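/- **Setting.** Let $P\subset\mathbb R^2$ be a finite set of $n$ points and $C\subset\mathbb R^2$ a convex body (non-empty, compact, convex), given by a separation oracle: for a query $q\in\mathbb R^2$ it either reports $q\in C$, or it returns a closed half-plane $h$ with $C\subseteq h$ and $q\notin h$. *Classifying* $P$ means determining $P\cap C$ and $P\setminus C$. **Separation price.** A closed convex polygon is a finite intersection of closed half-planes (it may be unbounded or degenerate). An inner fence is a closed convex polygon $F_{\rm in}\subseteq C$ with $F_{\rm in}\cap P=C\cap P$ and the fewest vertices; an outer fence is a closed convex polygon $F_{\rm out}\supseteq C$ with $F_{\rm out}\cap P=C\cap P$ and the fewest vertices. $\varpi(P,C)$ is the number of vertices of $F_{\rm in}$ plus the number of vertices of $F_{\rm out}$. **The algorithm.** It maintains an inner approximation $B$ (initially $\emptyset$) and the set $U$ of unclassified points (initially $P$). After a query $q$: if $q\in C$, replace $B$ by $\mathrm{conv}(B\cup\{q\})$ and mark the points of $U\cap B$ as inside; otherwise mark the points of $U\setminus h$ as outside, where $h$ is the returned half-plane; marked points leave $U$. A *round* on a set $S$ of points queries a point of $S$ if $|S|<3$ and otherwise a centerpoint of $S$ (a point such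 that every closed half-plane containing it contains at least $|S|/3$ points of $S$). 1. While $B=\emptyset$ and $U\ne\emptyset$, perform rounds on $U$. If $U$ is empty and $B$ still empty, finish. 2. *Directional climbs*, first for the positive and then for the negative $x$-direction: as long as some point of $U$ lies strictly beyond the line perpendicular to that direction supporting $B$ there, perform a round on the set of all these points. 3. Points above $B$. Let $X$ be the set of $x$-coordinates of the vertices of the top chain of $B$. For every $t\in X$, *clean* the vertical line $\ell=\{x=t\}$: let $I$ be the set of points of $\ell$ above $B$ that are the unique intersection point of $\ell$ with the affine span of $\{p,r\}$ for some $p,r\in P$ ($p=r$ allowed); while $I\neq\emptyset$, query a median of $I$ and delete from $I$ the points covered by the new $B$ or excluded by the returned half-plane. 4. A *vertical pocket* consists of the unclassified points above $B$ with $x$-coordinate strictly between two consecutive elements $a<b$ of $X$. As long as there is a non-empty pocket, pick one. If it has fewer than three points, query a point of it. Otherwise query a centerpoint $q$ of its points; if $q\in C$, add the $x$-coordinate of $q$ to $X$ and clean the vertical line through $q$, which splits the pocket. 5. Treat the points below $B$ symmetrically (as in 3 and 4, with the bottom chain), and finish. All choices left open above (centerpoints, medians, pockets, order of lines, points queried)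 are made arbitrarily. **Theorem.** There is an absolute constant $K>0$ such that for every finite $P\subset\mathbb R^2$ with $n$ points, every convex body $C$ and every separation oracle for $C$: - every run of the algorithm terminates, and upon termination exactly the points of $P\cap C$ are marked as inside and exactly the points of $P\setminus C$ as outside; - if $n\ge 2$, every run makes at most $K\,(1+\varpi(P,C))\log^2 n$ queries; - every deterministic adaptive query algorithm that classifies $P$ correctly against every convex body and every separation oracle for it makes at least $\varpi(P,C)$ queries on the given instance; and if it makes $k$ queries on the given instance and $n\ge2$, then every run of the algorithm above makes at most $K\,k\log^2 n$ queries, so the algorithm is an $O(\log^2 n)$-approximation to the optimal number of queries. -/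

import Mathlib

/-! ### Half-planes, separation oracles, query algorithms -/

/-- The Euclidean plane; `p 0` and `p 1` are the `x`- and `y`-coordinate of `p`. -/
abbrev Plane := EuclideanSpace ℝ (Fin 2)

/-- A closed half-plane `{x | ⟪normal, x⟫ ≤ offset}`. -/
structure HalfPlane where
  normal : Plane
  offset : ℝ
  normal_ne_zero : normal ≠ 0

def HalfPlane.carrier (h : HalfPlane) : Set Plane :=
  {x | inner ℝ h.normal x ≤ h.offset}

/-- An answer of a separation oracle: the query is in the body, or it is outside, with a closed
half-plane that contains the body and misses the query (its boundary line separates the two). -/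
inductive Answer where
  | inside
  | outside (h : HalfPlane)

abbrev Oracle := Plane → Answer

/-- `O` is a separation oracle for `C`. -/
def IsSeparationOracle (O : Oracle) (C : Set Plane) : Prop :=
  ∀ q : Plane, match O q with
    | .inside => q ∈ C
    | .outside h => C ⊆ h.carrier ∧ q ∉ h.carrier

/-- A deterministic adaptive query algorithm (for a fixed known point set): from the answers
received so far it decides to ask one more query or to halt with an output set. -/
structure QueryAlgorithm where
  act : List Answer → Plane ⊕ Set Plane

/-- `A.Produces O l k S`: with oracle `O` and after having received the answers `l`, the algorithm
`A` makes exactly `k` further queries and then outputs `S`. -/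
inductive QueryAlgorithm.Produces (A : QueryAlgorithm) (O : Oracle) :
    List Answer → ℕ → Set Plane → Prop where
  | halt {l : List Answer} {S : Set Plane} :
      A.act l = Sum.inr S → A.Produces O l 0 S
  | ask {l : List Answer} {q : Plane} {k : ℕ} {S : Set Plane} :
      A.act l = Sum.inl q → A.Produces O (l ++ [O q]) k S → A.Produces O l (k + 1) S

/-- `A` classifies the points of `P` against every convex body, whatever the separation oracle. -/
def QueryAlgorithm.Classifies (A : QueryAlgorithm) (P : Finset Plane) : Prop :=
  ∀ (C : ConvexBody Plane) (O : Oracle), IsSeparationOracle O (C : Set Plane) →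
    ∃ k : ℕ, A.Produces O [] k ((P : Set Plane) ∩ (C : Set Plane))

/-! ### Fences and the separation price -/

/-- Closed convex polygons: finite intersections of closed half-planes. They may be unbounded
(the whole plane included) or degenerate (a segment, a point, the empty set). -/
def IsConvexPolygon (F : Set Plane) : Prop :=
  ∃ H : Set HalfPlane, H.Finite ∧ F = ⋂ h ∈ H, h.carrier

/-- The number of vertices of a convex polygon. -/
noncomputable def numVertices (F : Set Plane) : ℕ := (F.extremePoints ℝ).ncard

/-- The number of vertices of an inner fence: the fewest vertices of a closed convex polygon
inside `C` that contains the same points of `P` as `C`. -/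
noncomputable def innerFenceSize (P : Finset Plane) (C : Set Plane) : ℕ :=
  sInf {m | ∃ F : Set Plane, IsConvexPolygon F ∧ F ⊆ C ∧
    C ∩ (P : Set Plane) = F ∩ (P : Set Plane) ∧ numVertices F = m}

/-- The number of vertices of an outer fence: the fewest vertices of a closed convex polygon
around `C` that contains the same points of `P` as `C`. -/
noncomputable def outerFenceSize (P : Finset Plane) (C : Set Plane) : ℕ :=
  sInf {m | ∃ F : Set Plane, IsConvexPolygon F ∧ C ⊆ F ∧
    C ∩ (P : Set Plane) = F ∩ (P : Set Plane) ∧ numVertices F = m}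

/-- The separation price of `P` and `C`. -/
noncomputable def separationPrice (P : Finset Plane) (C : Set Plane) : ℕ :=
  innerFenceSize P C + outerFenceSize P C

/-! ### The improved algorithm

The algorithm is a transition system. It leaves some choices open (which centerpoint, which median,
which pocket, ...); a run is any sequence of transitions, so the choices are made arbitrarily. -/

/-- `c` is a centerpoint of `S`: every closed half-plane containing `c` contains at least a third
of the points of `S`. -/
def IsCenterpoint (S : Set Plane) (c : Plane) : Prop :=
  ∀ h : HalfPlane, c ∈ h.carrier → S.ncard ≤ 3 * (S ∩ h.carrier).ncard

/-- The query of a round on the point set `S`: one of the points if there are fewer than three of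
them, a centerpoint otherwise. -/
def IsRoundQuery (S : Set Plane) (q : Plane) : Prop :=
  (S.ncard < 3 ∧ q ∈ S) ∨ (3 ≤ S.ncard ∧ IsCenterpoint S q)

/-- The two directions of the `x`-axis. -/
inductive Direction where
  | right
  | left

/-- The coordinate along a direction. -/
def Direction.coord : Direction → Plane → ℝ
  | .right, p => p 0
  | .left, p => -p 0

/-- Whether the algorithm treats the points above or below the inner approximation. -/
inductive Side where
  | above
  | below

/-- The vertical coordinate, oriented towards the given side. -/
def Side.height : Side → Plane → ℝ
  | .above, p => p 1
  | .below, p => -p 1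

/-- `p` lies vertically above (below) the set `B`. -/
def Side.Over (d : Side) (B : Set Plane) (p : Plane) : Prop :=
  (∃ b ∈ B, b 0 = p 0) ∧ ∀ b ∈ B, b 0 = p 0 → d.height b < d.height p

/-- The vertices of the top (bottom) chain of the convex polygon `B`. -/
def Side.chain (d : Side) (B : Set Plane) : Set Plane :=
  {v | v ∈ B.extremePoints ℝ ∧ ∀ b ∈ B, b 0 = v 0 → d.height b ≤ d.height v}

/-- The points of interest on the vertical line `x = t`: the points above (below) `B` in which that
line is crossed by a line spanned by `P`. With `p = r` the span is the point `p` itself, so points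
of `P` on the vertical line are of interest. -/
def interestPoints (P : Finset Plane) (d : Side) (B : Set Plane) (t : ℝ) : Set Plane :=
  {u | d.Over B u ∧ ∃ p ∈ P, ∃ r ∈ P,
    (affineSpan ℝ {p, r} : Set Plane) ∩ {z | z 0 = t} = {u}}

/-- `u` is a median of the set `I` of points on a vertical line. -/
def IsMedian (d : Side) (I : Set Plane) (u : Plane) : Prop :=
  u ∈ I ∧ 2 * {z ∈ I | d.height z < d.height u}.ncard ≤ I.ncard ∧
    2 * {z ∈ I | d.height u < d.height z}.ncard ≤ I.ncard

/-- The stage of the computation. The set `walls` holds the `x`-coordinates of the vertical lines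
bounding the pockets on the current side, `todo` those among them that are still to be cleaned. -/
inductive Phase where
  /-- greedy rounds until the inner approximation is non-empty -/
  | seek
  /-- directional climb -/
  | climb (e : Direction)
  /-- cleaning of the initial lines, then treatment of the pockets on side `d` -/
  | sweep (d : Side) (todo walls : Set ℝ)
  /-- cleaning of one vertical line, with remaining points of interest `I` -/
  | clean (d : Side) (I : Set Plane) (todo walls : Set ℝ)
  | done

/-- A state of the algorithm: the stage, the inner approximation, the unclassified points, the
points marked as inside and as outside, the number of queries made. -/
structure State where
  phase : Phase
  inner : Set Plane
  unclassified : Set Plane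
  markedIn : Set Plane
  markedOut : Set Plane
  queries : ℕ

def State.initial (P : Finset Plane) : State where
  phase := .seek
  inner := ∅
  unclassified := P
  markedIn := ∅
  markedOut := ∅
  queries := 0

/-- Processing the answer to the query `q`: the operations *expand* and *remove*. -/
def State.learn (s : State) (q : Plane) : Answer → State
  | .inside =>
    { s with
      inner := convexHull ℝ (insert q s.inner)
      unclassified := s.unclassified \ convexHull ℝ (insert q s.inner)
      markedIn := s.markedIn ∪ (s.unclassified ∩ convexHull ℝ (insert q s.inner))
      queries := s.queries + 1 }
  | .outside h =>
    { s with
      unclassified := s.unclassified ∩ h.carrier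
      markedOut := s.markedOut ∪ (s.unclassified \ h.carrier)
      queries := s.queries + 1 }

/-- The points of interest that stay unclassified after an answer; `B` is the updated inner
approximation. -/
def Answer.remaining (I B : Set Plane) : Answer → Set Plane
  | .inside => I \ B
  | .outside h => I ∩ h.carrier

/-- The unclassified points beyond the tangent to the inner approximation in direction `e`. -/
def State.ahead (s : State) (e : Direction) : Set Plane :=
  {p ∈ s.unclassified | ∀ b ∈ s.inner, e.coord b < e.coord p}

/-- The unclassified points in the vertical pocket over (under) the interval `(a, b)`. -/
def State.pocket (s : State) (d : Side) (a b : ℝ) : Set Plane :=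
  {p ∈ s.unclassified | a < p 0 ∧ p 0 < b ∧ d.Over s.inner p}

/-- `a < b` are consecutive walls. -/
def Consecutive (walls : Set ℝ) (a b : ℝ) : Prop :=
  a ∈ walls ∧ b ∈ walls ∧ a < b ∧ ∀ t ∈ walls, t ≤ a ∨ b ≤ t

/-- The vertical lines through the vertices of the top (bottom) chain become the walls. -/
def State.startSide (s : State) (d : Side) : State :=
  { s with phase := .sweep d ((fun v : Plane => v 0) '' d.chain s.inner)
                            ((fun v : Plane => v 0) '' d.chain s.inner) }

/-- One transition of the improved algorithm on the points `P` with oracle `O`. -/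
inductive Step (P : Finset Plane) (O : Oracle) : State → State → Prop where
  /-- a greedy round while the inner approximation is empty -/
  | seekRound (s : State) (q : Plane) :
      s.phase = .seek → s.inner = ∅ → IsRoundQuery s.unclassified q →
      Step P O s (s.learn q (O q))
  | seekFail (s : State) :
      s.phase = .seek → s.inner = ∅ → s.unclassified = ∅ →
      Step P O s { s with phase := .done }
  | seekSuccess (s : State) :
      s.phase = .seek → s.inner.Nonempty →
      Step P O s { s with phase := .climb .right }
  /-- a round of a directional climb -/
  | climbRound (s : State) (e : Direction) (q : Plane) :
      s.phase = .climb e → IsRoundQuery (s.ahead e) q →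
      Step P O s (s.learn q (O q))
  | climbRightEnd (s : State) :
      s.phase = .climb .right → s.ahead .right = ∅ →
      Step P O s { s with phase := .climb .left }
  | climbLeftEnd (s : State) :
      s.phase = .climb .left → s.ahead .left = ∅ →
      Step P O s (s.startSide .above)
  /-- start cleaning one of the initial vertical lines -/
  | cleanStart (s : State) (d : Side) (todo walls : Set ℝ) (t : ℝ) :
      s.phase = .sweep d todo walls → t ∈ todo →
      Step P O s { s with phase := .clean d (interestPoints P d s.inner t) (todo \ {t}) walls }
  /-- one step of the binary search along the line being cleaned -/
  | cleanQuery (s : State) (d : Side) (I : Set Plane) (todo walls : Set ℝ) (u : Plane) :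
      s.phase = .clean d I todo walls → IsMedian d I u →
      Step P O s { s.learn u (O u) with
        phase := .clean d ((O u).remaining I (s.learn u (O u)).inner) todo walls }
  | cleanEnd (s : State) (d : Side) (todo walls : Set ℝ) :
      s.phase = .clean d ∅ todo walls →
      Step P O s { s with phase := .sweep d todo walls }
  /-- in a pocket with fewer than three points, query a point -/
  | pocketSmall (s : State) (d : Side) (walls : Set ℝ) (a b : ℝ) (q : Plane) :
      s.phase = .sweep d ∅ walls → Consecutive walls a b →
      (s.pocket d a b).ncard < 3 → q ∈ s.pocket d a b →
      Step P O s (s.learn q (O q))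
  /-- in a larger pocket, query a centerpoint; if it is outside, continue ... -/
  | pocketOutside (s : State) (d : Side) (walls : Set ℝ) (a b : ℝ) (q : Plane) (h : HalfPlane) :
      s.phase = .sweep d ∅ walls → Consecutive walls a b →
      3 ≤ (s.pocket d a b).ncard → IsCenterpoint (s.pocket d a b) q → O q = .outside h →
      Step P O s (s.learn q (O q))
  /-- ... and if it is inside, clean the vertical line through it, which splits the pocket -/
  | pocketSplit (s : State) (d : Side) (walls : Set ℝ) (a b : ℝ) (q : Plane) :
      s.phase = .sweep d ∅ walls → Consecutive walls a b →
      3 ≤ (s.pocket d a b).ncard → IsCenterpoint (s.pocket d a b) q → O q = .inside →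
      Step P O s { s.learn q (O q) with
        phase := .clean d (interestPoints P d (s.learn q (O q)).inner (q 0)) ∅
          (insert (q 0) walls) }
  /-- no pocket is left above: treat the points below in the same way -/
  | aboveEnd (s : State) (walls : Set ℝ) :
      s.phase = .sweep .above ∅ walls →
      (∀ a b, Consecutive walls a b → s.pocket .above a b = ∅) →
      Step P O s (s.startSide .below)
  /-- no pocket is left below: finish -/
  | belowEnd (s : State) (walls : Set ℝ) :
      s.phase = .sweep .below ∅ walls →
      (∀ a b, Consecutive walls a b → s.pocket .below a b = ∅) →
      Step P O s { s with phase := .done }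

/-- `s` occurs in some run of the improved algorithm on the points `P` with oracle `O`. -/
def Reachable (P : Finset Plane) (O : Oracle) (s : State) : Prop :=
  Relation.ReflTransGen (Step P O) (State.initial P) s

/-! Upper bound. Progress is measured by `pot m = ⌊log₂ (2m²)⌋`, which drops by at least one
whenever a nonempty set shrinks to two thirds of its size. Rounds achieve this: a returned
half-plane misses the query, hence keeps at most two thirds of the set, and a positive answer during
a climb puts everything not beyond the query behind the new tangent. Seeking and the two climbs
therefore cost at most `3 * pot n` queries. Afterwards every unclassified point has an abscissa
covered by `B`, and `B` has at most `3 * pot n` vertices, so a side starts with at most that many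
walls.

On one side an amortized account (`SweepState.cost`) reserves `pot (n ^ 2)` for each line still to
be cleaned, since it has at most `n ^ 2` points of interest and a median query halves them, and the
potential of its point set for each pocket. Every query is paid for by falling potential, except a
positive answer at the centerpoint of a pocket. Such a split adds a wall, a pocket and a line to
clean, at a price of `splitCost n = O(log n)`. Everything thus rests on bounding the splits by `(2w
+ 1) * pot n`, where `w ≤ ϖ(P, C)` counts the abscissas of the vertices of an inner fence `F` and an
outer fence `G`.

Splits are charged to fence vertices. Suppose that a pocket over `(a, b)` is split
(`pocket_active`). If none of its points is in `C`, all of them avoid `G`; were `G` bounded over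
`(a, b)` by a single line, the centerpoint would be beyond that line although it lies in `C`, so `G`
has a vertex over `(a, b)`. If some point `p` of the pocket is in `C`, it is a witness: a line
through `p` and another point of `P` that stays below the top of `C` at both walls meets the walls
in points of interest, or below `B`. As the walls have been cleaned, the line is below the top of
`B` at both walls, hence also at `p`, which is absurd. Two witnesses `p`, `p'` in separate pockets
force a vertex of `F` between the outer walls (`PocketWitness.exists_vertex`): the segment `pp'` is
in `C`, so its line is below the top of `C` at the two inner walls, and if `F` had only one edge
there, the line would be below the top of `F` at one of the outer walls, against one of the
witnesses. Nested splits shrink by a factor 2/3, so splits of equal potential have non-overlapping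
intervals, and `card_splits_le` counts them.

Queries above `B` create no vertices in the bottom chain (`chain_opposite_insert_subset`), so the
second side starts with as few walls as the first. Termination follows from the bound on queries,
because only boundedly many consecutive transitions make no query.

Lower bound. A correct algorithm cannot distinguish bodies that are consistent with its answers.
Hence the hull of the positive queries is an inner fence and the intersection of the returned
half-planes an outer fence, apart from a degenerate case without positive answers; a polygon has at
most as many vertices as defining half-planes. -/

/-! ### Coordinates -/

/-- The point with the given coordinates. -/
noncomputable def mkPt (x y : ℝ) : Plane := !₂[x, y]

@[simp] lemma mkPt_zero (x y : ℝ) : mkPt x y 0 = x := rfl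

@[simp] lemma mkPt_one (x y : ℝ) : mkPt x y 1 = y := rfl

lemma Plane.ext {p q : Plane} (h0 : p 0 = q 0) (h1 : p 1 = q 1) : p = q := by
  ext i; fin_cases i <;> assumption

lemma inner_plane (p q : Plane) : inner ℝ p q = p 0 * q 0 + p 1 * q 1 := by
  simp [PiLp.inner_apply, Fin.sum_univ_two, mul_comm]

lemma HalfPlane.mem_carrier {h : HalfPlane} {x : Plane} :
    x ∈ h.carrier ↔ h.normal 0 * x 0 + h.normal 1 * x 1 ≤ h.offset := by
  simp [HalfPlane.carrier, inner_plane]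

lemma HalfPlane.normal_coord_ne_zero (h : HalfPlane) : h.normal 0 ≠ 0 ∨ h.normal 1 ≠ 0 := by
  by_contra hc
  push Not at hc
  exact h.normal_ne_zero (Plane.ext hc.1 hc.2)

/-- The half-plane `a x + b y ≤ c`. -/
noncomputable def HalfPlane.ofCoeffs (a b c : ℝ) (hab : a ≠ 0 ∨ b ≠ 0) : HalfPlane where
  normal := mkPt a b
  offset := c
  normal_ne_zero := by
    intro h
    have h0 : mkPt a b 0 = 0 := by rw [h]; rfl
    have h1 : mkPt a b 1 = 0 := by rw [h]; rfl
    simp only [mkPt_zero, mkPt_one] at h0 h1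
    tauto

lemma HalfPlane.mem_ofCoeffs {a b c : ℝ} {hab : a ≠ 0 ∨ b ≠ 0} {x : Plane} :
    x ∈ (HalfPlane.ofCoeffs a b c hab).carrier ↔ a * x 0 + b * x 1 ≤ c := by
  rw [HalfPlane.mem_carrier]; rfl

lemma HalfPlane.convex (h : HalfPlane) : Convex ℝ h.carrier := by
  intro x hx y hy s t hs ht hst
  rw [HalfPlane.mem_carrier] at *
  simp only [PiLp.add_apply, PiLp.smul_apply, smul_eq_mul]
  have h1 : s * h.offset + t * h.offset = h.offset := by rw [← add_mul, hst, one_mul]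
  have h2 := mul_le_mul_of_nonneg_left hx hs
  have h3 := mul_le_mul_of_nonneg_left hy ht
  linarith

lemma HalfPlane.isClosed (h : HalfPlane) : IsClosed h.carrier := by
  have : Continuous fun x : Plane => inner ℝ h.normal x := by fun_prop
  exact isClosed_le this continuous_const

/-! ### Abscissa and height, treating both sides uniformly -/

/-- The vertical direction towards a side. -/
def Side.sign : Side → ℝ
  | .above => 1
  | .below => -1

lemma Side.height_eq (d : Side) (p : Plane) : d.height p = d.sign * p 1 := by
  cases d <;> simp [Side.height, Side.sign]

lemma Side.sign_mul_self (d : Side) : d.sign * d.sign = 1 := by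
  cases d <;> simp [Side.sign]

lemma Side.eq_of_height_eq (d : Side) {p q : Plane} (h0 : p 0 = q 0)
    (h1 : d.height p = d.height q) : p = q := by
  refine Plane.ext h0 ?_
  cases d <;> simpa [Side.height] using h1

/-- The point with a given abscissa and a given height towards the side. -/
noncomputable def Side.pt (d : Side) (x y : ℝ) : Plane := mkPt x (d.sign * y)

@[simp] lemma Side.pt_zero (d : Side) (x y : ℝ) : d.pt x y 0 = x := rfl

@[simp] lemma Side.height_pt (d : Side) (x y : ℝ) : d.height (d.pt x y) = y := by
  rw [Side.height_eq, Side.pt, mkPt_one, ← mul_assoc, Side.sign_mul_self, one_mul]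

lemma Side.height_add_smul (d : Side) (p q : Plane) (s t : ℝ) :
    d.height (s • p + t • q) = s * d.height p + t * d.height q := by
  simp only [Side.height_eq, PiLp.add_apply, PiLp.smul_apply, smul_eq_mul]; ring

lemma add_smul_zero (p q : Plane) (s t : ℝ) : (s • p + t • q) 0 = s * p 0 + t * q 0 := by
  simp

/-- A half-plane in terms of abscissa and height. -/
lemma HalfPlane.mem_carrier_height {h : HalfPlane} (d : Side) {x : Plane} :
    x ∈ h.carrier ↔ h.normal 0 * x 0 + d.height h.normal * d.height x ≤ h.offset := by
  rw [HalfPlane.mem_carrier, Side.height_eq, Side.height_eq]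
  have : d.sign * h.normal 1 * (d.sign * x 1) = h.normal 1 * x 1 := by
    rw [show d.sign * h.normal 1 * (d.sign * x 1) = d.sign * d.sign * (h.normal 1 * x 1) by ring,
      Side.sign_mul_self, one_mul]
  rw [this]

/-- The closed half-plane of the points not above the line `y = m x + k`. -/
noncomputable def Side.belowLine (d : Side) (m k : ℝ) : HalfPlane :=
  HalfPlane.ofCoeffs (-m) d.sign k (Or.inr (by cases d <;> norm_num [Side.sign]))

lemma Side.mem_belowLine {d : Side} {m k : ℝ} {x : Plane} :
    x ∈ (d.belowLine m k).carrier ↔ d.height x ≤ m * x 0 + k := by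
  rw [Side.belowLine, HalfPlane.mem_ofCoeffs, ← Side.height_eq]
  constructor <;> intro h <;> linarith

/-- The point of a convex set at a given abscissa on a segment given as a graph. -/
lemma Convex.exists_mem_line {X : Set Plane} (hX : Convex ℝ X) (d : Side) {u v : Plane}
    (hu : u ∈ X) (hv : v ∈ X) {m k : ℝ} (hul : d.height u = m * u 0 + k)
    (hvl : d.height v = m * v 0 + k) {x : ℝ} (h1 : u 0 ≤ x) (h2 : x ≤ v 0) :
    ∃ z ∈ X, z 0 = x ∧ d.height z = m * x + k := by
  rcases eq_or_lt_of_le (h1.trans h2) with h | h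
  · have hx : u 0 = x := by linarith
    exact ⟨u, hu, hx, by rw [hul, hx]⟩
  · refine ⟨((v 0 - x) / (v 0 - u 0)) • u + ((x - u 0) / (v 0 - u 0)) • v, hX hu hv
      (div_nonneg (by linarith) (by linarith)) (div_nonneg (by linarith) (by linarith)) ?_, ?_, ?_⟩
    · have : v 0 - u 0 ≠ 0 := by linarith
      field_simp; ring
    · have : v 0 - u 0 ≠ 0 := by linarith
      rw [add_smul_zero]; field_simp; ring
    · have : v 0 - u 0 ≠ 0 := by linarith
      rw [Side.height_add_smul, hul, hvl]; field_simp; ring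

/-- On a vertical line a convex set is an interval. -/
lemma Convex.mem_of_height_between {X : Set Plane} (hX : Convex ℝ X) (d : Side) {u v z : Plane}
    (hu : u ∈ X) (hv : v ∈ X) (hu0 : u 0 = z 0) (hv0 : v 0 = z 0)
    (h1 : d.height u ≤ d.height z) (h2 : d.height z ≤ d.height v) : z ∈ X := by
  rcases eq_or_lt_of_le (h1.trans h2) with h | h
  · rwa [← d.eq_of_height_eq hu0 (by linarith)]
  · have hne : d.height v - d.height u ≠ 0 := by linarith
    have : z = ((d.height v - d.height z) / (d.height v - d.height u)) • u +
        ((d.height z - d.height u) / (d.height v - d.height u)) • v := by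
      refine d.eq_of_height_eq ?_ ?_
      · rw [add_smul_zero, hu0, hv0]; field_simp; ring
      · rw [Side.height_add_smul]; field_simp; ring
    rw [this]
    exact hX hu hv (div_nonneg (by linarith) (by linarith)) (div_nonneg (by linarith) (by linarith))
      (by field_simp; ring)

/-- Two points of a convex set can be joined by a graph over their abscissas. -/
lemma Convex.exists_mem_abscissa {X : Set Plane} (hX : Convex ℝ X) {u v : Plane}
    (hu : u ∈ X) (hv : v ∈ X) {x : ℝ} (h1 : u 0 ≤ x) (h2 : x ≤ v 0) : ∃ z ∈ X, z 0 = x := by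
  rcases eq_or_lt_of_le (h1.trans h2) with h | h
  · exact ⟨u, hu, by linarith⟩
  · have hne : v 0 - u 0 ≠ 0 := by linarith
    obtain ⟨z, hz, hz0, -⟩ := hX.exists_mem_line .above hu hv
      (m := (Side.above.height v - Side.above.height u) / (v 0 - u 0))
      (k := Side.above.height u - (Side.above.height v - Side.above.height u) / (v 0 - u 0) * u 0)
      (by ring) (by field_simp; ring) h1 h2
    exact ⟨z, hz, hz0⟩

/-! ### Convex hulls of finite sets are polygons -/

/-- Solution sets of finite systems of linear inequalities. -/
def IsPolyhedral (F : Set Plane) : Prop :=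
  ∃ T : Finset (ℝ × ℝ × ℝ), F = {z | ∀ c ∈ T, c.1 * z 0 + c.2.1 * z 1 ≤ c.2.2}

lemma isConvexPolygon_empty : IsConvexPolygon ∅ := by
  refine ⟨{HalfPlane.ofCoeffs 1 0 0 (by simp), HalfPlane.ofCoeffs (-1) 0 (-1) (by simp)},
    by simp, ?_⟩
  refine (Set.eq_empty_iff_forall_notMem.2 fun z hz => ?_).symm
  simp only [Set.mem_insert_iff, Set.mem_singleton_iff, Set.iInter_iInter_eq_or_left,
    Set.iInter_iInter_eq_left, Set.mem_inter_iff, HalfPlane.mem_ofCoeffs] at hz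
  linarith [hz.1, hz.2]

/-- The two notions differ only in rows with zero normal, which are not half-planes. When `F` is
nonempty such rows are true everywhere and can be dropped. -/
lemma IsPolyhedral.isConvexPolygon {F : Set Plane} (hF : IsPolyhedral F) : IsConvexPolygon F := by
  classical
  rcases F.eq_empty_or_nonempty with rfl | ⟨z₀, hz₀⟩
  · exact isConvexPolygon_empty
  obtain ⟨T, rfl⟩ := hF
  refine ⟨{h | (h.normal 0, h.normal 1, h.offset) ∈ T}, ?_, ?_⟩
  · refine Set.Finite.of_injOn (f := fun h : HalfPlane => (h.normal 0, h.normal 1, h.offset))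
      (t := (T : Set (ℝ × ℝ × ℝ))) (fun h hh => hh) ?_ T.finite_toSet
    rintro ⟨n, o, hn⟩ - ⟨n', o', hn'⟩ - h
    simp only [Prod.mk.injEq] at h
    obtain rfl : n = n' := Plane.ext h.1 h.2.1
    obtain rfl : o = o' := h.2.2
    rfl
  · ext z
    simp only [Set.mem_ofPred_eq, Set.mem_iInter, HalfPlane.mem_carrier]
    refine ⟨fun h g hg => h _ hg, fun h c hc => ?_⟩
    by_cases h0 : c.1 ≠ 0 ∨ c.2.1 ≠ 0
    · exact h (HalfPlane.ofCoeffs c.1 c.2.1 c.2.2 h0) hc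
    · push Not at h0
      have := hz₀ c hc
      rw [h0.1, h0.2] at this ⊢
      linarith

/-- Fourier–Motzkin elimination of one variable. -/
lemma isPolyhedral_exists (T : Finset (ℝ × ℝ × ℝ × ℝ))
    (hlo : ∃ c ∈ T, 0 < c.2.2.2) :
    IsPolyhedral {z : Plane | ∃ t : ℝ, ∀ c ∈ T,
      c.1 * z 0 + c.2.1 * z 1 ≤ c.2.2.1 + t * c.2.2.2} := by
  classical
  let Z : Finset (ℝ × ℝ × ℝ) := (T.filter fun c => c.2.2.2 = 0).image
    fun c => (c.1, c.2.1, c.2.2.1)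
  let W : Finset (ℝ × ℝ × ℝ) :=
    ((T.filter fun c => 0 < c.2.2.2) ×ˢ (T.filter fun c => c.2.2.2 < 0)).image fun e =>
      (e.1.1 / e.1.2.2.2 - e.2.1 / e.2.2.2.2, e.1.2.1 / e.1.2.2.2 - e.2.2.1 / e.2.2.2.2,
        e.1.2.2.1 / e.1.2.2.2 - e.2.2.2.1 / e.2.2.2.2)
  refine ⟨Z ∪ W, ?_⟩
  ext z
  let f : ℝ × ℝ × ℝ × ℝ → ℝ := fun c => (c.1 * z 0 + c.2.1 * z 1 - c.2.2.1) / c.2.2.2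
  have hpos : ∀ c : ℝ × ℝ × ℝ × ℝ, 0 < c.2.2.2 → ∀ t : ℝ,
      (c.1 * z 0 + c.2.1 * z 1 ≤ c.2.2.1 + t * c.2.2.2 ↔ f c ≤ t) := by
    intro c hc t
    rw [div_le_iff₀ hc]
    constructor <;> intro h <;> linarith
  have hneg : ∀ c : ℝ × ℝ × ℝ × ℝ, c.2.2.2 < 0 → ∀ t : ℝ,
      (c.1 * z 0 + c.2.1 * z 1 ≤ c.2.2.1 + t * c.2.2.2 ↔ t ≤ f c) := by
    intro c hc t
    rw [le_div_iff_of_neg hc]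
    constructor <;> intro h <;> linarith
  have hW : (∀ c ∈ W, c.1 * z 0 + c.2.1 * z 1 ≤ c.2.2) ↔
      ∀ c ∈ T, 0 < c.2.2.2 → ∀ e ∈ T, e.2.2.2 < 0 → f c ≤ f e := by
    have key : ∀ c e : ℝ × ℝ × ℝ × ℝ, ((c.1 / c.2.2.2 - e.1 / e.2.2.2) * z 0 +
        (c.2.1 / c.2.2.2 - e.2.1 / e.2.2.2) * z 1 ≤
        c.2.2.1 / c.2.2.2 - e.2.2.1 / e.2.2.2 ↔ f c ≤ f e) := by
      intro c e
      simp only [f, sub_div, add_div, mul_div_right_comm]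
      constructor <;> intro h <;> linarith
    constructor
    · intro h c hc hc' e he he'
      refine (key c e).1 (h _ (Finset.mem_image.2 ⟨(c, e), ?_, rfl⟩))
      simp [hc, hc', he, he']
    · intro h c hc
      obtain ⟨⟨c, e⟩, hce, rfl⟩ := Finset.mem_image.1 hc
      simp only [Finset.mem_product, Finset.mem_filter] at hce
      exact (key c e).2 (h c hce.1.1 hce.1.2 e hce.2.1 hce.2.2)
  have hZ : (∀ c ∈ Z, c.1 * z 0 + c.2.1 * z 1 ≤ c.2.2) ↔
      ∀ c ∈ T, c.2.2.2 = 0 → c.1 * z 0 + c.2.1 * z 1 ≤ c.2.2.1 := by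
    constructor
    · intro h c hc hc'
      exact h (c.1, c.2.1, c.2.2.1)
        (Finset.mem_image.2 ⟨c, Finset.mem_filter.2 ⟨hc, hc'⟩, rfl⟩)
    · intro h c hc
      obtain ⟨e, he, rfl⟩ := Finset.mem_image.1 hc
      exact h e (Finset.mem_filter.1 he).1 (Finset.mem_filter.1 he).2
  have hZW : (∀ c ∈ Z ∪ W, c.1 * z 0 + c.2.1 * z 1 ≤ c.2.2) ↔
      (∀ c ∈ Z, c.1 * z 0 + c.2.1 * z 1 ≤ c.2.2) ∧
        ∀ c ∈ W, c.1 * z 0 + c.2.1 * z 1 ≤ c.2.2 := by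
    simp only [Finset.mem_union, or_imp, forall_and]
  simp only [Set.mem_ofPred_eq]
  rw [hZW, hZ, hW]
  constructor
  · rintro ⟨t, ht⟩
    refine ⟨fun c hc hc0 => by simpa [hc0] using ht c hc, fun c hc hc' e he he' => ?_⟩
    exact ((hpos c hc' t).1 (ht c hc)).trans ((hneg e he' t).1 (ht e he))
  · rintro ⟨h0, h1⟩
    have hne : (T.filter fun c => 0 < c.2.2.2).Nonempty := by
      obtain ⟨c, hc, hc'⟩ := hlo
      exact ⟨c, Finset.mem_filter.2 ⟨hc, hc'⟩⟩
    -- The witness for `t` is the largest of the lower bounds; `hlo` guarantees that there is one.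
    refine ⟨(T.filter fun c => 0 < c.2.2.2).sup' hne f, fun c hc => ?_⟩
    rcases lt_trichotomy c.2.2.2 0 with hc0 | hc0 | hc0
    · rw [hneg c hc0]
      refine Finset.sup'_le _ _ fun e he => ?_
      exact h1 e (Finset.mem_filter.1 he).1 (Finset.mem_filter.1 he).2 c hc hc0
    · rw [hc0, mul_zero, add_zero]; exact h0 c hc hc0
    · rw [hpos c hc0]
      exact Finset.le_sup' f (Finset.mem_filter.2 ⟨hc, hc0⟩)

lemma isPolyhedral_singleton (q : Plane) : IsPolyhedral {q} := by
  refine ⟨{(1, 0, q 0), (-1, 0, -q 0), (0, 1, q 1), (0, -1, -q 1)}, ?_⟩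
  ext z
  simp only [Set.mem_singleton_iff, Finset.mem_insert, Finset.mem_singleton, forall_eq_or_imp,
    forall_eq, Set.mem_ofPred_eq]
  constructor
  · rintro rfl; refine ⟨?_, ?_, ?_, ?_⟩ <;> linarith
  · rintro ⟨h1, h2, h3, h4⟩
    exact Plane.ext (by linarith) (by linarith)

/-- For `z = q + t (y - q)` the rows of `F` at `y`, multiplied by `t`, become linear in `(z, t)`, so
the union of the segments is a projection along `t`. Boundedness is needed at `t = 0`, where the
scaled rows only say that `z - q` is a direction of recession. -/
lemma IsPolyhedral.segments {F : Set Plane} (hF : IsPolyhedral F) (hne : F.Nonempty)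
    (hb : Bornology.IsBounded F) (q : Plane) :
    IsPolyhedral {z | ∃ y ∈ F, z ∈ segment ℝ q y} := by
  classical
  obtain ⟨T, rfl⟩ := hF
  set F : Set Plane := {z | ∀ c ∈ T, c.1 * z 0 + c.2.1 * z 1 ≤ c.2.2} with hFdef
  -- The first two rows say `0 ≤ t` and `t ≤ 1`.
  let S : Finset (ℝ × ℝ × ℝ × ℝ) := insert (0, 0, 0, 1) (insert (0, 0, 1, -1)
    (T.image fun c => (c.1, c.2.1, c.1 * q 0 + c.2.1 * q 1,
      c.2.2 - (c.1 * q 0 + c.2.1 * q 1))))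
  have hS := isPolyhedral_exists S ⟨(0, 0, 0, 1), by simp [S], by simp⟩
  convert hS using 1
  ext z
  simp only [Set.mem_ofPred_eq, S, Finset.forall_mem_insert, Finset.forall_mem_image]
  constructor
  · rintro ⟨y, hy, a, b, ha, hb', hab, rfl⟩
    refine ⟨b, by simpa using hb', by simp; linarith, fun c hc => ?_⟩
    have h1 := mul_le_mul_of_nonneg_left (hy c hc) hb'
    have h2 : a = 1 - b := by linarith
    subst h2
    simp only [PiLp.add_apply, PiLp.smul_apply, smul_eq_mul]
    nlinarith
  · rintro ⟨t, ht0, ht1, ht⟩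
    have ht0' : 0 ≤ t := by linarith
    have ht1' : t ≤ 1 := by linarith
    rcases ht0'.eq_or_lt with rfl | htpos
    · -- the direction `z - q` is a direction of recession
      obtain ⟨y, hy⟩ := hne
      refine ⟨y, hy, ?_⟩
      have hray : ∀ r : ℝ, 0 ≤ r → y + r • (z - q) ∈ F := by
        intro r hr c hc
        have h1 := ht hc
        have h2 := hy c hc
        simp only [PiLp.add_apply, PiLp.smul_apply, PiLp.sub_apply, smul_eq_mul]
        have h3 : c.1 * (z 0 - q 0) + c.2.1 * (z 1 - q 1) ≤ 0 := by linarith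
        have := mul_le_mul_of_nonneg_left h3 hr
        nlinarith
      obtain ⟨M, hM⟩ := hb.exists_norm_le
      have hzq : z = q := by
        by_contra hne'
        have hpos : 0 < ‖z - q‖ := norm_pos_iff.2 (sub_ne_zero.2 hne')
        have hM0 : 0 ≤ M := (norm_nonneg _).trans (hM y hy)
        have h := hM _ (hray ((2 * M + 1) / ‖z - q‖) (by positivity))
        have h2 : ‖((2 * M + 1) / ‖z - q‖) • (z - q)‖ = 2 * M + 1 := by
          rw [norm_smul, Real.norm_of_nonneg (by positivity)]; field_simp
        have h3 := norm_sub_le (y + ((2 * M + 1) / ‖z - q‖) • (z - q)) y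
        rw [add_sub_cancel_left, h2] at h3
        linarith [hM y hy]
      rw [hzq]; exact left_mem_segment ℝ q y
    · refine ⟨q + t⁻¹ • (z - q), fun c hc => ?_, 1 - t, t, by linarith, ht0', by ring, ?_⟩
      · have h1 := ht hc
        simp only [PiLp.add_apply, PiLp.smul_apply, PiLp.sub_apply, smul_eq_mul]
        have h2 : t⁻¹ * (c.1 * (z 0 - q 0) + c.2.1 * (z 1 - q 1)) ≤
            c.2.2 - (c.1 * q 0 + c.2.1 * q 1) := by
          rw [inv_mul_le_iff₀ htpos]
          linarith
        linarith
      · rw [smul_add, smul_smul, mul_inv_cancel₀ htpos.ne', one_smul, sub_smul, one_smul]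
        abel

/-- Adding a point to a hull means taking all segments from the new point to the old hull. -/
lemma isPolyhedral_convexHull (S : Finset Plane) (hS : S.Nonempty) :
    IsPolyhedral (convexHull ℝ (S : Set Plane)) := by
  classical
  induction hS using Finset.Nonempty.cons_induction with
  | singleton a => simpa using isPolyhedral_singleton a
  | cons a s ha hs ih =>
    rw [Finset.coe_cons, convexHull_insert (by simpa using hs), convexJoin_singleton_left]
    have := ih.segments (by simpa using hs) ((isBounded_convexHull).2 s.finite_toSet.isBounded) a
    convert this using 1
    ext z
    simp

lemma isConvexPolygon_convexHull (S : Finset Plane) :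
    IsConvexPolygon (convexHull ℝ (S : Set Plane)) := by
  rcases S.eq_empty_or_nonempty with rfl | hS
  · simpa using isConvexPolygon_empty
  · exact (isPolyhedral_convexHull S hS).isConvexPolygon

/-! ### Vertices of polygons -/

/-- A point of an intersection of finitely many half-planes at which all tight constraints are
constant in some direction is not a vertex. -/
lemma not_extreme_of_direction {H : Set HalfPlane} (hH : H.Finite) {v w : Plane} (hw : w ≠ 0)
    (hv : v ∈ ⋂ h ∈ H, h.carrier)
    (hvw : ∀ h ∈ H, inner ℝ h.normal v = h.offset → inner ℝ h.normal w = 0) :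
    v ∉ (⋂ h ∈ H, h.carrier).extremePoints ℝ := by
  intro hext
  have hmem : ∀ h ∈ H, inner ℝ h.normal v ≤ h.offset := by
    simpa [HalfPlane.carrier] using hv
  obtain ⟨ε, hε, hball⟩ : ∃ ε : ℝ, 0 < ε ∧ ∀ h ∈ H, ∀ t : ℝ, |t| ≤ ε →
      inner ℝ h.normal (v + t • w) ≤ h.offset := by
    have : ∀ h ∈ H, ∀ᶠ t : ℝ in nhds 0, inner ℝ h.normal (v + t • w) ≤ h.offset := by
      intro h hh
      rcases (hmem h hh).eq_or_lt with he | hlt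
      · refine Filter.Eventually.of_forall fun t => ?_
        rw [inner_add_right, inner_smul_right, hvw h hh he, he]; simp
      · have hc : ContinuousAt (fun t : ℝ => inner ℝ h.normal (v + t • w)) 0 := by fun_prop
        have := hc.eventually_lt (continuousAt_const (y := h.offset)) (by simpa using hlt)
        exact this.mono fun t ht => ht.le
    have hall := (Filter.eventually_all_finite hH).2 this
    obtain ⟨ε, hε, h⟩ := Metric.eventually_nhds_iff.1 hall
    refine ⟨ε / 2, by positivity, fun g hg t ht => h ?_ g hg⟩
    rw [Real.dist_eq, sub_zero]; linarith
  have hin : ∀ t : ℝ, |t| ≤ ε → v + t • w ∈ ⋂ h ∈ H, h.carrier := by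
    intro t ht
    simp only [Set.mem_iInter]
    exact fun h hh => hball h hh t ht
  -- `v` is the midpoint of `v + ε • w` and `v - ε • w`, both in the polygon.
  have h1 := hin ε (abs_of_pos hε).le
  have h2 := hin (-ε) (by rw [abs_neg]; exact (abs_of_pos hε).le)
  have h3 := (mem_extremePoints.1 hext).2 _ h1 _ h2
    ⟨1 / 2, 1 / 2, by norm_num, by norm_num, by norm_num, by module⟩
  have h4 : ε • w = 0 := by simpa using h3.1
  rcases smul_eq_zero.1 h4 with h | h
  · exact hε.ne' h
  · exact hw h

lemma exists_perp (n : Plane) : ∃ w : Plane, w ≠ 0 ∧ inner ℝ n w = 0 := by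
  by_cases hn : n = 0
  · refine ⟨mkPt 1 0, fun h => ?_, by simp [hn]⟩
    have := congrArg (fun p : Plane => p 0) h
    simp at this
  · refine ⟨mkPt (-n 1) (n 0), fun h => hn (Plane.ext ?_ ?_), by simp [inner_plane]; ring⟩
    · simpa using congrArg (fun p : Plane => p 1) h
    · simpa using congrArg (fun p : Plane => p 0) h

/-- A line contains at most two vertices of a convex set. -/
lemma card_extreme_on_line_le {G : Set Plane} (h : HalfPlane) (E : Finset Plane)
    (hE : ∀ v ∈ E, v ∈ G.extremePoints ℝ ∧ inner ℝ h.normal v = h.offset) : E.card ≤ 2 := by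
  by_contra hc
  obtain ⟨a, ha, b, hb, c, hc', hab, hac, hbc⟩ := Finset.two_lt_card.1 (not_le.1 hc)
  have hcol : Collinear ℝ ({a, b, c} : Set Plane) := by
    rw [collinear_iff_of_mem (p₀ := a) (by simp)]
    refine ⟨mkPt (-h.normal 1) (h.normal 0), ?_⟩
    have hq : h.normal 0 ^ 2 + h.normal 1 ^ 2 ≠ 0 := by
      rcases h.normal_coord_ne_zero with h0 | h0 <;> positivity
    have key : ∀ p ∈ E, ∃ r : ℝ, p = r • mkPt (-h.normal 1) (h.normal 0) +ᵥ a := by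
      intro p hp
      have e1 := (hE p hp).2
      have e2 := (hE a ha).2
      rw [inner_plane] at e1 e2
      refine ⟨(-h.normal 1 * (p 0 - a 0) + h.normal 0 * (p 1 - a 1)) /
        (h.normal 0 ^ 2 + h.normal 1 ^ 2), Plane.ext ?_ ?_⟩
      · simp only [vadd_eq_add, PiLp.add_apply, PiLp.smul_apply, smul_eq_mul, mkPt_zero]
        field_simp
        linear_combination h.normal 0 * (e1 - e2)
      · simp only [vadd_eq_add, PiLp.add_apply, PiLp.smul_apply, smul_eq_mul, mkPt_one]
        field_simp
        linear_combination h.normal 1 * (e1 - e2)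
    intro p hp
    simp only [Set.mem_insert_iff, Set.mem_singleton_iff] at hp
    rcases hp with rfl | rfl | rfl
    · exact key _ ha
    · exact key _ hb
    · exact key _ hc'
  have key : ∀ x ∈ E, ∀ y ∈ E, ∀ z ∈ E, x ≠ y → y ≠ z → ¬ Wbtw ℝ x y z := by
    intro x hx y hy z hz hxy hyz hw
    have hs : y ∈ openSegment ℝ x z := by
      have : Sbtw ℝ x y z := ⟨hw, hxy.symm, hyz⟩
      rw [openSegment_eq_image_lineMap]
      exact this.mem_image_Ioo
    have := (mem_extremePoints.1 (hE y hy).1).2 x (hE x hx).1.1 z (hE z hz).1.1 hs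
    exact hxy this.1
  rcases hcol.wbtw_or_wbtw_or_wbtw with h1 | h1 | h1
  · exact key a ha b hb c hc' hab hbc h1
  · exact key b hb c hc' a ha hbc hac.symm h1
  · exact key c hc' a ha b hb hac.symm hab h1

/-- Double counting of tight pairs: at a vertex at least two constraints are tight, since otherwise
one could move both ways along the only tight line, and the boundary line of a half-plane carries at
most two vertices. -/
lemma card_extreme_le (H : Finset HalfPlane) (E : Finset Plane)
    (hE : ∀ v ∈ E, v ∈ (⋂ h ∈ (H : Set HalfPlane), h.carrier).extremePoints ℝ) :
    E.card ≤ H.card := by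
  classical
  have h := Finset.card_mul_le_card_mul (s := E) (t := H) (m := 2) (n := 2)
    (fun (v : Plane) (h : HalfPlane) => inner ℝ h.normal v = h.offset) ?_ ?_
  · omega
  · intro v hv
    by_contra hlt
    rw [not_le, Nat.lt_succ_iff, Finset.card_le_one] at hlt
    obtain ⟨h₀, hh₀⟩ : ∃ n : Plane, ∀ h ∈ H, inner ℝ h.normal v = h.offset → h.normal = n := by
      by_cases hex : ∃ h ∈ H, inner ℝ h.normal v = h.offset
      · obtain ⟨g, hg, hgv⟩ := hex
        refine ⟨g.normal, fun h hh hhv => ?_⟩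
        rw [hlt h (Finset.mem_filter.2 ⟨hh, hhv⟩) g (Finset.mem_filter.2 ⟨hg, hgv⟩)]
      · push Not at hex
        exact ⟨0, fun h hh hhv => absurd hhv (hex h hh)⟩
    obtain ⟨w, hw, hnw⟩ := exists_perp h₀
    refine not_extreme_of_direction H.finite_toSet hw (hE v hv).1 ?_ (hE v hv)
    intro h hh hhv
    rw [hh₀ h hh hhv, hnw]
  · intro h hh
    refine card_extreme_on_line_le (G := ⋂ h ∈ (H : Set HalfPlane), h.carrier) h _ fun v hv => ?_
    have := Finset.mem_filter.1 hv
    exact ⟨hE v this.1, this.2⟩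

lemma extremePoints_finite {H : Set HalfPlane} (hH : H.Finite) :
    ((⋂ h ∈ H, h.carrier).extremePoints ℝ).Finite := by
  by_contra hinf
  obtain ⟨E, hE, hcard⟩ := Set.Infinite.exists_subset_card_eq hinf (hH.toFinset.card + 1)
  have := card_extreme_le hH.toFinset E (fun v hv => by simpa using hE hv)
  omega

lemma numVertices_iInter_le (H : Finset HalfPlane) :
    numVertices (⋂ h ∈ (H : Set HalfPlane), h.carrier) ≤ H.card := by
  have hfin := extremePoints_finite H.finite_toSet
  rw [numVertices, Set.ncard_eq_toFinset_card _ hfin]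
  exact card_extreme_le H _ fun v hv => by simpa using hv

lemma IsConvexPolygon.finite_extremePoints {F : Set Plane} (hF : IsConvexPolygon F) :
    (F.extremePoints ℝ).Finite := by
  obtain ⟨H, hH, rfl⟩ := hF
  exact extremePoints_finite hH

lemma IsConvexPolygon.convex {F : Set Plane} (hF : IsConvexPolygon F) : Convex ℝ F := by
  obtain ⟨H, -, rfl⟩ := hF
  exact convex_iInter₂ fun h _ => h.convex

/-! ### Centerpoints and medians -/

/-- Helly's theorem for the hulls of all subsets with more than two thirds of the points: any three
of these subsets share a point, as each misses less than a third. A half-plane through the common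
point with less than a third of the points would be disjoint from the hull of the remaining ones. -/
lemma exists_centerpoint (S : Finset Plane) (hS : S.Nonempty) :
    ∃ c, IsCenterpoint (S : Set Plane) c := by
  classical
  let 𝓕 : Finset (Finset Plane) := S.powerset.filter fun T => 2 * S.card < 3 * T.card
  have hne : (⋂ T ∈ 𝓕, convexHull ℝ (T : Set Plane)).Nonempty := by
    refine Convex.helly_theorem' (𝕜 := ℝ) (fun T _ => convex_convexHull ℝ _) fun I hI hcard => ?_
    have hrank : Module.finrank ℝ Plane = 2 := by simp
    rw [hrank] at hcard
    have hbad : (I.biUnion fun T => S \ T).card < S.card := by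
      rcases I.eq_empty_or_nonempty with rfl | hIne
      · simpa using hS.card_pos
      · have h1 : ∀ T ∈ I, 3 * (S \ T).card < S.card := by
          intro T hT
          have h2 := Finset.mem_filter.1 (hI hT)
          have h3 := Finset.card_sdiff_add_card_eq_card (Finset.mem_powerset.1 h2.1)
          omega
        have h2 : 3 * (I.biUnion fun T => S \ T).card ≤ ∑ T ∈ I, 3 * (S \ T).card := by
          rw [← Finset.mul_sum]
          exact Nat.mul_le_mul_left 3 Finset.card_biUnion_le
        have h3 : ∑ T ∈ I, 3 * (S \ T).card < ∑ _T ∈ I, S.card :=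
          Finset.sum_lt_sum_of_nonempty hIne h1
        rw [Finset.sum_const, smul_eq_mul] at h3
        have h4 : I.card * S.card ≤ 3 * S.card := Nat.mul_le_mul_right _ hcard
        omega
    obtain ⟨p, hp, hpn⟩ : ∃ p ∈ S, p ∉ I.biUnion fun T => S \ T := by
      by_contra hall
      push Not at hall
      exact absurd (Finset.card_le_card hall) (not_le.2 hbad)
    refine ⟨p, Set.mem_iInter₂.2 fun T hT => subset_convexHull ℝ _ ?_⟩
    by_contra hpT
    exact hpn (Finset.mem_biUnion.2 ⟨T, hT, Finset.mem_sdiff.2 ⟨hp, hpT⟩⟩)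
  obtain ⟨c, hc⟩ := hne
  refine ⟨c, fun h hch => ?_⟩
  by_contra hlt
  let T : Finset Plane := S.filter fun p => p ∉ h.carrier
  have hST : ((S : Set Plane) ∩ h.carrier).ncard = (S.filter fun p => p ∈ h.carrier).card := by
    rw [← Set.ncard_coe_finset]; congr 1; ext; simp
  have hsum := Finset.card_filter_add_card_filter_not (s := S) (fun p => p ∈ h.carrier)
  rw [hST, Set.ncard_coe_finset] at hlt
  have hT : T ∈ 𝓕 := Finset.mem_filter.2 ⟨by simp [T], by simp only [T]; omega⟩
  have hcT := Set.mem_iInter₂.1 hc T hT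
  have hconv : Convex ℝ {x : Plane | h.offset < inner ℝ h.normal x} :=
    convex_halfSpace_gt (IsLinearMap.mk (fun x y => inner_add_right _ _ _)
      fun r x => by rw [inner_smul_right, smul_eq_mul]) _
  have hsub : (T : Set Plane) ⊆ {x : Plane | h.offset < inner ℝ h.normal x} := by
    intro p hp
    have := (Finset.mem_filter.1 hp).2
    simpa [HalfPlane.carrier] using this
  have := convexHull_min hsub hconv hcT
  exact absurd hch (by simpa [HalfPlane.carrier] using this)

/-- A half-plane without points of a finite set does not contain its centerpoints. -/
lemma IsCenterpoint.notMem {S : Set Plane} {c : Plane} (hc : IsCenterpoint S c)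
    (hS : S.Nonempty) (hfin : S.Finite) {h : HalfPlane} (hh : ∀ p ∈ S, p ∉ h.carrier) :
    c ∉ h.carrier := by
  intro hch
  have h1 := hc h hch
  have h2 : S ∩ h.carrier = ∅ := Set.eq_empty_iff_forall_notMem.2 fun p hp => hh p hp.1 hp.2
  rw [h2, Set.ncard_empty, mul_zero] at h1
  have := (Set.ncard_pos hfin).2 hS
  omega

/-- At most two thirds of the points avoid a half-plane that contains a centerpoint. -/
lemma IsCenterpoint.ncard_le {S T : Set Plane} {c : Plane} (hc : IsCenterpoint S c)
    (hfin : S.Finite) {h : HalfPlane} (hch : c ∈ h.carrier) (hT : T ⊆ S \ h.carrier) :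
    3 * T.ncard ≤ 2 * S.ncard := by
  have h1 := hc h hch
  have h2 := Set.ncard_inter_add_ncard_sdiff_eq_ncard S h.carrier hfin
  have h3 := Set.ncard_le_ncard hT (hfin.subset Set.sdiff_subset)
  omega

/-- The half-plane on the other side, through a given point. -/
noncomputable def HalfPlane.oppositeAt (h : HalfPlane) (q : Plane) : HalfPlane where
  normal := -h.normal
  offset := - inner ℝ h.normal q
  normal_ne_zero := neg_ne_zero.2 h.normal_ne_zero

lemma HalfPlane.mem_oppositeAt {h : HalfPlane} {q x : Plane} :
    x ∈ (h.oppositeAt q).carrier ↔ inner ℝ h.normal q ≤ inner ℝ h.normal x := by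
  simp [HalfPlane.carrier, HalfPlane.oppositeAt]

/-- A half-plane that misses a centerpoint contains at most two thirds of the points. -/
lemma IsCenterpoint.ncard_inter_le {S : Set Plane} {c : Plane} (hc : IsCenterpoint S c)
    (hfin : S.Finite) {h : HalfPlane} (hch : c ∉ h.carrier) :
    3 * (S ∩ h.carrier).ncard ≤ 2 * S.ncard := by
  refine hc.ncard_le (h := h.oppositeAt c) hfin (HalfPlane.mem_oppositeAt.2 le_rfl) ?_
  intro p hp
  refine ⟨hp.1, fun hp' => hch ?_⟩
  have := HalfPlane.mem_oppositeAt.1 hp'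
  have h2 := hp.2
  simp only [HalfPlane.carrier, Set.mem_ofPred_eq] at h2 ⊢
  linarith

lemma exists_median (d : Side) {I : Set Plane} (hI : I.Finite) (hne : I.Nonempty) :
    ∃ u, IsMedian d I u := by
  have hfin : ∀ p : Plane → Prop, {z ∈ I | p z}.Finite := fun p => hI.subset (Set.sep_subset _ _)
  have hJ : {u ∈ I | 2 * {z ∈ I | d.height z < d.height u}.ncard ≤ I.ncard}.Nonempty := by
    obtain ⟨u, hu, hmin⟩ := Set.exists_min_image I d.height hI hne
    refine ⟨u, hu, ?_⟩
    have : {z ∈ I | d.height z < d.height u} = ∅ :=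
      Set.eq_empty_iff_forall_notMem.2 fun z hz => absurd (hmin z hz.1) (not_le.2 hz.2)
    rw [this]; simp
  -- The median is the highest point with at most half of `I` strictly below it. If more than half
  -- were strictly above, the next higher point would qualify as well.
  obtain ⟨u, hu, hmax⟩ := Set.exists_max_image _ d.height (hfin _) hJ
  refine ⟨u, hu.1, hu.2, ?_⟩
  by_contra hlt
  have hne' : {z ∈ I | d.height u < d.height z}.Nonempty := by
    rw [Set.nonempty_iff_ne_empty]; intro h0; rw [h0] at hlt; simp at hlt
  obtain ⟨v, hv, hvmin⟩ := Set.exists_min_image _ d.height (hfin _) hne'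
  have hvJ : v ∈ {u ∈ I | 2 * {z ∈ I | d.height z < d.height u}.ncard ≤ I.ncard} := by
    refine ⟨hv.1, ?_⟩
    have hdisj : Disjoint {z ∈ I | d.height z < d.height v} {z ∈ I | d.height u < d.height z} :=
      Set.disjoint_left.2 fun z hz hz' => absurd (hvmin z hz') (not_le.2 hz.2)
    have h1 := Set.ncard_union_eq hdisj (hfin _) (hfin _)
    have h2 := Set.ncard_le_ncard (Set.union_subset (Set.sep_subset I _) (Set.sep_subset I _) :
      {z ∈ I | d.height z < d.height v} ∪ {z ∈ I | d.height u < d.height z} ⊆ I) hI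
    omega
  exact absurd (hmax v hvJ) (not_le.2 hv.2)

/-! ### Points of interest -/

lemma interestPoints_zero {P : Finset Plane} {d : Side} {B : Set Plane} {t : ℝ} {u : Plane}
    (hu : u ∈ interestPoints P d B t) : u 0 = t := by
  obtain ⟨-, p, -, r, -, h⟩ := hu
  have : u ∈ (affineSpan ℝ {p, r} : Set Plane) ∩ {z | z 0 = t} := h ▸ Set.mem_singleton u
  exact this.2

/-- A pair of points of `P` determines at most one point of interest on the line. -/
lemma interestPoints_finite (P : Finset Plane) (d : Side) (B : Set Plane) (t : ℝ) :
    (interestPoints P d B t).Finite ∧ (interestPoints P d B t).ncard ≤ P.card ^ 2 := by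
  classical
  have hsub : interestPoints P d B t ⊆ ((P ×ˢ P).image fun e : Plane × Plane =>
      Classical.epsilon fun u =>
        (affineSpan ℝ {e.1, e.2} : Set Plane) ∩ {z | z 0 = t} = {u} : Finset Plane) := by
    rintro u ⟨-, p, hp, r, hr, h⟩
    refine Finset.mem_coe.2 (Finset.mem_image.2 ⟨(p, r), Finset.mem_product.2 ⟨hp, hr⟩, ?_⟩)
    have := Classical.epsilon_spec (p := fun u =>
      (affineSpan ℝ {p, r} : Set Plane) ∩ {z | z 0 = t} = {u}) ⟨u, h⟩
    exact (Set.singleton_eq_singleton_iff.1 (h.symm.trans this)).symm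
  refine ⟨(Finset.finite_toSet _).subset hsub, ?_⟩
  refine (Set.ncard_le_ncard hsub (Finset.finite_toSet _)).trans ?_
  rw [Set.ncard_coe_finset]
  refine Finset.card_image_le.trans ?_
  rw [Finset.card_product, sq]

lemma Side.Over.anti {d : Side} {B B' : Set Plane} {p : Plane} (hBB : B ⊆ B')
    (hx : ∃ b ∈ B, b 0 = p 0) (h : d.Over B' p) : d.Over B p :=
  ⟨hx, fun b hb hb0 => h.2 b (hBB hb) hb0⟩

lemma Side.Over.notMem {d : Side} {B : Set Plane} {p : Plane} (h : d.Over B p) : p ∉ B :=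
  fun hp => lt_irrefl _ (h.2 p hp rfl)

/-- This is why a cleaned line stays clean while `B` grows. -/
lemma interestPoints_anti {P : Finset Plane} {d : Side} {B B' : Set Plane} {t : ℝ}
    (hBB : B ⊆ B') (hx : ∃ b ∈ B, b 0 = t) : interestPoints P d B' t ⊆ interestPoints P d B t := by
  intro u hu
  have h0 := interestPoints_zero hu
  exact ⟨hu.1.anti hBB (by rwa [h0]), hu.2⟩

/-- The degenerate pair `p = r` makes cleaning a wall classify the points of `P` on it, which belong
to no pocket. -/
lemma mem_interestPoints_self {P : Finset Plane} {d : Side} {B : Set Plane} {p : Plane}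
    (hp : p ∈ P) (h : d.Over B p) : p ∈ interestPoints P d B (p 0) := by
  refine ⟨h, p, hp, p, hp, ?_⟩
  ext z
  simp only [Set.pair_eq_singleton, AffineSubspace.coe_affineSpan_singleton, Set.mem_inter_iff,
    Set.mem_singleton_iff, Set.mem_ofPred_eq]
  exact ⟨fun h => h.1, fun h => ⟨h, by rw [h]⟩⟩

/-- The line through two points with distinct abscissas yields points of interest. -/
lemma mem_interestPoints_of_line {P : Finset Plane} {d : Side} {B : Set Plane} {p r u : Plane}
    (hp : p ∈ P) (hr : r ∈ P) (hpr : r 0 ≠ p 0) {m k : ℝ} (hpl : d.height p = m * p 0 + k)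
    (hrl : d.height r = m * r 0 + k) (hul : d.height u = m * u 0 + k) (h : d.Over B u) :
    u ∈ interestPoints P d B (u 0) := by
  refine ⟨h, p, hp, r, hr, ?_⟩
  have hne : r 0 - p 0 ≠ 0 := sub_ne_zero.2 hpr
  ext z
  simp only [Set.mem_inter_iff, Set.mem_ofPred_eq, Set.mem_singleton_iff]
  constructor
  · rintro ⟨hz, hz0⟩
    obtain ⟨s, hs⟩ : ∃ s : ℝ, s • (r -ᵥ p) = z - p := by
      rw [← vadd_left_mem_affineSpan_pair]; simpa using hz
    obtain rfl : z = (1 - s) • p + s • r := by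
      rw [vsub_eq_sub, eq_sub_iff_add_eq] at hs
      rw [← hs]; module
    refine d.eq_of_height_eq hz0 ?_
    rw [Side.height_add_smul, hul, ← hz0, add_smul_zero, hpl, hrl]
    ring
  · rintro rfl
    refine ⟨?_, rfl⟩
    have : z = AffineMap.lineMap p r ((z 0 - p 0) / (r 0 - p 0)) := by
      rw [AffineMap.lineMap_apply_module]
      refine d.eq_of_height_eq ?_ ?_
      · rw [add_smul_zero]; field_simp; ring
      · rw [Side.height_add_smul, hul, hpl, hrl]; field_simp; ring
    rw [this]
    exact AffineMap.lineMap_mem_affineSpan_pair _ _ _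

/-! ### The side of a polygon over an interval without vertices -/

/-- Over an interval without vertices, a polygon that is bounded towards a side is bounded there by
a single line, which it attains over the whole closed interval. -/
lemma exists_edge_line (d : Side) {H : Set HalfPlane} (hH : H.Finite) {a b : ℝ} {g : Plane}
    (hg : g ∈ ⋂ h ∈ H, h.carrier) (hag : a < g 0) (hgb : g 0 < b)
    (hup : ∃ h ∈ H, 0 < d.height h.normal)
    (hext : ∀ v ∈ (⋂ h ∈ H, h.carrier).extremePoints ℝ, ¬ (a < v 0 ∧ v 0 < b)) :
    ∃ m k : ℝ, (∀ x, a ≤ x → x ≤ b → d.pt x (m * x + k) ∈ ⋂ h ∈ H, h.carrier) ∧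
      ∀ z ∈ ⋂ h ∈ H, h.carrier, d.height z ≤ m * z 0 + k := by
  set G : Set Plane := ⋂ h ∈ H, h.carrier with hG
  have hGconv : Convex ℝ G := convex_iInter₂ fun h _ => h.convex
  have hGclosed : IsClosed G := isClosed_biInter fun h _ => h.isClosed
  let L : HalfPlane → ℝ → ℝ := fun h x =>
    -(h.normal 0) / d.height h.normal * x + h.offset / d.height h.normal
  have hL : ∀ h : HalfPlane, 0 < d.height h.normal → ∀ z : Plane,
      (z ∈ h.carrier ↔ d.height z ≤ L h (z 0)) := by
    intro h hh z
    rw [HalfPlane.mem_carrier_height d]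
    simp only [L]
    rw [div_mul_eq_mul_div, ← add_div, le_div_iff₀ hh]
    constructor <;> intro h <;> linarith
  -- `h₀` is the lowest upper constraint at the abscissa of `g`. The polygon touches its line there,
  -- and the face on that line can only end at vertices.
  obtain ⟨h₀, hh₀, hmin⟩ := Set.exists_min_image {h ∈ H | 0 < d.height h.normal}
    (fun h => L h (g 0)) (hH.subset (Set.sep_subset _ _)) (by
      obtain ⟨h, hh, hp⟩ := hup; exact ⟨h, hh, hp⟩)
  let m : ℝ := -(h₀.normal 0) / d.height h₀.normal
  let k : ℝ := h₀.offset / d.height h₀.normal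
  have hbelow : ∀ z ∈ G, d.height z ≤ m * z 0 + k := fun z hz =>
    (hL h₀ hh₀.2 z).1 (Set.mem_iInter₂.1 hz h₀ hh₀.1)
  have htop : d.pt (g 0) (m * g 0 + k) ∈ G := by
    refine Set.mem_iInter₂.2 fun h hh => ?_
    have hgh := Set.mem_iInter₂.1 hg h hh
    rcases lt_or_ge 0 (d.height h.normal) with hp | hp
    · rw [hL h hp, Side.height_pt, Side.pt_zero]
      exact hmin h ⟨hh, hp⟩
    · rw [HalfPlane.mem_carrier_height d] at hgh ⊢
      rw [Side.height_pt, Side.pt_zero]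
      have := mul_le_mul_of_nonpos_left (hbelow g hg) hp
      linarith
  let f : ℝ → Plane := fun x => d.pt x (m * x + k)
  have hf : Continuous f := by
    simp only [f, Side.pt, mkPt]
    refine (PiLp.continuous_toLp 2 _).comp ?_
    refine continuous_pi fun i => ?_
    fin_cases i
    · exact continuous_id
    · exact (continuous_const.mul ((continuous_const.mul continuous_id).add continuous_const))
  have hfz : ∀ z ∈ G, d.height z = m * z 0 + k → z = f (z 0) := fun z _ hz =>
    d.eq_of_height_eq rfl (by rw [hz, Side.height_pt])
  have hfc : ∀ x y z : ℝ, f x ∈ G → f y ∈ G → x ≤ z → z ≤ y → f z ∈ G := by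
    intro x y z hx hy hxz hzy
    obtain ⟨w, hw, hw0, hwh⟩ := hGconv.exists_mem_line d hx hy (m := m) (k := k)
      (by simp [f]) (by simp [f]) hxz hzy
    have := hfz w hw (by rw [hwh, hw0])
    rwa [this, hw0] at hw
  -- an end of the face is a vertex
  have hend : ∀ e : ℝ, f e ∈ G → (∀ x, f x ∈ G → x ≤ e) ∨ (∀ x, f x ∈ G → e ≤ x) →
      f e ∈ G.extremePoints ℝ := by
    intro e he hends
    refine mem_extremePoints.2 ⟨he, fun x₁ h₁ x₂ h₂ hx => ?_⟩
    obtain ⟨s, t, hs, ht, hst, hc⟩ := hx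
    have e0 : s * x₁ 0 + t * x₂ 0 = e := by rw [← add_smul_zero, hc]; rfl
    have e1 : s * d.height x₁ + t * d.height x₂ = m * e + k := by
      rw [← Side.height_add_smul, hc]; simp [f]
    have b1 := hbelow x₁ h₁
    have b2 := hbelow x₂ h₂
    have hsum : s * (m * x₁ 0 + k - d.height x₁) + t * (m * x₂ 0 + k - d.height x₂) = 0 := by
      have : s * (m * x₁ 0 + k) + t * (m * x₂ 0 + k) = m * e + k := by
        rw [← e0]; linear_combination k * hst
      linarith
    have c1 : d.height x₁ = m * x₁ 0 + k := by
      have := mul_nonneg hs.le (sub_nonneg.2 b1)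
      have := mul_nonneg ht.le (sub_nonneg.2 b2)
      have : s * (m * x₁ 0 + k - d.height x₁) = 0 := by linarith
      rcases mul_eq_zero.1 this with h | h <;> linarith
    have c2 : d.height x₂ = m * x₂ 0 + k := by
      have := mul_nonneg hs.le (sub_nonneg.2 b1)
      have := mul_nonneg ht.le (sub_nonneg.2 b2)
      have : t * (m * x₂ 0 + k - d.height x₂) = 0 := by linarith
      rcases mul_eq_zero.1 this with h | h <;> linarith
    have f1 := hfz x₁ h₁ c1
    have f2 := hfz x₂ h₂ c2
    have hfe : s * (x₁ 0 - e) + t * (x₂ 0 - e) = 0 := by linear_combination e0 - e * hst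
    have g1 : x₁ 0 = e ∧ x₂ 0 = e := by
      rcases hends with hle | hle
      · have i1 := hle _ (f1 ▸ h₁)
        have i2 := hle _ (f2 ▸ h₂)
        constructor <;> by_contra hne
        · have := mul_neg_of_pos_of_neg hs (sub_neg.2 (lt_of_le_of_ne i1 hne))
          have := mul_nonpos_of_nonneg_of_nonpos ht.le (sub_nonpos.2 i2)
          linarith
        · have := mul_neg_of_pos_of_neg ht (sub_neg.2 (lt_of_le_of_ne i2 hne))
          have := mul_nonpos_of_nonneg_of_nonpos hs.le (sub_nonpos.2 i1)
          linarith
      · have i1 := hle _ (f1 ▸ h₁)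
        have i2 := hle _ (f2 ▸ h₂)
        constructor <;> by_contra hne
        · have := mul_pos hs (sub_pos.2 (lt_of_le_of_ne i1 (Ne.symm hne)))
          have := mul_nonneg ht.le (sub_nonneg.2 i2)
          linarith
        · have := mul_pos ht (sub_pos.2 (lt_of_le_of_ne i2 (Ne.symm hne)))
          have := mul_nonneg hs.le (sub_nonneg.2 i1)
          linarith
    exact ⟨by rw [f1, g1.1], by rw [f2, g1.2]⟩
  have hTclosed : IsClosed {x | f x ∈ G} := hGclosed.preimage hf
  -- Otherwise the last point of the face before `b` would be a vertex strictly between `a` and `b`.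
  have hb : f b ∈ G := by
    by_contra hbG
    have hcomp : IsCompact ({x | f x ∈ G} ∩ Set.Icc (g 0) b) :=
      isCompact_Icc.inter_left hTclosed
    obtain ⟨e, he, hmax⟩ := hcomp.exists_isGreatest ⟨g 0, htop, le_rfl, hgb.le⟩
    have heb : e < b := lt_of_le_of_ne he.2.2 fun h => hbG (h ▸ he.1)
    refine hext _ (hend e he.1 (Or.inl fun x hx => ?_)) ⟨hag.trans_le he.2.1, heb⟩
    by_contra hlt
    push Not at hlt
    rcases le_total x b with hxb | hxb
    · exact absurd (hmax ⟨hx, (he.2.1.trans hlt.le), hxb⟩) (not_le.2 hlt)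
    · exact hbG (hfc e x b he.1 hx heb.le hxb)
  have ha : f a ∈ G := by
    by_contra haG
    have hcomp : IsCompact ({x | f x ∈ G} ∩ Set.Icc a (g 0)) :=
      isCompact_Icc.inter_left hTclosed
    obtain ⟨e, he, hmin'⟩ := hcomp.exists_isLeast ⟨g 0, htop, hag.le, le_rfl⟩
    have hea : a < e := lt_of_le_of_ne he.2.1 fun h => haG (h ▸ he.1)
    refine hext _ (hend e he.1 (Or.inr fun x hx => ?_)) ⟨hea, he.2.2.trans_lt hgb⟩
    by_contra hlt
    push Not at hlt
    rcases le_total a x with hxa | hxa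
    · exact absurd (hmin' ⟨hx, hxa, hlt.le.trans he.2.2⟩) (not_le.2 hlt)
    · exact haG (hfc x e a hx he.1 hxa hea.le)
  exact ⟨m, k, fun x hx hx' => hfc a b x ha hb hx hx', hbelow⟩

/-- `y` is at most the height of a point of `X` with abscissa `x`. -/
def Side.Dominates (d : Side) (X : Set Plane) (x y : ℝ) : Prop :=
  ∃ c ∈ X, c 0 = x ∧ y ≤ d.height c

lemma Side.Dominates.mono {d : Side} {X Y : Set Plane} (h : X ⊆ Y) {x y : ℝ}
    (hX : d.Dominates X x y) : d.Dominates Y x y := by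
  obtain ⟨c, hc, h0, h1⟩ := hX
  exact ⟨c, h hc, h0, h1⟩

lemma Side.Dominates.between {d : Side} {X : Set Plane} (hX : Convex ℝ X) {a b x m k : ℝ}
    (ha : d.Dominates X a (m * a + k)) (hb : d.Dominates X b (m * b + k)) (hax : a ≤ x)
    (hxb : x ≤ b) : d.Dominates X x (m * x + k) := by
  obtain ⟨u, hu, hu0, hu1⟩ := ha
  obtain ⟨v, hv, hv0, hv1⟩ := hb
  rcases eq_or_lt_of_le (hax.trans hxb) with h | h
  · have : a = x := by linarith
    exact ⟨u, hu, by rw [hu0, this], by rwa [this] at hu1⟩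
  · have hne : b - a ≠ 0 := by linarith
    refine ⟨((b - x) / (b - a)) • u + ((x - a) / (b - a)) • v, hX hu hv
      (div_nonneg (by linarith) (by linarith)) (div_nonneg (by linarith) (by linarith))
      (by field_simp; ring), ?_, ?_⟩
    · rw [add_smul_zero, hu0, hv0]; field_simp; ring
    · rw [Side.height_add_smul]
      have h1 := mul_le_mul_of_nonneg_left hu1
        (div_nonneg (sub_nonneg.2 hxb) (sub_nonneg.2 h.le))
      have h2 := mul_le_mul_of_nonneg_left hv1
        (div_nonneg (sub_nonneg.2 hax) (sub_nonneg.2 h.le))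
      refine le_trans (le_of_eq ?_) (add_le_add h1 h2)
      field_simp; ring

/-- A line through a point of a bounded polygon is dominated at one of the ends of an interval
without vertices around that point. -/
lemma dominates_end_of_no_vertex (d : Side) {F : Set Plane} (hF : IsConvexPolygon F)
    (hbd : Bornology.IsBounded F) {p : Plane} (hp : p ∈ F) {a b m k : ℝ} (hap : a < p 0)
    (hpb : p 0 < b) (hpl : d.height p = m * p 0 + k)
    (hext : ∀ v ∈ F.extremePoints ℝ, ¬ (a < v 0 ∧ v 0 < b)) :
    d.Dominates F a (m * a + k) ∨ d.Dominates F b (m * b + k) := by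
  obtain ⟨H, hH, rfl⟩ := hF
  -- Without an upper constraint the polygon would contain a vertical ray from `p`.
  have hup : ∃ h ∈ H, 0 < d.height h.normal := by
    by_contra hno
    push Not at hno
    obtain ⟨M, hM⟩ := hbd.exists_norm_le
    have hray : ∀ t : ℝ, 0 ≤ t → d.pt (p 0) (d.height p + t) ∈ ⋂ h ∈ H, h.carrier := by
      intro t ht
      refine Set.mem_iInter₂.2 fun h hh => ?_
      have h1 := Set.mem_iInter₂.1 hp h hh
      rw [HalfPlane.mem_carrier_height d] at h1 ⊢
      rw [Side.pt_zero, Side.height_pt]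
      have := mul_nonpos_of_nonpos_of_nonneg (hno h hh) ht
      linarith
    have h1 := hM _ (hray (M + 1 + |d.height p|) (by
      have := (norm_nonneg _).trans (hM p hp)
      positivity))
    have h2 : |d.height (d.pt (p 0) (d.height p + (M + 1 + |d.height p|)))| ≤ M := by
      refine le_trans ?_ h1
      rw [Side.height_eq, abs_mul]
      have : |d.sign| = 1 := by cases d <;> simp [Side.sign]
      rw [this, one_mul, ← Real.norm_eq_abs]
      exact PiLp.norm_apply_le _ 1
    rw [Side.height_pt] at h2
    have := le_abs_self (d.height p + (M + 1 + |d.height p|))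
    have := neg_abs_le (d.height p)
    linarith
  obtain ⟨m', k', h1, h2⟩ := exists_edge_line d hH hp hap hpb hup hext
  have hle := h2 p hp
  have hab : a ≤ b := (hap.trans hpb).le
  by_cases hc : m * a + k ≤ m' * a + k'
  · exact Or.inl ⟨_, h1 a le_rfl hab, rfl, by rwa [Side.height_pt]⟩
  · refine Or.inr ⟨_, h1 b hab le_rfl, rfl, ?_⟩
    rw [Side.height_pt]
    push Not at hc
    by_contra hc'
    push Not at hc'
    rw [hpl] at hle
    -- The difference of the two lines is affine in the abscissa; it cannot be positive at both ends
    -- and nonpositive at `p 0`.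
    have e1 : 0 < (m - m') * a + (k - k') := by linarith
    have e2 : 0 < (m - m') * b + (k - k') := by linarith
    have e3 : (m - m') * p 0 + (k - k') ≤ 0 := by linarith
    rcases le_total 0 (m - m') with hm | hm
    · nlinarith [mul_le_mul_of_nonneg_left hap.le hm]
    · nlinarith [mul_le_mul_of_nonpos_left hpb.le hm]

/-! ### Why a pocket is split: witnesses and cleaned walls -/

/-- A witness for the activity of the pocket over `(a, b)`: a point of `P` in `C` over the interval
such that no line to another point of `P` stays below the top of `C` at both walls. -/
def PocketWitness (P : Finset Plane) (C : Set Plane) (d : Side) (a b : ℝ) (p : Plane) : Prop :=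
  p ∈ P ∧ p ∈ C ∧ a < p 0 ∧ p 0 < b ∧ ∀ m k : ℝ, d.height p = m * p 0 + k → ∀ r ∈ P, r 0 ≠ p 0 →
    d.height r = m * r 0 + k →
      ¬ (d.Dominates C a (m * a + k) ∧ d.Dominates C b (m * b + k))

/-- Between two separate pockets with witnesses there is a vertex of every inner fence. -/
lemma PocketWitness.exists_vertex {P : Finset Plane} {C F : Set Plane} (hC : Convex ℝ C)
    (hCb : Bornology.IsBounded C) (hF : IsConvexPolygon F) (hFC : F ⊆ C)
    (hFP : C ∩ (P : Set Plane) = F ∩ (P : Set Plane)) {d : Side} {a b a' b' : ℝ} {p p' : Plane}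
    (hp : PocketWitness P C d a b p) (hp' : PocketWitness P C d a' b' p') (hba : b ≤ a') :
    ∃ v ∈ F.extremePoints ℝ, a < v 0 ∧ v 0 < b' := by
  obtain ⟨hpP, hpC, hap, hpb, hpw⟩ := hp
  obtain ⟨hpP', hpC', hap', hpb', hpw'⟩ := hp'
  by_contra hno
  have hlt : p 0 < p' 0 := by linarith
  have hne : p' 0 - p 0 ≠ 0 := by linarith
  obtain ⟨m, k, hl, hl'⟩ : ∃ m k, d.height p = m * p 0 + k ∧ d.height p' = m * p' 0 + k :=
    ⟨(d.height p' - d.height p) / (p' 0 - p 0),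
      d.height p - (d.height p' - d.height p) / (p' 0 - p 0) * p 0, by ring, by field_simp; ring⟩
  have dp : d.Dominates C (p 0) (m * p 0 + k) := ⟨p, hpC, rfl, hl.ge⟩
  have dp' : d.Dominates C (p' 0) (m * p' 0 + k) := ⟨p', hpC', rfl, hl'.ge⟩
  -- The inner walls `b ≤ a'` lie between `p` and `p'`, whose segment is in `C`. Without a vertex of
  -- `F` over `(a, b')`, the line is also dominated at `a`, contradicting the witness `p`, or at
  -- `b'`, contradicting `p'`.
  have db : d.Dominates C b (m * b + k) := dp.between hC dp' hpb.le (by linarith)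
  have da' : d.Dominates C a' (m * a' + k) := dp.between hC dp' (by linarith) hap'.le
  have hpF : p ∈ F := (hFP.subset ⟨hpC, hpP⟩).1
  rcases dominates_end_of_no_vertex d hF (hCb.subset hFC) hpF hap (by linarith : p 0 < b') hl
    (fun v hv h => hno ⟨v, hv, h⟩) with h | h
  · exact hpw m k hl p' hpP' hlt.ne' hl' ⟨h.mono hFC, db⟩
  · exact hpw' m k hl' p hpP hlt.ne hl ⟨da', h.mono hFC⟩

/-- The vertical line `x = t` has been cleaned: no point of interest on it is in `C` or
unclassified. -/
def CleanLine (P : Finset Plane) (C : Set Plane) (d : Side) (B U : Set Plane) (t : ℝ) : Prop :=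
  ∀ u ∈ interestPoints P d B t, u ∉ C ∧ u ∉ U

/-- On a cleaned line, a point of a line spanned by `P` that is below the top of `C` is below the
top of the inner approximation. -/
lemma CleanLine.dominates {P : Finset Plane} {C : Set Plane} {d : Side} {B U : Set Plane} {t : ℝ}
    (h : CleanLine P C d B U t) (hC : Convex ℝ C) (hBC : B ⊆ C) (hx : ∃ b ∈ B, b 0 = t)
    {p r : Plane} (hp : p ∈ P) (hr : r ∈ P) (hpr : r 0 ≠ p 0) {m k : ℝ}
    (hpl : d.height p = m * p 0 + k) (hrl : d.height r = m * r 0 + k)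
    (hD : d.Dominates C t (m * t + k)) : d.Dominates B t (m * t + k) := by
  by_contra hno
  have hover : d.Over B (d.pt t (m * t + k)) := by
    refine ⟨hx, fun b hb hb0 => ?_⟩
    by_contra hle
    rw [Side.height_pt] at hle
    exact hno ⟨b, hb, hb0, not_lt.1 hle⟩
  have hi := mem_interestPoints_of_line hp hr hpr hpl hrl (u := d.pt t (m * t + k))
    (by rw [Side.height_pt, Side.pt_zero]) hover
  refine (h _ hi).1 ?_
  obtain ⟨c, hc, hc0, hc1⟩ := hD
  obtain ⟨b, hb, hb0⟩ := hx
  exact hC.mem_of_height_between d (hBC hb) hc hb0 hc0 (hover.2 b hb hb0).le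
    (by rwa [Side.height_pt])

/-- A pocket between cleaned walls is split only if there is a vertex of the outer fence over it,
or if it has a witness. -/
lemma pocket_active {P : Finset Plane} {C G : Set Plane} (hC : Convex ℝ C)
    (hG : IsConvexPolygon G) (hCG : C ⊆ G) (hGP : C ∩ (P : Set Plane) = G ∩ (P : Set Plane))
    {d : Side} {B U S : Set Plane} (hB : Convex ℝ B) (hBC : B ⊆ C) {a b : ℝ} {q : Plane}
    (hxa : ∃ z ∈ B, z 0 = a) (hxb : ∃ z ∈ B, z 0 = b) (ha : CleanLine P C d B U a)
    (hb : CleanLine P C d B U b) (hSne : S.Nonempty) (hSP : S ⊆ P)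
    (hS : ∀ p ∈ S, a < p 0 ∧ p 0 < b ∧ d.Over B p) (hq : IsCenterpoint S q) (hqC : q ∈ C)
    (haq : a < q 0) (hqb : q 0 < b) :
    (∃ v ∈ G.extremePoints ℝ, a < v 0 ∧ v 0 < b) ∨ ∃ p, PocketWitness P C d a b p := by
  by_cases hin : ∃ p ∈ S, p ∈ C
  · obtain ⟨p, hpS, hpC⟩ := hin
    obtain ⟨hap, hpb, hov⟩ := hS p hpS
    refine Or.inr ⟨p, hSP hpS, hpC, hap, hpb, fun m k hl r hr hrp hrl hdom => ?_⟩
    -- Clean walls turn domination by `C` into domination by `B`; by convexity `B` would then reach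
    -- up to `p`, which is strictly over `B`.
    have d1 := ha.dominates hC hBC hxa (hSP hpS) hr hrp hl hrl hdom.1
    have d2 := hb.dominates hC hBC hxb (hSP hpS) hr hrp hl hrl hdom.2
    obtain ⟨c, hc, hc0, hc1⟩ := d1.between hB d2 hap.le hpb.le
    have := hov.2 c hc hc0
    linarith
  · push Not at hin
    refine Or.inl ?_
    by_contra hno
    have hSG : ∀ p ∈ S, p ∉ G := fun p hp hpG => hin p hp (hGP.superset ⟨hpG, hSP hp⟩).1
    have hGc := hG.convex
    obtain ⟨H, hH, rfl⟩ := hG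
    obtain ⟨s, hs⟩ := hSne
    -- If no constraint of the outer fence bounded it towards this side, `s` would be in the fence,
    -- being over a point of `B`.
    have hup : ∃ h ∈ H, 0 < d.height h.normal := by
      by_contra hno'
      push Not at hno'
      refine hSG s hs (Set.mem_iInter₂.2 fun h hh => ?_)
      obtain ⟨z, hz, hz0⟩ := (hS s hs).2.2.1
      have h1 := Set.mem_iInter₂.1 (hCG (hBC hz)) h hh
      have h2 := (hS s hs).2.2.2 z hz hz0
      rw [HalfPlane.mem_carrier_height d] at h1 ⊢
      have := mul_le_mul_of_nonpos_left h2.le (hno' h hh)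
      rw [hz0] at h1
      linarith
    obtain ⟨m, k, h1, h2⟩ := exists_edge_line d hH (hCG hqC) haq hqb hup
      (fun v hv h => hno ⟨v, hv, h⟩)
    -- A pocket point below the edge line would lie between `B` and the edge, hence in the outer
    -- fence. So all pocket points, and with them the centerpoint, are beyond the line.
    have hqL : q ∉ (d.belowLine m k).carrier := by
      refine hq.notMem ⟨s, hs⟩ (P.finite_toSet.subset hSP) fun p hp hpL => hSG p hp ?_
      rw [Side.mem_belowLine] at hpL
      obtain ⟨hap, hpb, hov⟩ := hS p hp
      obtain ⟨z, hz, hz0⟩ := hov.1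
      exact hGc.mem_of_height_between d (hCG (hBC hz)) (h1 (p 0) hap.le hpb.le) hz0 rfl
        (hov.2 z hz hz0).le (by rwa [Side.height_pt])
    exact hqL (Side.mem_belowLine.2 (h2 q (hCG hqC)))

/-! ### Fences and query algorithms -/

lemma QueryAlgorithm.Produces.unique {A : QueryAlgorithm} {O : Oracle} {l : List Answer} {k k' : ℕ}
    {S S' : Set Plane} (h : A.Produces O l k S) (h' : A.Produces O l k' S') : k = k' ∧ S = S' := by
  induction h generalizing k' S' with
  | halt hl =>
    cases h' with
    | halt hl' => rw [hl] at hl'; exact ⟨rfl, Sum.inr.inj hl'⟩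
    | ask hl' _ => rw [hl] at hl'; cases hl'
  | ask hl _ ih =>
    cases h' with
    | halt hl' => rw [hl] at hl'; cases hl'
    | ask hl' hp =>
      rw [hl] at hl'
      obtain rfl := Sum.inl.inj hl'
      obtain ⟨rfl, rfl⟩ := ih hp
      exact ⟨rfl, rfl⟩

/-- The output depends only on the answers to the queries made. -/
lemma QueryAlgorithm.Produces.exists_transcript {A : QueryAlgorithm} {O : Oracle} {l : List Answer}
    {k : ℕ} {S : Set Plane} (h : A.Produces O l k S) :
    ∃ Q : Finset Plane, Q.card ≤ k ∧
      ∀ O' : Oracle, (∀ q ∈ Q, O' q = O q) → A.Produces O' l k S := by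
  classical
  induction h with
  | halt hl => exact ⟨∅, le_rfl, fun O' _ => .halt hl⟩
  | @ask l q k S hl _ ih =>
    obtain ⟨Q, hQ, h⟩ := ih
    refine ⟨insert q Q, (Finset.card_insert_le _ _).trans (Nat.succ_le_succ hQ), fun O' hO' => ?_⟩
    refine .ask hl ?_
    rw [hO' q (Finset.mem_insert_self _ _)]
    exact h O' fun p hp => hO' p (Finset.mem_insert_of_mem hp)

/-- Every point outside a convex body can be separated from it. -/
lemma exists_halfPlane_separating (C : ConvexBody Plane) {q : Plane} (hq : q ∉ (C : Set Plane)) :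
    ∃ h : HalfPlane, (C : Set Plane) ⊆ h.carrier ∧ q ∉ h.carrier := by
  obtain ⟨f, u, hu, hqu⟩ := geometric_hahn_banach_closed_point C.convex C.isCompact.isClosed hq
  obtain ⟨c, hc⟩ := C.nonempty
  let n := (InnerProductSpace.toDual ℝ Plane).symm f
  have hn : ∀ x, inner ℝ n x = f x := fun x => InnerProductSpace.toDual_symm_apply
  refine ⟨⟨n, u, fun h0 => ?_⟩, fun x hx => ?_, fun hx => ?_⟩
  · have h1 := hu c hc
    rw [← hn, h0, inner_zero_left] at h1 hqu
    linarith
  · show inner ℝ n x ≤ u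
    rw [hn]; exact (hu x hx).le
  · have : inner ℝ n q ≤ u := hx
    rw [hn] at this
    linarith

lemma IsSeparationOracle.inside {O : Oracle} {C : Set Plane} (hO : IsSeparationOracle O C)
    {q : Plane} (h : O q = .inside) : q ∈ C := by
  have := hO q; rwa [h] at this

lemma IsSeparationOracle.outside {O : Oracle} {C : Set Plane} (hO : IsSeparationOracle O C)
    {q : Plane} {h : HalfPlane} (hq : O q = .outside h) : C ⊆ h.carrier ∧ q ∉ h.carrier := by
  have := hO q; rwa [hq] at this

/-- A correct algorithm gives the same output on all bodies consistent with its queries. -/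
lemma QueryAlgorithm.Classifies.eq_of_consistent {A : QueryAlgorithm} {P : Finset Plane}
    (hA : A.Classifies P) {C C' : ConvexBody Plane} {O : Oracle}
    (hO : IsSeparationOracle O (C : Set Plane)) {k : ℕ} {S : Set Plane} {Q : Finset Plane}
    (hQ : ∀ O' : Oracle, (∀ q ∈ Q, O' q = O q) → A.Produces O' [] k S)
    (hin : ∀ q ∈ Q, O q = .inside → q ∈ (C' : Set Plane))
    (hout : ∀ q ∈ Q, ∀ h, O q = .outside h → (C' : Set Plane) ⊆ h.carrier) :
    S = (P : Set Plane) ∩ (C' : Set Plane) := by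
  classical
  -- The adversary repeats the recorded answers and separates from `C'` everywhere else.
  let O' : Oracle := fun q => if q ∈ Q then O q else
    if hq : q ∈ (C' : Set Plane) then .inside else
      .outside (exists_halfPlane_separating C' hq).choose
  have hO' : IsSeparationOracle O' (C' : Set Plane) := by
    intro q
    simp only [O']
    by_cases hqQ : q ∈ Q
    · rw [if_pos hqQ]
      cases hq : O q with
      | inside => exact hin q hqQ hq
      | outside h => exact ⟨hout q hqQ h hq, (hO.outside hq).2⟩
    · rw [if_neg hqQ]
      by_cases hqC : q ∈ (C' : Set Plane)
      · rw [dif_pos hqC]; exact hqC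
      · rw [dif_neg hqC]; exact (exists_halfPlane_separating C' hqC).choose_spec
  obtain ⟨k', hk'⟩ := hA C' O' hO'
  exact ((hQ O' fun q hq => if_pos hq).unique hk').2

lemma numVertices_convexHull_le (S : Finset Plane) :
    numVertices (convexHull ℝ (S : Set Plane)) ≤ S.card := by
  rw [numVertices, ← Set.ncard_coe_finset]
  exact Set.ncard_le_ncard extremePoints_convexHull_subset S.finite_toSet

lemma innerFenceSize_le {P : Finset Plane} {C F : Set Plane} (hF : IsConvexPolygon F) (hFC : F ⊆ C)
    (hFP : C ∩ (P : Set Plane) = F ∩ (P : Set Plane)) : innerFenceSize P C ≤ numVertices F :=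
  Nat.sInf_le ⟨F, hF, hFC, hFP, rfl⟩

lemma outerFenceSize_le {P : Finset Plane} {C F : Set Plane} (hF : IsConvexPolygon F) (hCF : C ⊆ F)
    (hFP : C ∩ (P : Set Plane) = F ∩ (P : Set Plane)) : outerFenceSize P C ≤ numVertices F :=
  Nat.sInf_le ⟨F, hF, hCF, hFP, rfl⟩

/-- There is an inner fence. -/
lemma exists_innerFence (P : Finset Plane) {C : Set Plane} (hC : Convex ℝ C) :
    ∃ F : Set Plane, IsConvexPolygon F ∧ F ⊆ C ∧ C ∩ (P : Set Plane) = F ∩ (P : Set Plane) ∧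
      numVertices F = innerFenceSize P C := by
  classical
  refine Nat.sInf_mem (s := {m | ∃ F : Set Plane, IsConvexPolygon F ∧ F ⊆ C ∧
    C ∩ (P : Set Plane) = F ∩ (P : Set Plane) ∧ numVertices F = m})
    ⟨_, convexHull ℝ ((P.filter (· ∈ C) : Finset Plane) : Set Plane),
      isConvexPolygon_convexHull _, ?_, ?_, rfl⟩
  · exact convexHull_min (fun p hp => (Finset.mem_filter.1 hp).2) hC
  · refine Set.Subset.antisymm (fun p hp => ⟨subset_convexHull ℝ _ ?_, hp.2⟩) fun p hp => ⟨?_, hp.2⟩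
    · exact Finset.mem_coe.2 (Finset.mem_filter.2 ⟨hp.2, hp.1⟩)
    · exact convexHull_min (fun p hp => (Finset.mem_filter.1 hp).2) hC hp.1

/-- There is an outer fence. -/
lemma exists_outerFence (P : Finset Plane) (C : ConvexBody Plane) :
    ∃ F : Set Plane, IsConvexPolygon F ∧ (C : Set Plane) ⊆ F ∧
      (C : Set Plane) ∩ (P : Set Plane) = F ∩ (P : Set Plane) ∧
      numVertices F = outerFenceSize P C := by
  classical
  have hsep : ∀ p : Plane, ∃ h : HalfPlane, p ∉ (C : Set Plane) →
      (C : Set Plane) ⊆ h.carrier ∧ p ∉ h.carrier := by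
    intro p
    by_cases hp : p ∈ (C : Set Plane)
    · exact ⟨HalfPlane.ofCoeffs 1 0 0 (by simp), fun h => absurd hp h⟩
    · obtain ⟨h, hh⟩ := exists_halfPlane_separating C hp
      exact ⟨h, fun _ => hh⟩
  choose g hg using hsep
  refine Nat.sInf_mem (s := {m | ∃ F : Set Plane, IsConvexPolygon F ∧ (C : Set Plane) ⊆ F ∧
    (C : Set Plane) ∩ (P : Set Plane) = F ∩ (P : Set Plane) ∧ numVertices F = m})
    ⟨_, ⋂ h ∈ g '' {p | p ∈ P ∧ p ∉ (C : Set Plane)}, h.carrier, ⟨_, ?_, rfl⟩, ?_, ?_, rfl⟩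
  · exact (P.finite_toSet.subset fun p hp => hp.1).image g
  · refine Set.subset_iInter₂ ?_
    rintro h ⟨p, hp, rfl⟩
    exact (hg p hp.2).1
  · refine Set.Subset.antisymm (fun p hp => ⟨Set.mem_iInter₂.2 ?_, hp.2⟩) fun p hp => ⟨?_, hp.2⟩
    · rintro h ⟨r, hr, rfl⟩
      exact (hg r hr.2).1 hp.1
    · by_contra hpC
      exact (hg p hpC).2 (Set.mem_iInter₂.1 hp.1 _ ⟨p, ⟨hp.2, hpC⟩, rfl⟩)

/-! ### Consistent bodies and the lower bound for arbitrary query algorithms -/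

/-- The convex body consisting of one point. -/
def pointBody (p : Plane) : ConvexBody Plane := ⟨{p}, convex_singleton p, isCompact_singleton,
  Set.singleton_nonempty p⟩

/-- The convex hull of a finite set as a convex body. -/
def hullBody (S : Finset Plane) (hS : S.Nonempty) : ConvexBody Plane :=
  ⟨convexHull ℝ (S : Set Plane), convex_convexHull ℝ _, S.finite_toSet.isCompact_convexHull ℝ,
    (Finset.coe_nonempty.2 hS).convexHull⟩

lemma isCompact_convexHull_insert {C : Set Plane} (hC : Convex ℝ C) (hcomp : IsCompact C)
    (hne : C.Nonempty) (p : Plane) : IsCompact (convexHull ℝ (insert p C)) := by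
  rw [convexHull_insert hne, hC.convexHull_eq]
  have : convexJoin ℝ {p} C =
      (fun e : ℝ × Plane => (1 - e.1) • p + e.1 • e.2) '' (Set.Icc 0 1 ×ˢ C) := by
    ext z
    simp only [convexJoin_singleton_left, Set.mem_iUnion, segment_eq_image, Set.mem_image,
      Set.mem_prod, Prod.exists, exists_prop]
    constructor
    · rintro ⟨y, hy, t, ht, rfl⟩; exact ⟨t, y, ⟨ht, hy⟩, rfl⟩
    · rintro ⟨t, y, ⟨ht, hy⟩, rfl⟩; exact ⟨y, hy, t, ht, rfl⟩
  rw [this]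
  exact (isCompact_Icc.prod hcomp).image (by fun_prop)

/-- The convex hull of a convex body and a point. -/
def ConvexBody.insertPoint (C : ConvexBody Plane) (p : Plane) : ConvexBody Plane :=
  ⟨convexHull ℝ (insert p (C : Set Plane)), convex_convexHull ℝ _,
    isCompact_convexHull_insert C.convex C.isCompact C.nonempty p,
    (Set.insert_nonempty _ _).convexHull⟩

/-- The separation price is a lower bound for the number of queries. -/
lemma QueryAlgorithm.Classifies.separationPrice_le {A : QueryAlgorithm} {P : Finset Plane}
    (hA : A.Classifies P) {C : ConvexBody Plane} {O : Oracle}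
    (hO : IsSeparationOracle O (C : Set Plane)) {k : ℕ} {S : Set Plane}
    (hk : A.Produces O [] k S) : separationPrice P (C : Set Plane) ≤ k := by
  classical
  obtain ⟨Q, hQk, hQ⟩ := hk.exists_transcript
  have hS : S = (P : Set Plane) ∩ C := hA.eq_of_consistent hO hQ (fun q _ h => hO.inside h)
    fun q _ h hq => (hO.outside hq).1
  let Qin := Q.filter fun q => O q = .inside
  let g : Plane → HalfPlane := fun q => match O q with
    | .inside => HalfPlane.ofCoeffs 1 0 0 (by simp)
    | .outside h => h
  have hg : ∀ q h, O q = .outside h → g q = h := by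
    intro q h hq; simp only [g, hq]
  let Qout := Q.filter fun q => ¬ O q = .inside
  have hQc : Qin.card + Qout.card = Q.card := Finset.card_filter_add_card_filter_not _
  have hQout : ∀ q ∈ Qout, O q = .outside (g q) := by
    intro q hq
    have := (Finset.mem_filter.1 hq).2
    cases h : O q with
    | inside => exact absurd h this
    | outside h' => rw [hg q h' h]
  let Hs := Qout.image g
  let F : Set Plane := ⋂ h ∈ (Hs : Set HalfPlane), h.carrier
  have hmemF : ∀ z, z ∈ F ↔ ∀ q ∈ Qout, z ∈ (g q).carrier := by
    intro z; simp [F, Hs]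
  have hCF : (C : Set Plane) ⊆ F := fun z hz =>
    (hmemF z).2 fun q hq => (hO.outside (hQout q hq)).1 hz
  have hout : ∀ C' : ConvexBody Plane, (C' : Set Plane) ⊆ F →
      ∀ q ∈ Q, ∀ h, O q = .outside h → (C' : Set Plane) ⊆ h.carrier := by
    intro C' hC' q hq h hqh z hz
    have := (hmemF z).1 (hC' hz) q (Finset.mem_filter.2 ⟨hq, by rw [hqh]; simp⟩)
    rwa [hg q h hqh] at this
  have hFpoly : IsConvexPolygon F := ⟨Hs, Hs.finite_toSet, rfl⟩
  have hFP : (C : Set Plane) ∩ (P : Set Plane) = F ∩ (P : Set Plane) := by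
    refine Set.Subset.antisymm (fun p hp => ⟨hCF hp.1, hp.2⟩) fun p hp => ⟨?_, hp.2⟩
    -- Enlarging `C` by a point `p` that no returned half-plane excludes changes no answer, so the
    -- algorithm must have put `p` into its output already.
    have hcons := hA.eq_of_consistent (C' := C.insertPoint p) hO hQ
      (fun q _ h => subset_convexHull ℝ _ (Set.mem_insert_of_mem _ (hO.inside h)))
      (hout _ (convexHull_min (Set.insert_subset hp.1 hCF) hFpoly.convex))
    have : p ∈ S := by
      rw [hcons]; exact ⟨hp.2, subset_convexHull ℝ _ (Set.mem_insert _ _)⟩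
    rw [hS] at this
    exact this.2
  have hcardH : Hs.card ≤ Qout.card := Finset.card_image_le
  have houter : outerFenceSize P C ≤ Qout.card :=
    (outerFenceSize_le hFpoly hCF hFP).trans ((numVertices_iInter_le Hs).trans hcardH)
  rcases Qin.eq_empty_or_nonempty with hQin | hQin
  · rcases ((C : Set Plane) ∩ (P : Set Plane)).eq_empty_or_nonempty with hCP | ⟨p, hpC, hpP⟩
    · have : innerFenceSize P C ≤ 0 := by
        refine (innerFenceSize_le isConvexPolygon_empty (Set.empty_subset _)
          (by rw [hCP, Set.empty_inter])).trans ?_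
        simp [numVertices]
      rw [separationPrice]; omega
    · -- without a positive answer the body must be a single point
      have honly : ∀ c ∈ F, c = p := by
        intro c hc
        have hcons := hA.eq_of_consistent (C' := pointBody c) hO hQ
          (fun q hq h => (Finset.eq_empty_iff_forall_notMem.1 hQin q
            (Finset.mem_filter.2 ⟨hq, h⟩)).elim)
          (hout _ (Set.singleton_subset_iff.2 hc))
        have : p ∈ S := by rw [hS]; exact ⟨hpP, hpC⟩
        rw [hcons] at this
        exact (Set.mem_singleton_iff.1 this.2).symm
      have hFp : F = {p} := Set.Subset.antisymm honly (Set.singleton_subset_iff.2 (hCF hpC))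
      have hCp : (C : Set Plane) = {p} :=
        Set.Subset.antisymm (hCF.trans hFp.subset) (Set.singleton_subset_iff.2 hpC)
      have h1 : innerFenceSize P C ≤ 1 := by
        refine (innerFenceSize_le hFpoly (by rw [hFp, hCp]) hFP).trans ?_
        simp [hFp, numVertices]
      have h2 : outerFenceSize P C ≤ 1 := by
        refine (outerFenceSize_le hFpoly hCF hFP).trans ?_
        simp [hFp, numVertices]
      -- Both fences are the point `p`, so the price may be 2. A single half-plane, or none, would
      -- leave room to move `p` along a direction `w` inside `F = {p}`.
      have h3 : 2 ≤ Qout.card := by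
        by_contra hlt
        obtain ⟨n, hn⟩ : ∃ n : Plane, ∀ q ∈ Qout, (g q).normal = n := by
          rcases Qout.eq_empty_or_nonempty with h0 | ⟨q, hq⟩
          · exact ⟨0, by simp [h0]⟩
          · refine ⟨(g q).normal, fun r hr => ?_⟩
            rw [Finset.card_le_one.1 (by omega : Qout.card ≤ 1) r hr q hq]
        obtain ⟨w, hw, hnw⟩ := exists_perp n
        have hpw : p + w ∈ F := by
          refine (hmemF _).2 fun q hq => ?_
          have := (hmemF p).1 (hCF hpC) q hq
          have h0 : inner ℝ (g q).normal w = 0 := by rw [hn q hq, hnw]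
          show inner ℝ (g q).normal (p + w) ≤ (g q).offset
          rw [inner_add_right, h0, add_zero]
          exact this
        exact hw (by simpa using honly _ hpw)
      rw [separationPrice]; omega
  -- The hull of the positive queries is itself a consistent body, so it contains the same points of
  -- `P` as `C`.
  · have hcons := hA.eq_of_consistent (C' := hullBody Qin hQin) hO hQ
      (fun q hq h => subset_convexHull ℝ _ (Finset.mem_coe.2 (Finset.mem_filter.2 ⟨hq, h⟩)))
      (hout _ ((convexHull_min (fun q hq => hO.inside (Finset.mem_filter.1 hq).2) C.convex).trans
        hCF))
    have hinner : innerFenceSize P C ≤ Qin.card := by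
      refine (innerFenceSize_le (isConvexPolygon_convexHull Qin) (convexHull_min
        (fun q hq => hO.inside (Finset.mem_filter.1 hq).2) C.convex) ?_).trans
        (numVertices_convexHull_le Qin)
      rw [Set.inter_comm, ← hS, hcons, Set.inter_comm]; rfl
    rw [separationPrice]; omega

/-- A correct algorithm makes at least one query unless there is no point to classify. -/
lemma QueryAlgorithm.Classifies.pos_of_nonempty {A : QueryAlgorithm} {P : Finset Plane}
    (hA : A.Classifies P) (hP : P.Nonempty) {C : ConvexBody Plane} {O : Oracle}
    (hO : IsSeparationOracle O (C : Set Plane)) {k : ℕ} {S : Set Plane}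
    (hk : A.Produces O [] k S) : 1 ≤ k := by
  by_contra hk0
  obtain ⟨Q, hQk, hQ⟩ := hk.exists_transcript
  obtain rfl : Q = ∅ := Finset.card_eq_zero.1 (by omega)
  obtain ⟨p, hp⟩ := hP
  -- Without any query, every one-point body is consistent.
  have key : ∀ c : Plane, S = (P : Set Plane) ∩ {c} := fun c =>
    hA.eq_of_consistent (C' := pointBody c) hO hQ (by simp) (by simp)
  have h1 : p ∈ S := by rw [key p]; exact ⟨hp, rfl⟩
  rw [key (p + mkPt 1 0)] at h1
  have h2 := congrArg (fun z : Plane => z 0) (Set.mem_singleton_iff.1 h1.2)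
  simp at h2

/-! ### A logarithmic potential -/

/-- The potential of a set of `m` points. -/
def pot (m : ℕ) : ℕ := Nat.log 2 (2 * m ^ 2)

lemma pot_mono {m m' : ℕ} (h : m' ≤ m) : pot m' ≤ pot m :=
  Nat.log_mono_right (Nat.mul_le_mul_left 2 (Nat.pow_le_pow_left h 2))

lemma pot_pos {m : ℕ} (h : 1 ≤ m) : 1 ≤ pot m := by
  have := pot_mono h
  rwa [show pot 1 = 1 by norm_num [pot]] at this

/-- The square turns the factor 2/3 into 4/9, which is below 1/2 and so costs a full binary digit.
The factor 2 gives `pot 1 = 1`, while `Nat.log` gives `pot 0 = 0`, so removing the last point also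
counts. -/
lemma pot_succ_le {m m' : ℕ} (h : 3 * m' ≤ 2 * m) (hm : 1 ≤ m) : pot m' + 1 ≤ pot m := by
  rcases Nat.eq_zero_or_pos m' with rfl | hm'
  · simpa [pot] using pot_pos hm
  · rw [pot, ← Nat.log_mul_base one_lt_two (by positivity)]
    exact Nat.log_mono_right (by nlinarith)

/-- Here `1 + 2 log₂ n ≤ 3 log₂ n`, and `3 / log 2 < 5`. -/
lemma pot_le_log {n : ℕ} (hn : 2 ≤ n) : (pot n : ℝ) ≤ 5 * Real.log n := by
  have h1 : (pot n : ℝ) ≤ Real.logb 2 ((2 * n ^ 2 : ℕ) : ℝ) := Real.natLog_le_logb _ _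
  have hn' : (2 : ℝ) ≤ n := by exact_mod_cast hn
  have hl : Real.log 2 ≤ Real.log n := Real.log_le_log two_pos hn'
  have h2 := Real.log_two_gt_d9
  refine h1.trans ?_
  rw [Real.logb, div_le_iff₀ (by linarith)]
  push_cast
  rw [Real.log_mul two_ne_zero (by positivity), Real.log_pow]
  push_cast
  nlinarith

lemma pot_sq_le_log {n : ℕ} (hn : 2 ≤ n) : (pot (n ^ 2) : ℝ) ≤ 10 * Real.log n := by
  have := pot_le_log (n := n ^ 2) (by nlinarith)
  push_cast at this
  rw [Real.log_pow] at this
  push_cast at this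
  linarith

/-! ### Counting the splits -/

/-- The split of a pocket: its walls and the number of its points. -/
structure Split where
  left : ℝ
  right : ℝ
  size : ℕ

/-- Each split is encoded by its potential and a key: an element of `W` in its interval if there is
one (`W.card` keys), otherwise the number of elements of `W` up to its left end (`W.card + 1` keys).
The code is injective: splits of equal potential have non-overlapping intervals by `hsep`, and
non-overlapping intervals get different keys. -/
lemma card_splits_le (R : Finset Split) (W : Finset ℝ) (N : ℕ) (wit : Split → Prop)
    (hN : ∀ ρ ∈ R, 1 ≤ pot ρ.size ∧ pot ρ.size ≤ N)
    (hact : ∀ ρ ∈ R, (∃ w ∈ W, ρ.left < w ∧ w < ρ.right) ∨ wit ρ)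
    (hpair : ∀ ρ ∈ R, ∀ ρ' ∈ R, wit ρ → wit ρ' → ρ.right ≤ ρ'.left →
      ∃ w ∈ W, ρ.left < w ∧ w < ρ'.right)
    (hsep : ∀ ρ ∈ R, ∀ ρ' ∈ R, ρ.right ≤ ρ'.left ∨ ρ'.right ≤ ρ.left ∨
      pot ρ.size ≠ pot ρ'.size ∨ ρ = ρ') : R.card ≤ (2 * W.card + 1) * N := by
  classical
  let key : Split → ℝ ⊕ ℕ := fun ρ =>
    if h : ∃ w ∈ W, ρ.left < w ∧ w < ρ.right then Sum.inl h.choose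
    else Sum.inr (W.filter fun w => w ≤ ρ.left).card
  have hcard : (((W.disjSum (Finset.range (W.card + 1))) ×ˢ Finset.Icc 1 N).card) =
      (2 * W.card + 1) * N := by
    rw [Finset.card_product, Finset.card_disjSum, Finset.card_range, Nat.card_Icc]
    congr 1; omega
  rw [← hcard]
  refine Finset.card_le_card_of_injOn (fun ρ => (key ρ, pot ρ.size)) ?_ ?_
  · intro ρ hρ
    refine Finset.mem_coe.2 (Finset.mem_product.2 ⟨?_, Finset.mem_Icc.2 (hN ρ hρ)⟩)
    simp only [key]
    split_ifs with h
    · exact Finset.inl_mem_disjSum.2 h.choose_spec.1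
    · exact Finset.inr_mem_disjSum.2 (Finset.mem_range.2
        (Nat.lt_succ_of_le (Finset.card_filter_le _ _)))
  · intro ρ hρ ρ' hρ' heq
    simp only [Prod.mk.injEq] at heq
    have hdisj : ∀ ρ ∈ R, ∀ ρ' ∈ R, key ρ = key ρ' → ¬ ρ.right ≤ ρ'.left := by
      intro ρ hρ ρ' hρ' hk hle
      simp only [key] at hk
      split_ifs at hk with h1 h2
      · have e := Sum.inl.inj hk
        have s1 := h1.choose_spec
        have s2 := h2.choose_spec
        rw [← e] at s2
        linarith [s1.2.2, s2.2.1]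
      · have w1 := (hact ρ hρ).resolve_left h1
        rename_i h2
        have w2 := (hact ρ' hρ').resolve_left h2
        obtain ⟨w, hw, hlw, hwr⟩ := hpair ρ hρ ρ' hρ' w1 w2 hle
        have e := Sum.inr.inj hk
        -- The element `w` supplied by `hpair` is not inside the right interval, so it is counted
        -- for `ρ'`; being greater than `ρ.left`, it is not counted for `ρ`.
        have hwl : w ≤ ρ'.left := by
          by_contra hlt
          exact h2 ⟨w, hw, not_le.1 hlt, hwr⟩
        refine absurd e (ne_of_lt (Finset.card_lt_card ?_))
        refine Finset.ssubset_iff_subset_ne.2 ⟨fun x hx => ?_, fun he => ?_⟩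
        · rw [Finset.mem_filter] at hx ⊢
          exact ⟨hx.1, hx.2.trans (hlw.le.trans hwl)⟩
        · have : w ∈ W.filter fun w => w ≤ ρ'.left := Finset.mem_filter.2 ⟨hw, hwl⟩
          rw [← he, Finset.mem_filter] at this
          linarith [this.2]
    rcases hsep ρ hρ ρ' hρ' with h | h | h | h
    · exact absurd h (hdisj ρ hρ ρ' hρ' heq.1)
    · exact absurd h (hdisj ρ' hρ' ρ hρ heq.1.symm)
    · exact absurd heq.2 h
    · exact h

/-- `W` contains the abscissas of the vertices of an inner and an outer fence. -/
structure FenceAbscissas (P : Finset Plane) (C : Set Plane) (W : Finset ℝ) : Prop where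
  inner : ∃ F : Set Plane, IsConvexPolygon F ∧ F ⊆ C ∧ C ∩ (P : Set Plane) = F ∩ (P : Set Plane) ∧
    ∀ v ∈ F.extremePoints ℝ, v 0 ∈ W
  outer : ∃ F : Set Plane, IsConvexPolygon F ∧ C ⊆ F ∧ C ∩ (P : Set Plane) = F ∩ (P : Set Plane) ∧
    ∀ v ∈ F.extremePoints ℝ, v 0 ∈ W

lemma exists_fenceAbscissas (P : Finset Plane) (C : ConvexBody Plane) :
    ∃ W : Finset ℝ, FenceAbscissas P C W ∧ W.card ≤ separationPrice P (C : Set Plane) := by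
  classical
  obtain ⟨F, hF, hFC, hFP, hFn⟩ := exists_innerFence P C.convex
  obtain ⟨G, hG, hCG, hGP, hGn⟩ := exists_outerFence P C
  let V := hF.finite_extremePoints.toFinset.image (fun v : Plane => v 0) ∪
    hG.finite_extremePoints.toFinset.image (fun v : Plane => v 0)
  refine ⟨V, ⟨⟨F, hF, hFC, hFP, fun v hv => ?_⟩, ⟨G, hG, hCG, hGP, fun v hv => ?_⟩⟩, ?_⟩
  · exact Finset.mem_union_left _ (Finset.mem_image.2 ⟨v, by simpa using hv, rfl⟩)
  · exact Finset.mem_union_right _ (Finset.mem_image.2 ⟨v, by simpa using hv, rfl⟩)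
  · rw [separationPrice, ← hFn, ← hGn, numVertices, numVertices,
      Set.ncard_eq_toFinset_card _ hF.finite_extremePoints,
      Set.ncard_eq_toFinset_card _ hG.finite_extremePoints]
    exact (Finset.card_union_le _ _).trans
      (add_le_add Finset.card_image_le Finset.card_image_le)

/-! ### Chains -/

lemma Direction.coord_add_smul (e : Direction) (p q : Plane) (s t : ℝ) :
    e.coord (s • p + t • q) = s * e.coord p + t * e.coord q := by
  cases e <;> (simp [Direction.coord]; try ring)

lemma Direction.eq_of_coord_eq (e : Direction) {p q : Plane} (h : e.coord p = e.coord q) :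
    p 0 = q 0 := by
  cases e <;> simpa [Direction.coord] using h

lemma Direction.continuous_coord (e : Direction) : Continuous e.coord := by
  cases e
  · show Continuous fun p : Plane => p 0
    fun_prop
  · show Continuous fun p : Plane => -p 0
    fun_prop

lemma Side.continuous_height (d : Side) : Continuous d.height := by
  cases d
  · show Continuous fun p : Plane => p 1
    fun_prop
  · show Continuous fun p : Plane => -p 1
    fun_prop

lemma eq_of_convex_comb_le {s t x y c : ℝ} (hs : 0 < s) (ht : 0 < t) (hst : s + t = 1)
    (hx : x ≤ c) (hy : y ≤ c) (h : s * x + t * y = c) : x = c ∧ y = c := by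
  have h1 := mul_nonneg hs.le (sub_nonneg.2 hx)
  have h2 := mul_nonneg ht.le (sub_nonneg.2 hy)
  have h3 : s * c + t * c = c := by rw [← add_mul, hst, one_mul]
  constructor
  · have : s * (c - x) = 0 := by linarith
    rcases mul_eq_zero.1 this with h | h <;> linarith
  · have : t * (c - y) = 0 := by linarith
    rcases mul_eq_zero.1 this with h | h <;> linarith

/-- A chain reaches to the extreme abscissas. -/
lemma exists_mem_chain (d : Side) (e : Direction) {B : Set Plane} (hB : IsCompact B)
    (hne : B.Nonempty) : ∃ v ∈ d.chain B, ∀ b ∈ B, e.coord b ≤ e.coord v := by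
  obtain ⟨w, hw, hmax⟩ := hB.exists_isMaxOn hne e.continuous_coord.continuousOn
  have hA : IsCompact (B ∩ {b | e.coord b = e.coord w}) :=
    hB.inter_right (isClosed_eq e.continuous_coord continuous_const)
  -- Lexicographic maximum: first the coordinate along `e`, then the height. Such a point is
  -- extreme.
  obtain ⟨v, hv, hvmax⟩ := hA.exists_isMaxOn ⟨w, hw, rfl⟩ d.continuous_height.continuousOn
  have hev : e.coord v = e.coord w := hv.2
  have hle : ∀ b ∈ B, e.coord b ≤ e.coord v := fun b hb => hev ▸ hmax hb
  have htop : ∀ b ∈ B, e.coord b = e.coord v → d.height b ≤ d.height v := fun b hb h =>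
    hvmax ⟨hb, h.trans hev⟩
  refine ⟨v, ⟨mem_extremePoints.2 ⟨hv.1, fun x₁ h₁ x₂ h₂ hx => ?_⟩, fun b hb hb0 => ?_⟩, hle⟩
  · obtain ⟨s, t, hs, ht, hst, hc⟩ := hx
    obtain ⟨c1, c2⟩ := eq_of_convex_comb_le hs ht hst (hle x₁ h₁) (hle x₂ h₂)
      (by rw [← Direction.coord_add_smul, hc])
    obtain ⟨g1, g2⟩ := eq_of_convex_comb_le hs ht hst (htop x₁ h₁ c1) (htop x₂ h₂ c2)
      (by rw [← Side.height_add_smul, hc])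
    exact ⟨d.eq_of_height_eq (e.eq_of_coord_eq c1) g1, d.eq_of_height_eq (e.eq_of_coord_eq c2) g2⟩
  · refine htop b hb ?_
    cases e <;> simp [Direction.coord, hb0]

/-- The opposite side. -/
def Side.opposite : Side → Side
  | .above => .below
  | .below => .above

lemma Side.height_opposite (d : Side) (p : Plane) : d.opposite.height p = -d.height p := by
  cases d <;> simp [Side.opposite, Side.height]

/-- Adding a point on one side of a convex set gives no new vertices in the opposite chain. -/
lemma chain_opposite_insert_subset (d : Side) {B : Set Plane} {q : Plane}
    (hq : ∃ b ∈ B, b 0 = q 0 ∧ d.height b ≤ d.height q) :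
    d.opposite.chain (convexHull ℝ (insert q B)) ⊆ d.opposite.chain B := by
  rintro v ⟨hv, hlow⟩
  have hBB : B ⊆ convexHull ℝ (insert q B) :=
    (Set.subset_insert q B).trans (subset_convexHull ℝ _)
  have hvB : v ∈ B := by
    -- The new point can be in the opposite chain only if it coincides with the point of `B` at or
    -- behind it.
    rcases extremePoints_convexHull_subset hv with rfl | h
    · obtain ⟨b, hb, hb0, hbh⟩ := hq
      have := hlow b (hBB hb) hb0
      rw [Side.height_opposite, Side.height_opposite] at this
      rwa [← d.eq_of_height_eq hb0 (by linarith)]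
    · exact h
  refine ⟨inter_extremePoints_subset_extremePoints_of_subset hBB ⟨hvB, hv⟩,
    fun b hb hb0 => hlow b (hBB hb) hb0⟩

/-! ### The invariants of a sweep -/

/-- The unclassified points over `B` to the right of the wall `c`, up to the next wall. -/
def cell (d : Side) (B U : Set Plane) (walls : Finset ℝ) (c : ℝ) : Set Plane :=
  {p ∈ U | d.Over B p ∧ c < p 0 ∧ ∀ t ∈ walls, c < t → p 0 < t}

/-- Indexing pockets by their left wall lets potentials be summed over `walls` and compared cell by
cell, even when a wall is added. -/
lemma cell_anti {d : Side} {B B' U U' : Set Plane} {walls walls' : Finset ℝ} (hB : B ⊆ B')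
    (hU : U' ⊆ U) (hw : walls ⊆ walls') (hx : ∀ p ∈ U, ∃ b ∈ B, b 0 = p 0) (c : ℝ) :
    cell d B' U' walls' c ⊆ cell d B U walls c := fun p hp =>
  ⟨hU hp.1, hp.2.1.anti hB (hx p (hU hp.1)), hp.2.2.1, fun t ht hct => hp.2.2.2 t (hw ht) hct⟩

/-- The points of a pocket. -/
def pocketPoints (d : Side) (B U : Set Plane) (a b : ℝ) : Set Plane :=
  {p ∈ U | a < p 0 ∧ p 0 < b ∧ d.Over B p}

lemma cell_eq_pocketPoints {d : Side} {B U : Set Plane} {walls : Finset ℝ} {a b : ℝ}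
    (h : Consecutive (walls : Set ℝ) a b) : cell d B U walls a = pocketPoints d B U a b := by
  ext p
  constructor
  · rintro ⟨hp, hov, hap, hw⟩
    exact ⟨hp, hap, hw b h.2.1 h.2.2.1, hov⟩
  · rintro ⟨hp, hap, hpb, hov⟩
    refine ⟨hp, hov, hap, fun t ht hat => ?_⟩
    rcases h.2.2.2 t ht with h' | h' <;> linarith

/-- The invariants during the treatment of one side. The lines in `dirty` have not been cleaned
yet; `R` records the splits made so far. -/
structure SweepInv (P : Finset Plane) (C : Set Plane) (W : Finset ℝ) (d : Side) (B U : Set Plane)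
    (walls : Finset ℝ) (dirty : Set ℝ) (R : Finset Split) : Prop where
  covered : ∀ p ∈ U, ∃ b ∈ B, b 0 = p 0
  walls_over : ∀ t ∈ walls, ∃ b ∈ B, b 0 = t
  lower : ∀ p ∈ U, ∃ t ∈ walls, t ≤ p 0
  upper : ∀ p ∈ U, ∃ t ∈ walls, p 0 ≤ t
  clean : ∀ t ∈ walls, t ∉ dirty → CleanLine P C d B U t
  split_walls : ∀ ρ ∈ R, ρ.left ∈ walls ∧ ρ.right ∈ walls
  split_size : ∀ ρ ∈ R, 1 ≤ ρ.size ∧ ρ.size ≤ P.card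
  active : ∀ ρ ∈ R, (∃ w ∈ W, ρ.left < w ∧ w < ρ.right) ∨
    ∃ p, PocketWitness P C d ρ.left ρ.right p
  separated : ∀ ρ ∈ R, ∀ ρ' ∈ R, ρ.right ≤ ρ'.left ∨ ρ'.right ≤ ρ.left ∨
    pot ρ.size ≠ pot ρ'.size ∨ ρ = ρ'
  shrinks : ∀ ρ ∈ R, ∀ c ∈ walls, ρ.left ≤ c → c < ρ.right →
    3 * (cell d B U walls c).ncard ≤ 2 * ρ.size

lemma CleanLine.mono {P : Finset Plane} {C : Set Plane} {d : Side} {B B' U U' : Set Plane} {t : ℝ}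
    (h : CleanLine P C d B U t) (hB : B ⊆ B') (hU : U' ⊆ U) (hx : ∃ b ∈ B, b 0 = t) :
    CleanLine P C d B' U' t := fun u hu =>
  ⟨(h u (interestPoints_anti hB hx hu)).1, fun hu' => (h u (interestPoints_anti hB hx hu)).2 (hU hu')⟩

section

variable {P : Finset Plane} {C : Set Plane} {W : Finset ℝ} {d : Side} {B U : Set Plane}
  {walls : Finset ℝ} {dirty : Set ℝ} {R : Finset Split}

lemma SweepInv.cell_finite (hUP : U ⊆ P) (c : ℝ) : (cell d B U walls c).Finite :=
  P.finite_toSet.subset fun _ hp => hUP hp.1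

lemma SweepInv.mono (h : SweepInv P C W d B U walls dirty R) {B' U' : Set Plane} (hB : B ⊆ B')
    (hU : U' ⊆ U) (hUP : U ⊆ P) : SweepInv P C W d B' U' walls dirty R where
  covered p hp := let ⟨b, hb, h0⟩ := h.covered p (hU hp); ⟨b, hB hb, h0⟩
  walls_over t ht := let ⟨b, hb, h0⟩ := h.walls_over t ht; ⟨b, hB hb, h0⟩
  lower p hp := h.lower p (hU hp)
  upper p hp := h.upper p (hU hp)
  clean t ht htd := (h.clean t ht htd).mono hB hU (h.walls_over t ht)
  split_walls := h.split_walls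
  split_size := h.split_size
  active := h.active
  separated := h.separated
  shrinks ρ hρ c hc h1 h2 := by
    have := Set.ncard_le_ncard (cell_anti hB hU subset_rfl h.covered c)
      (SweepInv.cell_finite hUP (d := d) (B := B) (walls := walls) c)
    have := h.shrinks ρ hρ c hc h1 h2
    omega

lemma SweepInv.card_le (h : SweepInv P C W d B U walls dirty R) (hC : Convex ℝ C)
    (hCb : Bornology.IsBounded C) (hW : FenceAbscissas P C W) :
    R.card ≤ (2 * W.card + 1) * pot P.card := by
  obtain ⟨F, hF, hFC, hFP, hFW⟩ := hW.inner
  refine card_splits_le R W (pot P.card) (fun ρ => ∃ p, PocketWitness P C d ρ.left ρ.right p)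
    (fun ρ hρ => ⟨pot_pos (h.split_size ρ hρ).1, pot_mono (h.split_size ρ hρ).2⟩) h.active ?_
    h.separated
  rintro ρ - ρ' - ⟨p, hp⟩ ⟨p', hp'⟩ hle
  obtain ⟨v, hv, hl, hr⟩ := hp.exists_vertex hC hCb hF hFC hFP hp' hle
  exact ⟨v 0, hFW v hv, hl, hr⟩

/-- A centerpoint of a pocket is over the inner approximation, strictly between the walls. -/
lemma pocket_centerpoint (hB : Convex ℝ B) (hUP : U ⊆ P) {a b : ℝ} {q : Plane}
    (ha : ∃ z ∈ B, z 0 = a) (hb : ∃ z ∈ B, z 0 = b) (hne : (pocketPoints d B U a b).Nonempty)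
    (hq : IsCenterpoint (pocketPoints d B U a b) q) :
    a < q 0 ∧ q 0 < b ∧ ∃ z ∈ B, z 0 = q 0 ∧ d.height z ≤ d.height q := by
  have hfin : (pocketPoints d B U a b).Finite := P.finite_toSet.subset fun p hp => hUP hp.1
  have haq : a < q 0 := by
    have := hq.notMem hne hfin (h := HalfPlane.ofCoeffs 1 0 a (by simp)) fun p hp hp' => by
      rw [HalfPlane.mem_ofCoeffs] at hp'
      linarith [hp.2.1]
    rw [HalfPlane.mem_ofCoeffs] at this
    linarith
  have hqb : q 0 < b := by
    have := hq.notMem hne hfin (h := HalfPlane.ofCoeffs (-1) 0 (-b) (by simp)) fun p hp hp' => by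
      rw [HalfPlane.mem_ofCoeffs] at hp'
      linarith [hp.2.2.1]
    rw [HalfPlane.mem_ofCoeffs] at this
    linarith
  refine ⟨haq, hqb, ?_⟩
  obtain ⟨u, hu, hu0⟩ := ha
  obtain ⟨v, hv, hv0⟩ := hb
  have hne' : v 0 - u 0 ≠ 0 := by linarith
  obtain ⟨m, k, hul, hvl⟩ : ∃ m k, d.height u = m * u 0 + k ∧ d.height v = m * v 0 + k :=
    ⟨(d.height v - d.height u) / (v 0 - u 0),
      d.height u - (d.height v - d.height u) / (v 0 - u 0) * u 0, by ring, by field_simp; ring⟩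
  obtain ⟨z, hz, hz0, hzh⟩ := hB.exists_mem_line d hu hv hul hvl (x := q 0) (by linarith)
    (by linarith)
  refine ⟨z, hz, hz0, ?_⟩
  have := hq.notMem hne hfin (h := d.belowLine m k) fun p hp hp' => by
    rw [Side.mem_belowLine] at hp'
    obtain ⟨y, hy, hy0, hyh⟩ := hB.exists_mem_line d hu hv hul hvl (x := p 0)
      (by linarith [hp.2.1]) (by linarith [hp.2.2.1])
    linarith [hp.2.2.2.2 y hy hy0]
  rw [Side.mem_belowLine] at this
  linarith

/-- The invariants after a split. -/
lemma SweepInv.split [DecidableEq Split] (h : SweepInv P C W d B U walls ∅ R) (hC : Convex ℝ C)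
    (hW : FenceAbscissas P C W) (hB : Convex ℝ B) (hBC : B ⊆ C) (hUP : U ⊆ P) {a b : ℝ}
    (hab : Consecutive (walls : Set ℝ) a b) {q : Plane}
    (hne : (pocketPoints d B U a b).Nonempty)
    (hq : IsCenterpoint (pocketPoints d B U a b) q) (hqC : q ∈ C) {B' U' : Set Plane}
    (hBB : B ⊆ B') (hqB : q ∈ B') (hUU : U' ⊆ U) :
    SweepInv P C W d B' U' (insert (q 0) walls) {q 0}
      (insert ⟨a, b, (pocketPoints d B U a b).ncard⟩ R) ∧
    (⟨a, b, (pocketPoints d B U a b).ncard⟩ : Split) ∉ R := by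
  set S := pocketPoints d B U a b with hS
  have hfin : S.Finite := P.finite_toSet.subset fun p hp => hUP hp.1
  have hpos : 1 ≤ S.ncard := (Set.ncard_pos hfin).2 hne
  have hcellS : cell d B U walls a = S := cell_eq_pocketPoints hab
  obtain ⟨haw, hbw, hlt, hcons⟩ := hab
  have hxa := h.walls_over a haw
  have hxb := h.walls_over b hbw
  obtain ⟨haq, hqb, -⟩ := pocket_centerpoint hB hUP hxa hxb hne hq
  have hsub := cell_anti (d := d) hBB hUU (Finset.subset_insert (q 0) walls) h.covered
  have hcard : ∀ c, (cell d B' U' (insert (q 0) walls) c).ncard ≤ (cell d B U walls c).ncard :=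
    fun c => Set.ncard_le_ncard (hsub c) (SweepInv.cell_finite hUP c)
  -- An earlier split that overlaps the pocket has its walls among the present ones; since `a`, `b`
  -- are consecutive, its left wall is at most `a`, and `shrinks` applies to the cell at `a`.
  have hlow : ∀ ρ ∈ R, ρ.left < b → a < ρ.right → ρ.left ≤ a ∧ 3 * S.ncard ≤ 2 * ρ.size := by
    intro ρ hρ h1 h2
    have hle : ρ.left ≤ a := (hcons _ (h.split_walls ρ hρ).1).resolve_right (not_le.2 h1)
    refine ⟨hle, ?_⟩
    rw [← hcellS]
    exact h.shrinks ρ hρ a haw hle h2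
  have hcellq : cell d B' U' (insert (q 0) walls) (q 0) ⊆ {p ∈ S | q 0 < p 0} := by
    intro p hp
    refine ⟨⟨hUU hp.1, haq.trans hp.2.2.1, ?_, hp.2.1.anti hBB (h.covered p (hUU hp.1))⟩, hp.2.2.1⟩
    exact hp.2.2.2 b (Finset.mem_insert_of_mem hbw) hqb
  refine ⟨⟨?_, ?_, ?_, ?_, ?_, ?_, ?_, ?_, ?_, ?_⟩, fun hmem => ?_⟩
  · exact fun p hp => let ⟨z, hz, h0⟩ := h.covered p (hUU hp); ⟨z, hBB hz, h0⟩
  · intro t ht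
    rcases Finset.mem_insert.1 ht with rfl | ht
    · exact ⟨q, hqB, rfl⟩
    · obtain ⟨z, hz, h0⟩ := h.walls_over t ht; exact ⟨z, hBB hz, h0⟩
  · exact fun p hp => let ⟨t, ht, h0⟩ := h.lower p (hUU hp); ⟨t, Finset.mem_insert_of_mem ht, h0⟩
  · exact fun p hp => let ⟨t, ht, h0⟩ := h.upper p (hUU hp); ⟨t, Finset.mem_insert_of_mem ht, h0⟩
  · intro t ht htq
    have ht' := (Finset.mem_insert.1 ht).resolve_left htq
    exact (h.clean t ht' (Set.notMem_empty t)).mono hBB hUU (h.walls_over t ht')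
  · intro ρ hρ
    rcases Finset.mem_insert.1 hρ with rfl | hρ
    · exact ⟨Finset.mem_insert_of_mem haw, Finset.mem_insert_of_mem hbw⟩
    · exact ⟨Finset.mem_insert_of_mem (h.split_walls ρ hρ).1,
        Finset.mem_insert_of_mem (h.split_walls ρ hρ).2⟩
  · intro ρ hρ
    rcases Finset.mem_insert.1 hρ with rfl | hρ
    · refine ⟨hpos, ?_⟩
      rw [← Set.ncard_coe_finset]
      exact Set.ncard_le_ncard (fun p hp => hUP hp.1) P.finite_toSet
    · exact h.split_size ρ hρ
  · intro ρ hρ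
    rcases Finset.mem_insert.1 hρ with rfl | hρ
    · obtain ⟨G, hG, hCG, hGP, hGW⟩ := hW.outer
      rcases pocket_active (U := U) hC hG hCG hGP hB hBC hxa hxb (h.clean a haw (Set.notMem_empty a))
        (h.clean b hbw (Set.notMem_empty b)) hne (fun p hp => hUP hp.1) (fun p hp => hp.2) hq hqC
        haq hqb with ⟨v, hv, h1, h2⟩ | hp
      · exact Or.inl ⟨v 0, hGW v hv, h1, h2⟩
      · exact Or.inr hp
    · exact h.active ρ hρ
  -- An overlapping earlier split was larger by a factor 3/2, so its potential is greater by at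
  -- least one.
  · have key : ∀ ρ ∈ R, b ≤ ρ.left ∨ ρ.right ≤ a ∨ pot S.ncard ≠ pot ρ.size := by
      intro ρ hρ
      by_cases h1 : b ≤ ρ.left
      · exact Or.inl h1
      by_cases h2 : ρ.right ≤ a
      · exact Or.inr (Or.inl h2)
      have h3 := (hlow ρ hρ (not_le.1 h1) (not_le.1 h2)).2
      have := pot_succ_le h3 (h.split_size ρ hρ).1
      exact Or.inr (Or.inr (by omega))
    intro ρ hρ ρ' hρ'
    rcases Finset.mem_insert.1 hρ with rfl | hρ <;> rcases Finset.mem_insert.1 hρ' with rfl | hρ'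
    · exact Or.inr (Or.inr (Or.inr rfl))
    · rcases key ρ' hρ' with h | h | h
      · exact Or.inl h
      · exact Or.inr (Or.inl h)
      · exact Or.inr (Or.inr (Or.inl h))
    · rcases key ρ hρ with h | h | h
      · exact Or.inr (Or.inl h)
      · exact Or.inl h
      · exact Or.inr (Or.inr (Or.inl h.symm))
    · exact h.separated ρ hρ ρ' hρ'
  · intro ρ hρ c hc h1 h2
    rcases Finset.mem_insert.1 hρ with rfl | hρ
    · rcases Finset.mem_insert.1 hc with rfl | hc
      -- The vertical line through the centerpoint leaves at most two thirds of the points strictly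
      -- on either side.
      · refine hq.ncard_le (h := HalfPlane.ofCoeffs 1 0 (q 0) (by simp)) hfin
          (HalfPlane.mem_ofCoeffs.2 (by linarith)) fun p hp => ⟨(hcellq hp).1, fun hp' => ?_⟩
        rw [HalfPlane.mem_ofCoeffs] at hp'
        linarith [(hcellq hp).2]
      · obtain rfl : c = a := le_antisymm ((hcons c hc).resolve_right (not_le.2 h2)) h1
        refine hq.ncard_le (h := HalfPlane.ofCoeffs (-1) 0 (-q 0) (by simp)) hfin
          (HalfPlane.mem_ofCoeffs.2 (by linarith)) fun p hp => ⟨hcellS ▸ hsub c hp, fun hp' => ?_⟩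
        rw [HalfPlane.mem_ofCoeffs] at hp'
        linarith [hp.2.2.2 (q 0) (Finset.mem_insert_self _ _) haq]
    · rcases Finset.mem_insert.1 hc with rfl | hc
      · have h3 := (hlow ρ hρ (h1.trans_lt hqb) (haq.trans h2)).2
        have := Set.ncard_le_ncard (hcellq.trans (Set.sep_subset _ _)) hfin
        omega
      · have h3 := h.shrinks ρ hρ c hc h1 h2
        have := hcard c
        omega
  -- If the split were recorded already, its nonempty pocket would be at most two thirds of itself.
  · have h3 := (hlow _ hmem hlt hlt).2
    simp only at h3
    omega

/-! ### The potential summed over all pockets of a side -/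

/-- The total potential of the pockets. -/
noncomputable def totalPot (d : Side) (B U : Set Plane) (walls : Finset ℝ) : ℕ :=
  ∑ c ∈ walls, pot (cell d B U walls c).ncard

lemma totalPot_le (hUP : U ⊆ P) : totalPot d B U walls ≤ walls.card * pot P.card := by
  refine Finset.sum_le_card_nsmul _ _ _ fun c _ => pot_mono ?_
  rw [← Set.ncard_coe_finset]
  exact Set.ncard_le_ncard (fun p hp => hUP hp.1) P.finite_toSet

lemma totalPot_mono (hUP : U ⊆ P) (hx : ∀ p ∈ U, ∃ b ∈ B, b 0 = p 0) {B' U' : Set Plane}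
    (hB : B ⊆ B') (hU : U' ⊆ U) : totalPot d B' U' walls ≤ totalPot d B U walls :=
  Finset.sum_le_sum fun c _ => pot_mono (Set.ncard_le_ncard (cell_anti hB hU subset_rfl hx c)
    (SweepInv.cell_finite hUP c))

lemma totalPot_succ_le (hUP : U ⊆ P) (hx : ∀ p ∈ U, ∃ b ∈ B, b 0 = p 0) {B' U' : Set Plane}
    (hB : B ⊆ B') (hU : U' ⊆ U) {a : ℝ} (ha : a ∈ walls)
    (hpos : 1 ≤ (cell d B U walls a).ncard)
    (hlt : 3 * (cell d B' U' walls a).ncard ≤ 2 * (cell d B U walls a).ncard) :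
    totalPot d B' U' walls + 1 ≤ totalPot d B U walls :=
  Finset.sum_lt_sum (fun c _ => pot_mono (Set.ncard_le_ncard (cell_anti hB hU subset_rfl hx c)
    (SweepInv.cell_finite hUP c))) ⟨a, ha, pot_succ_le hlt hpos⟩

/-- Only the cell at the new wall is new; the old cells do not grow. -/
lemma totalPot_insert_le (hUP : U ⊆ P) (hx : ∀ p ∈ U, ∃ b ∈ B, b 0 = p 0) {B' U' : Set Plane}
    (hB : B ⊆ B') (hU : U' ⊆ U) (x : ℝ) :
    totalPot d B' U' (insert x walls) ≤ totalPot d B U walls + pot P.card := by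
  have hle : ∀ c, pot (cell d B' U' (insert x walls) c).ncard ≤ pot (cell d B U walls c).ncard :=
    fun c => pot_mono (Set.ncard_le_ncard (cell_anti hB hU (Finset.subset_insert _ _) hx c)
      (SweepInv.cell_finite hUP c))
  have hN : pot (cell d B' U' (insert x walls) x).ncard ≤ pot P.card := by
    refine pot_mono ?_
    rw [← Set.ncard_coe_finset]
    exact Set.ncard_le_ncard (fun p hp => hUP (hU hp.1)) P.finite_toSet
  have hsum := Finset.sum_le_sum (s := walls) fun c _ => hle c
  rw [totalPot, totalPot]
  by_cases hxw : x ∈ walls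
  · rw [Finset.insert_eq_of_mem hxw] at hsum ⊢
    omega
  · rw [Finset.sum_insert hxw]
    omega

end

/-! ### Processing an answer -/

/-- The invariants that hold throughout a run. -/
structure BaseInv (P : Finset Plane) (C : Set Plane) (s : State) : Prop where
  hull : ∃ D : Finset Plane, s.inner = convexHull ℝ (D : Set Plane)
  inner_subset : s.inner ⊆ C
  unclassified_subset : s.unclassified ⊆ P
  unclassified_notMem : ∀ p ∈ s.unclassified, p ∉ s.inner
  markedIn_subset : s.markedIn ⊆ (P : Set Plane) ∩ C
  markedOut_subset : s.markedOut ⊆ (P : Set Plane) \ C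
  subset_union : (P : Set Plane) ⊆ s.unclassified ∪ s.markedIn ∪ s.markedOut

lemma BaseInv.setPhase {P : Finset Plane} {C : Set Plane} {s : State} (h : BaseInv P C s)
    (φ : Phase) : BaseInv P C { s with phase := φ } :=
  ⟨h.hull, h.inner_subset, h.unclassified_subset, h.unclassified_notMem, h.markedIn_subset,
    h.markedOut_subset, h.subset_union⟩

lemma BaseInv.convex {P : Finset Plane} {C : Set Plane} {s : State} (h : BaseInv P C s) :
    Convex ℝ s.inner := by
  obtain ⟨D, hD⟩ := h.hull
  rw [hD]; exact convex_convexHull ℝ _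

lemma BaseInv.isCompact {P : Finset Plane} {C : Set Plane} {s : State} (h : BaseInv P C s) :
    IsCompact s.inner := by
  obtain ⟨D, hD⟩ := h.hull
  rw [hD]; exact D.finite_toSet.isCompact_convexHull ℝ

lemma BaseInv.finite {P : Finset Plane} {C : Set Plane} {s : State} (h : BaseInv P C s) :
    s.unclassified.Finite := P.finite_toSet.subset h.unclassified_subset

lemma convexHull_insert_convexHull (q : Plane) (X : Set Plane) :
    convexHull ℝ (insert q (convexHull ℝ X)) = convexHull ℝ (insert q X) := by
  refine Set.Subset.antisymm (convexHull_min (Set.insert_subset ?_ ?_) (convex_convexHull ℝ _))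
    (convexHull_mono (Set.insert_subset_insert (subset_convexHull ℝ X)))
  · exact subset_convexHull ℝ _ (Set.mem_insert _ _)
  · exact convexHull_mono (Set.subset_insert _ _)

lemma State.learn_queries (s : State) (q : Plane) (a : Answer) :
    (s.learn q a).queries = s.queries + 1 := by
  cases a <;> rfl

lemma State.learn_phase (s : State) (q : Plane) (a : Answer) :
    (s.learn q a).phase = s.phase := by
  cases a <;> rfl

lemma State.inner_subset_learn (s : State) (q : Plane) (a : Answer) :
    s.inner ⊆ (s.learn q a).inner := by
  cases a
  · exact (Set.subset_insert _ _).trans (subset_convexHull ℝ _)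
  · exact subset_rfl

lemma State.learn_unclassified_subset (s : State) (q : Plane) (a : Answer) :
    (s.learn q a).unclassified ⊆ s.unclassified := by
  cases a
  · exact Set.sdiff_subset
  · exact Set.inter_subset_left

lemma IsSeparationOracle.query_classified {O : Oracle} {C : Set Plane}
    (hO : IsSeparationOracle O C) (s : State) (q : Plane) :
    q ∉ (s.learn q (O q)).unclassified := by
  cases h : O q with
  | inside => exact fun hq => hq.2 (subset_convexHull ℝ _ (Set.mem_insert _ _))
  | outside g => exact fun hq => (hO.outside h).2 hq.2

lemma BaseInv.learn {P : Finset Plane} {C : Set Plane} {s : State} (h : BaseInv P C s)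
    (hC : Convex ℝ C) {O : Oracle} (hO : IsSeparationOracle O C) (q : Plane) :
    BaseInv P C (s.learn q (O q)) := by
  classical
  cases hq : O q with
  | inside =>
    have hsub : convexHull ℝ (insert q s.inner) ⊆ C :=
      convexHull_min (Set.insert_subset (hO.inside hq) h.inner_subset) hC
    refine ⟨?_, hsub, Set.sdiff_subset.trans h.unclassified_subset, fun p hp => hp.2,
      Set.union_subset h.markedIn_subset fun p hp => ⟨h.unclassified_subset hp.1, hsub hp.2⟩,
      h.markedOut_subset, fun p hp => ?_⟩
    · obtain ⟨D, hD⟩ := h.hull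
      refine ⟨insert q D, ?_⟩
      show convexHull ℝ (insert q s.inner) = _
      rw [hD, convexHull_insert_convexHull, Finset.coe_insert]
    · by_cases hp' : p ∈ convexHull ℝ (insert q s.inner)
      · rcases h.subset_union hp with (h1 | h1) | h1
        · exact Or.inl (Or.inr (Or.inr ⟨h1, hp'⟩))
        · exact Or.inl (Or.inr (Or.inl h1))
        · exact Or.inr h1
      · rcases h.subset_union hp with (h1 | h1) | h1
        · exact Or.inl (Or.inl ⟨h1, hp'⟩)
        · exact Or.inl (Or.inr (Or.inl h1))
        · exact Or.inr h1
  | outside g =>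
    have hsub := (hO.outside hq).1
    refine ⟨h.hull, h.inner_subset, Set.inter_subset_left.trans h.unclassified_subset,
      fun p hp => h.unclassified_notMem p hp.1, h.markedIn_subset,
      Set.union_subset h.markedOut_subset fun p hp => ⟨h.unclassified_subset hp.1, fun hpC =>
        hp.2 (hsub hpC)⟩, fun p hp => ?_⟩
    by_cases hp' : p ∈ g.carrier
    · rcases h.subset_union hp with (h1 | h1) | h1
      · exact Or.inl (Or.inl ⟨h1, hp'⟩)
      · exact Or.inl (Or.inr h1)
      · exact Or.inr (Or.inl h1)
    · rcases h.subset_union hp with (h1 | h1) | h1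
      · exact Or.inr (Or.inr ⟨h1, hp'⟩)
      · exact Or.inl (Or.inr h1)
      · exact Or.inr (Or.inl h1)

/-! ### Rounds -/

/-- In a set of fewer than three points, losing the queried point alone already leaves at most two
thirds. -/
lemma IsRoundQuery.ncard_le {S T : Set Plane} {q : Plane} (hq : IsRoundQuery S q) (hfin : S.Finite)
    {h : HalfPlane} (hqh : q ∈ h.carrier) (hT : T ⊆ S \ h.carrier) :
    3 * T.ncard ≤ 2 * S.ncard := by
  rcases hq with ⟨hlt, hqS⟩ | ⟨-, hc⟩
  · have hsub : T ⊂ S := Set.ssubset_iff_subset_ne.2 ⟨hT.trans Set.sdiff_subset, fun he =>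
      (hT (he.symm ▸ hqS)).2 hqh⟩
    have := Set.ncard_lt_ncard hsub hfin
    omega
  · exact hc.ncard_le hfin hqh hT

lemma IsRoundQuery.ncard_inter_le {S : Set Plane} {q : Plane} (hq : IsRoundQuery S q)
    (hfin : S.Finite) {h : HalfPlane} (hqh : q ∉ h.carrier) :
    3 * (S ∩ h.carrier).ncard ≤ 2 * S.ncard := by
  refine hq.ncard_le (h := h.oppositeAt q) hfin (HalfPlane.mem_oppositeAt.2 le_rfl) ?_
  intro p hp
  refine ⟨hp.1, fun hp' => hqh ?_⟩
  have := HalfPlane.mem_oppositeAt.1 hp'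
  have h2 := hp.2
  simp only [HalfPlane.carrier, Set.mem_ofPred_eq] at h2 ⊢
  linarith

lemma IsRoundQuery.one_le_ncard {S : Set Plane} {q : Plane} (hq : IsRoundQuery S q)
    (hfin : S.Finite) : 1 ≤ S.ncard := by
  rcases hq with ⟨-, hqS⟩ | ⟨h, -⟩
  · exact (Set.ncard_pos hfin).2 ⟨q, hqS⟩
  · omega

/-- The half-plane of the points not beyond `q` in a direction. -/
lemma Direction.exists_halfPlane (e : Direction) (q : Plane) :
    ∃ h : HalfPlane, ∀ p, p ∈ h.carrier ↔ e.coord p ≤ e.coord q := by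
  cases e
  · exact ⟨HalfPlane.ofCoeffs 1 0 (q 0) (by simp), fun p => by
      rw [HalfPlane.mem_ofCoeffs]; simp [Direction.coord]⟩
  · exact ⟨HalfPlane.ofCoeffs (-1) 0 (-q 0) (by simp), fun p => by
      rw [HalfPlane.mem_ofCoeffs]; simp [Direction.coord]⟩

lemma State.ahead_learn_subset (s : State) (e : Direction) (q : Plane) (a : Answer) :
    (s.learn q a).ahead e ⊆ s.ahead e := fun _ hp =>
  ⟨s.learn_unclassified_subset q a hp.1, fun b hb => hp.2 b (s.inner_subset_learn q a hb)⟩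

/-- A round of a climb. -/
lemma ahead_learn_ncard_le {P : Finset Plane} {C : Set Plane} {s : State} (h : BaseInv P C s)
    {O : Oracle} (hO : IsSeparationOracle O C) {e : Direction} {q : Plane}
    (hq : IsRoundQuery (s.ahead e) q) :
    pot ((s.learn q (O q)).ahead e).ncard + 1 ≤ pot (s.ahead e).ncard := by
  have hfin : (s.ahead e).Finite := h.finite.subset (Set.sep_subset _ _)
  refine pot_succ_le ?_ (hq.one_le_ncard hfin)
  have hsub := s.ahead_learn_subset e q (O q)
  cases ha : O q with
  | inside =>
    rw [ha] at hsub
    obtain ⟨g, hg⟩ := e.exists_halfPlane q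
    refine hq.ncard_le hfin ((hg q).2 le_rfl) fun p hp => ⟨hsub hp, fun hpg => ?_⟩
    have := hp.2 q (subset_convexHull ℝ _ (Set.mem_insert _ _))
    linarith [(hg p).1 hpg]
  | outside g =>
    rw [ha] at hsub
    refine le_trans ?_ (hq.ncard_inter_le hfin (hO.outside ha).2)
    exact Nat.mul_le_mul_left 3 (Set.ncard_le_ncard (fun p hp => ⟨hsub hp, hp.1.2⟩)
      (hfin.subset Set.inter_subset_left))

/-- The inner approximation is the hull of at most as many points as there were queries. -/
def FewVertices (s : State) : Prop :=
  ∃ D : Finset Plane, s.inner = convexHull ℝ (D : Set Plane) ∧ D.card ≤ s.queries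

lemma FewVertices.learn {s : State} (h : FewVertices s) (q : Plane) (a : Answer) :
    FewVertices (s.learn q a) := by
  classical
  obtain ⟨D, hD, hc⟩ := h
  cases a with
  | inside =>
    refine ⟨insert q D, ?_, (Finset.card_insert_le _ _).trans (Nat.succ_le_succ hc)⟩
    show convexHull ℝ (insert q s.inner) = _
    rw [hD, convexHull_insert_convexHull, Finset.coe_insert]
  | outside g => exact ⟨D, hD, hc.trans (Nat.le_succ _)⟩

/-! ### The cost of the stages -/

/-- The cost of a split and of the treatment of the additional pocket. -/
def splitCost (n : ℕ) : ℕ := pot n + pot (n ^ 2) + 1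

/-- The cost of the initial lines and pockets on a side. -/
def sideCost (n : ℕ) : ℕ := 3 * pot n * (pot n + pot (n ^ 2))

/-- The cost before the first split on a side; `w` is the number of vertices of the fences. -/
def baseCost (n w : ℕ) : Side → ℕ
  | .above => 3 * pot n + sideCost n
  | .below => 3 * pot n + sideCost n + splitCost n * ((2 * w + 1) * pot n) + sideCost n

/-- The total cost. -/
def totalCost (n w : ℕ) : ℕ := baseCost n w .below + splitCost n * ((2 * w + 1) * pot n)

lemma baseCost_le (n w : ℕ) (d : Side) :
    baseCost n w d + splitCost n * ((2 * w + 1) * pot n) ≤ totalCost n w := by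
  cases d
  · simp only [totalCost, baseCost]; omega
  · exact le_rfl

/-- What has to be remembered about the other side. -/
def OtherSide (n : ℕ) : Side → Set Plane → Set Plane → Prop
  | .above, B, _ => ∃ D : Finset Plane, D.card ≤ 3 * pot n ∧ Side.below.chain B ⊆ D
  | .below, B, U => ∀ p ∈ U, ¬ Side.above.Over B p

/-- The state of the treatment of a side. -/
structure SweepState (P : Finset Plane) (C : Set Plane) (W : Finset ℝ) (d : Side)
    (B U : Set Plane) (queries : ℕ) (todo walls : Finset ℝ) (dirty : Set ℝ) (R : Finset Split)
    (extra : ℕ) : Prop where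
  todo_subset : todo ⊆ walls
  todo_card : todo.card ≤ 3 * pot P.card
  inv : SweepInv P C W d B U walls dirty R
  other : OtherSide P.card d B U
  cost : queries + totalPot d B U walls + pot (P.card ^ 2) * todo.card + extra ≤
    baseCost P.card W.card d + splitCost P.card * R.card

/-- The state of the cleaning of the line `x = t`. -/
structure LineInv (P : Finset Plane) (C : Set Plane) (d : Side) (B U I : Set Plane) (t : ℝ) :
    Prop where
  finite : I.Finite
  mem : ∀ z ∈ I, z 0 = t ∧ ∃ b ∈ B, b 0 = t ∧ d.height b ≤ d.height z
  complete : ∀ u ∈ interestPoints P d B t, (u ∈ C ∨ u ∈ U) → u ∈ I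

/-- The invariants of the single stages. -/
def PhaseInv (P : Finset Plane) (C : Set Plane) (W : Finset ℝ) (s : State) : Prop :=
  match s.phase with
  | .seek => FewVertices s ∧
      (s.inner = ∅ → s.queries + pot s.unclassified.ncard ≤ pot P.card) ∧
      (s.inner.Nonempty → s.queries ≤ pot P.card)
  | .climb .right => FewVertices s ∧ s.inner.Nonempty ∧
      s.queries + pot (s.ahead .right).ncard ≤ 2 * pot P.card
  | .climb .left => FewVertices s ∧ s.inner.Nonempty ∧ s.ahead .right = ∅ ∧
      s.queries + pot (s.ahead .left).ncard ≤ 3 * pot P.card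
  | .sweep d todo walls => ∃ (T V : Finset ℝ) (R : Finset Split), todo = T ∧ walls = V ∧
      SweepState P C W d s.inner s.unclassified s.queries T V T R 0
  | .clean d I todo walls => ∃ (T V : Finset ℝ) (R : Finset Split) (t : ℝ), todo = T ∧ walls = V ∧
      t ∈ V ∧ LineInv P C d s.inner s.unclassified I t ∧
      SweepState P C W d s.inner s.unclassified s.queries T V (insert t (T : Set ℝ)) R
        (pot I.ncard)
  | .done => s.unclassified = ∅ ∧ s.queries ≤ totalCost P.card W.card

/-- Queries on one side do not disturb the other: above, they add no vertices to the bottom chain;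
below, growth of `B` cannot bring a covered unclassified point above it. -/
lemma OtherSide.learn {n : ℕ} {d : Side} {s : State} (h : OtherSide n d s.inner s.unclassified)
    (hx : ∀ p ∈ s.unclassified, ∃ b ∈ s.inner, b 0 = p 0) {q : Plane}
    (hq : ∃ b ∈ s.inner, b 0 = q 0 ∧ d.height b ≤ d.height q) (a : Answer) :
    OtherSide n d (s.learn q a).inner (s.learn q a).unclassified := by
  cases d with
  | above =>
    obtain ⟨D, hD, hsub⟩ := h
    refine ⟨D, hD, ?_⟩
    cases a with
    | inside => exact (chain_opposite_insert_subset .above hq).trans hsub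
    | outside g => exact hsub
  | below =>
    intro p hp hov
    have hpU := s.learn_unclassified_subset q a hp
    exact h p hpU (hov.anti (s.inner_subset_learn q a) (hx p hpU))

section

variable {P : Finset Plane} {C : Set Plane} {W : Finset ℝ} {s : State} {O : Oracle}

/-- The effect of a query during the treatment of a side. -/
lemma SweepState.learn {d : Side} {T V : Finset ℝ} {dirty : Set ℝ} {R : Finset Split}
    {extra extra' : ℕ} (h : SweepState P C W d s.inner s.unclassified s.queries T V dirty R extra)
    (hbase : BaseInv P C s) {q : Plane}
    (hq : ∃ b ∈ s.inner, b 0 = q 0 ∧ d.height b ≤ d.height q) (a : Answer)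
    (hcost : totalPot d (s.learn q a).inner (s.learn q a).unclassified V + extra' + 1 ≤
      totalPot d s.inner s.unclassified V + extra) :
    SweepState P C W d (s.learn q a).inner (s.learn q a).unclassified (s.learn q a).queries T V
      dirty R extra' where
  todo_subset := h.todo_subset
  todo_card := h.todo_card
  inv := h.inv.mono (s.inner_subset_learn q a) (s.learn_unclassified_subset q a)
    hbase.unclassified_subset
  other := h.other.learn h.inv.covered hq a
  cost := by
    have := h.cost
    rw [State.learn_queries]
    omega

/-- The bound on the number of splits replaces `R.card` in the account. -/
lemma SweepState.queries_le {d : Side} {T V : Finset ℝ} {dirty : Set ℝ} {R : Finset Split}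
    {extra k : ℕ} {B U : Set Plane} (h : SweepState P C W d B U k T V dirty R extra)
    (hC : Convex ℝ C) (hCb : Bornology.IsBounded C) (hW : FenceAbscissas P C W) :
    k ≤ baseCost P.card W.card d +
      splitCost P.card * ((2 * W.card + 1) * pot P.card) := by
  have h1 := h.cost
  have h2 := Nat.mul_le_mul_left (splitCost P.card) (h.inv.card_le hC hCb hW)
  omega

/-- Start of the treatment of a side. -/
lemma phaseInv_startSide (hbase : BaseInv P C s) (hne : s.inner.Nonempty)
    (hx : ∀ p ∈ s.unclassified, ∃ b ∈ s.inner, b 0 = p 0) {d : Side} {D : Finset Plane}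
    (hD : D.card ≤ 3 * pot P.card) (hchain : d.chain s.inner ⊆ D)
    (hother : OtherSide P.card d s.inner s.unclassified)
    (hcost : s.queries + sideCost P.card ≤ baseCost P.card W.card d) :
    PhaseInv P C W (s.startSide d) := by
  classical
  have hfin : (d.chain s.inner).Finite := D.finite_toSet.subset hchain
  let V : Finset ℝ := hfin.toFinset.image fun v : Plane => v 0
  have hV : (fun v : Plane => v 0) '' d.chain s.inner = (V : Set ℝ) := by
    simp [V]
  have hVc : V.card ≤ 3 * pot P.card := by
    refine Finset.card_image_le.trans (le_trans ?_ hD)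
    exact Finset.card_le_card (by simpa using hchain)
  have hmemV : ∀ v ∈ d.chain s.inner, v 0 ∈ V := fun v hv => by
    rw [← Finset.mem_coe, ← hV]; exact ⟨v, hv, rfl⟩
  refine ⟨V, V, ∅, hV, hV, subset_rfl, hVc, ⟨hx, ?_, ?_, ?_, ?_, ?_, ?_, ?_, ?_, ?_⟩, hother, ?_⟩
  · intro t ht
    rw [← Finset.mem_coe, ← hV] at ht
    obtain ⟨v, hv, rfl⟩ := ht
    exact ⟨v, hv.1.1, rfl⟩
  · intro p hp
    obtain ⟨b, hb, hb0⟩ := hx p hp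
    obtain ⟨v, hv, hle⟩ := exists_mem_chain d .left hbase.isCompact hne
    have := hle b hb
    simp only [Direction.coord] at this
    exact ⟨v 0, hmemV v hv, by linarith⟩
  · intro p hp
    obtain ⟨b, hb, hb0⟩ := hx p hp
    obtain ⟨v, hv, hle⟩ := exists_mem_chain d .right hbase.isCompact hne
    have := hle b hb
    simp only [Direction.coord] at this
    exact ⟨v 0, hmemV v hv, by linarith⟩
  · exact fun t ht htd => absurd ht htd
  all_goals try simp
  -- The initial deposit `sideCost`: each of the at most `3 * pot n` walls gets `pot n` for the
  -- pocket to its right and `pot (n ^ 2)` for its cleaning.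
  have h1 := totalPot_le (d := d) (B := s.inner) (walls := V) hbase.unclassified_subset
  have h2 := Nat.mul_le_mul_right (pot P.card) hVc
  have h3 := Nat.mul_le_mul_left (pot (P.card ^ 2)) hVc
  have h4 : sideCost P.card = 3 * pot P.card * pot P.card + pot (P.card ^ 2) * (3 * pot P.card) := by
    rw [sideCost]; ring
  show s.queries + _ + _ ≤ _
  have h5 : totalPot d (s.startSide d).inner (s.startSide d).unclassified V =
    totalPot d s.inner s.unclassified V := rfl
  omega

end

/-! ### Preservation of the invariants -/

section

variable {P : Finset Plane} {C : Set Plane} {W : Finset ℝ} {s : State} {O : Oracle}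

lemma phaseInv_initial : PhaseInv P C W (State.initial P) := by
  refine ⟨⟨∅, by simp [State.initial], Nat.zero_le _⟩, fun _ => ?_, fun _ => Nat.zero_le _⟩
  simp [State.initial]

lemma baseInv_initial : BaseInv P C (State.initial P) := by
  refine ⟨⟨∅, by simp [State.initial]⟩, ?_, ?_, ?_, ?_, ?_, ?_⟩ <;> simp [State.initial]

lemma phaseInv_seekRound (hbase : BaseInv P C s) (hO : IsSeparationOracle O C)
    (h : PhaseInv P C W s) (hs : s.phase = .seek) (hin : s.inner = ∅) {q : Plane}
    (hq : IsRoundQuery s.unclassified q) : PhaseInv P C W (s.learn q (O q)) := by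
  rw [PhaseInv, hs] at h
  rw [PhaseInv, State.learn_phase, hs]
  obtain ⟨hfew, h1, -⟩ := h
  have h1 := h1 hin
  -- The unclassified set is nonempty before the query, so its potential pays for a positive answer.
  have hpos := pot_pos (hq.one_le_ncard hbase.finite)
  refine ⟨hfew.learn _ _, fun hemp => ?_, fun _ => by rw [State.learn_queries]; omega⟩
  cases ha : O q with
  | inside =>
    rw [ha] at hemp
    have : q ∈ (∅ : Set Plane) := hemp ▸ subset_convexHull ℝ _ (Set.mem_insert q s.inner)
    exact absurd this (Set.notMem_empty q)
  | outside g =>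
    have h2 := pot_succ_le (hq.ncard_inter_le hbase.finite (hO.outside ha).2)
      (hq.one_le_ncard hbase.finite)
    show s.queries + 1 + pot (s.unclassified ∩ g.carrier).ncard ≤ _
    omega

lemma phaseInv_climbRound (hbase : BaseInv P C s) (hO : IsSeparationOracle O C)
    (h : PhaseInv P C W s) {e : Direction} (hs : s.phase = .climb e) {q : Plane}
    (hq : IsRoundQuery (s.ahead e) q) : PhaseInv P C W (s.learn q (O q)) := by
  rw [PhaseInv, hs] at h
  rw [PhaseInv, State.learn_phase, hs]
  have hlt := ahead_learn_ncard_le hbase hO hq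
  cases e with
  | right =>
    obtain ⟨hfew, hne, hc⟩ := h
    refine ⟨hfew.learn _ _, hne.mono (s.inner_subset_learn q _), ?_⟩
    rw [State.learn_queries]; omega
  | left =>
    obtain ⟨hfew, hne, hahead, hc⟩ := h
    refine ⟨hfew.learn _ _, hne.mono (s.inner_subset_learn q _), ?_, ?_⟩
    · exact Set.subset_empty_iff.1 (hahead ▸ s.ahead_learn_subset .right q _)
    · rw [State.learn_queries]; omega

lemma phaseInv_seekSuccess (hbase : BaseInv P C s) (h : PhaseInv P C W s) (hs : s.phase = .seek)
    (hne : s.inner.Nonempty) : PhaseInv P C W { s with phase := .climb .right } := by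
  rw [PhaseInv, hs] at h
  obtain ⟨hfew, -, hc⟩ := h
  have h1 := hc hne
  have h2 : pot (s.ahead .right).ncard ≤ pot P.card := pot_mono (by
    rw [← Set.ncard_coe_finset]
    exact Set.ncard_le_ncard (fun p hp => hbase.unclassified_subset hp.1) P.finite_toSet)
  refine ⟨hfew, hne, ?_⟩
  show s.queries + pot (s.ahead .right).ncard ≤ _
  omega

lemma phaseInv_climbRightEnd (hbase : BaseInv P C s) (h : PhaseInv P C W s)
    (hs : s.phase = .climb .right) (hahead : s.ahead .right = ∅) :
    PhaseInv P C W { s with phase := .climb .left } := by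
  rw [PhaseInv, hs] at h
  obtain ⟨hfew, hne, hc⟩ := h
  have h2 : pot (s.ahead .left).ncard ≤ pot P.card := pot_mono (by
    rw [← Set.ncard_coe_finset]
    exact Set.ncard_le_ncard (fun p hp => hbase.unclassified_subset hp.1) P.finite_toSet)
  refine ⟨hfew, hne, hahead, ?_⟩
  show s.queries + pot (s.ahead .left).ncard ≤ _
  omega

lemma covered_of_ahead_empty (hbase : BaseInv P C s) (h1 : s.ahead .right = ∅)
    (h2 : s.ahead .left = ∅) : ∀ p ∈ s.unclassified, ∃ b ∈ s.inner, b 0 = p 0 := by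
  intro p hp
  have e1 : p ∉ s.ahead .right := by rw [h1]; simp
  have e2 : p ∉ s.ahead .left := by rw [h2]; simp
  obtain ⟨v, hv, hvp⟩ : ∃ v ∈ s.inner, p 0 ≤ v 0 := by
    by_contra hno
    push Not at hno
    exact e1 ⟨hp, hno⟩
  obtain ⟨u, hu, hup⟩ : ∃ u ∈ s.inner, u 0 ≤ p 0 := by
    by_contra hno
    push Not at hno
    exact e2 ⟨hp, fun b hb => neg_lt_neg (hno b hb)⟩
  exact hbase.convex.exists_mem_abscissa hu hv hup hvp

lemma phaseInv_climbLeftEnd (hbase : BaseInv P C s) (h : PhaseInv P C W s)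
    (hs : s.phase = .climb .left) (hahead : s.ahead .left = ∅) :
    PhaseInv P C W (s.startSide .above) := by
  rw [PhaseInv, hs] at h
  obtain ⟨⟨D, hD, hDc⟩, hne, hahead', hc⟩ := h
  have hsub : ∀ d : Side, d.chain s.inner ⊆ D := fun d v hv => by
    have := hv.1
    rw [hD] at this
    exact extremePoints_convexHull_subset this
  refine phaseInv_startSide hbase hne (covered_of_ahead_empty hbase hahead' hahead)
    (D := D) (by omega) (hsub _) ⟨D, by omega, hsub _⟩ ?_
  simp only [baseCost]; omega

lemma phaseInv_cleanStart (h : PhaseInv P C W s) {d : Side} {todo walls : Set ℝ} {t : ℝ}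
    (hs : s.phase = .sweep d todo walls) (ht : t ∈ todo) :
    PhaseInv P C W
      { s with phase := .clean d (interestPoints P d s.inner t) (todo \ {t}) walls } := by
  classical
  rw [PhaseInv, hs] at h
  obtain ⟨T, V, R, rfl, rfl, h⟩ := h
  have htT : t ∈ T := ht
  have hfin := interestPoints_finite P d s.inner t
  have hpot := pot_mono hfin.2
  refine ⟨T.erase t, V, R, t, (Finset.coe_erase t T).symm, rfl, h.todo_subset htT,
    ⟨hfin.1, fun z hz => ?_, fun u hu _ => hu⟩,
    ⟨(Finset.erase_subset _ _).trans h.todo_subset, (Finset.card_erase_le).trans h.todo_card, ?_,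
      h.other, ?_⟩⟩
  · obtain ⟨b, hb, hb0⟩ := hz.1.1
    have hz0 := interestPoints_zero hz
    exact ⟨hz0, b, hb, hb0.trans hz0, (hz.1.2 b hb hb0).le⟩
  -- The line `t` leaves the list at the start of its cleaning but counts as dirty until the end.
  · have : insert t ((T.erase t : Finset ℝ) : Set ℝ) = T := by
      rw [← Finset.coe_insert, Finset.insert_erase htT]
    rw [this]
    exact h.inv
  · have hcost := h.cost
    have hcard := Finset.card_erase_add_one htT
    have : pot (P.card ^ 2) * T.card = pot (P.card ^ 2) * (T.erase t).card + pot (P.card ^ 2) := by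
      rw [← hcard]; ring
    show s.queries + totalPot d s.inner s.unclassified V + _ + _ ≤ _
    omega

lemma phaseInv_cleanEnd (h : PhaseInv P C W s) {d : Side} {todo walls : Set ℝ}
    (hs : s.phase = .clean d ∅ todo walls) :
    PhaseInv P C W { s with phase := .sweep d todo walls } := by
  rw [PhaseInv, hs] at h
  obtain ⟨T, V, R, t, rfl, rfl, ht, hline, h⟩ := h
  refine ⟨T, V, R, rfl, rfl, h.todo_subset, h.todo_card, ?_, h.other, ?_⟩
  · have hi := h.inv
    refine ⟨hi.covered, hi.walls_over, hi.lower, hi.upper, fun x hx hxT => ?_, hi.split_walls,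
      hi.split_size, hi.active, hi.separated, hi.shrinks⟩
    by_cases hxt : x = t
    · subst hxt
      intro u hu
      exact ⟨fun hC => hline.complete u hu (Or.inl hC), fun hU => hline.complete u hu (Or.inr hU)⟩
    · exact hi.clean x hx (by simp [hxt, hxT])
  · have := h.cost
    show s.queries + totalPot d s.inner s.unclassified V + _ + _ ≤ _
    omega

lemma Answer.remaining_subset (I B : Set Plane) (a : Answer) : a.remaining I B ⊆ I := by
  cases a
  · exact Set.sdiff_subset
  · exact Set.inter_subset_left

/-- A query at a median halves the points of interest. -/
lemma LineInv.ncard_remaining_le {d : Side} {I : Set Plane} {t : ℝ} (hbase : BaseInv P C s)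
    (hO : IsSeparationOracle O C) (h : LineInv P C d s.inner s.unclassified I t) {u : Plane}
    (hu : IsMedian d I u) :
    2 * ((O u).remaining I (s.learn u (O u)).inner).ncard ≤ I.ncard := by
  obtain ⟨huI, hlo, hhi⟩ := hu
  obtain ⟨hut, -⟩ := h.mem u huI
  cases ha : O u with
  | inside =>
    -- After a positive answer the new `B` covers every point of interest not higher than `u`.
    refine le_trans (Nat.mul_le_mul_left 2 (Set.ncard_le_ncard ?_
      (h.finite.subset (Set.sep_subset _ _)))) hhi
    intro z hz
    refine ⟨hz.1, not_le.1 fun hle => hz.2 ?_⟩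
    obtain ⟨hzt, b, hb, hbt, hbz⟩ := h.mem z hz.1
    exact (convex_convexHull ℝ (insert u s.inner)).mem_of_height_between d
      (subset_convexHull ℝ _ (Set.mem_insert_of_mem _ hb))
      (subset_convexHull ℝ _ (Set.mem_insert _ _)) (hbt.trans hzt.symm) (hut.trans hzt.symm) hbz hle
  | outside g =>
    -- The half-plane contains `B`, which reaches a point at or below `u`; if it also kept a point
    -- at or above `u`, it would contain `u`.
    refine le_trans (Nat.mul_le_mul_left 2 (Set.ncard_le_ncard ?_
      (h.finite.subset (Set.sep_subset _ _)))) hlo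
    intro z hz
    refine ⟨hz.1, not_le.1 fun hle => (hO.outside ha).2 ?_⟩
    obtain ⟨hzt, -⟩ := h.mem z hz.1
    obtain ⟨-, b, hb, hbt, hbu⟩ := h.mem u huI
    exact g.convex.mem_of_height_between d ((hO.outside ha).1 (hbase.inner_subset hb)) hz.2
      (hbt.trans hut.symm) (hzt.trans hut.symm) hbu hle

lemma phaseInv_cleanQuery (hbase : BaseInv P C s) (hO : IsSeparationOracle O C)
    (h : PhaseInv P C W s) {d : Side} {I : Set Plane} {todo walls : Set ℝ} {u : Plane}
    (hs : s.phase = .clean d I todo walls) (hu : IsMedian d I u) :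
    PhaseInv P C W { s.learn u (O u) with
      phase := .clean d ((O u).remaining I (s.learn u (O u)).inner) todo walls } := by
  rw [PhaseInv, hs] at h
  obtain ⟨T, V, R, t, rfl, rfl, ht, hline, h⟩ := h
  obtain ⟨hut, b, hb, hbt, hbu⟩ := hline.mem u hu.1
  have hpos : 1 ≤ I.ncard := (Set.ncard_pos hline.finite).2 ⟨u, hu.1⟩
  have hhalf := hline.ncard_remaining_le hbase hO hu
  have hpot : pot ((O u).remaining I (s.learn u (O u)).inner).ncard + 1 ≤ pot I.ncard :=
    pot_succ_le (by omega) hpos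
  have hBB := s.inner_subset_learn u (O u)
  refine ⟨T, V, R, t, rfl, rfl, ht,
    ⟨hline.finite.subset (Answer.remaining_subset _ _ _), fun z hz => ?_, fun z hz hzC => ?_⟩,
    h.learn hbase ⟨b, hb, hbt.trans hut.symm, hbu⟩ (O u) ?_⟩
  · obtain ⟨hz0, c, hc, hct, hcz⟩ := hline.mem z (Answer.remaining_subset _ _ _ hz)
    exact ⟨hz0, c, hBB hc, hct, hcz⟩
  · have hzI : z ∈ I := hline.complete z (interestPoints_anti hBB ⟨b, hb, hbt⟩ hz)
      (hzC.imp_right fun hU => s.learn_unclassified_subset u (O u) hU)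
    have hover : z ∉ (s.learn u (O u)).inner := hz.1.notMem
    cases ha : O u with
    | inside => rw [ha] at hover; exact ⟨hzI, hover⟩
    | outside g =>
      refine ⟨hzI, ?_⟩
      rcases hzC with hzC | hzU
      · exact (hO.outside ha).1 hzC
      · rw [ha] at hzU; exact hzU.2
  · have := totalPot_mono (d := d) (walls := V) hbase.unclassified_subset h.inv.covered hBB
      (s.learn_unclassified_subset u (O u))
    omega

/-- Common to the pocket queries without a split: the query pays for itself if the pocket shrinks to
two thirds. -/
lemma phaseInv_pocket (hbase : BaseInv P C s) (h : PhaseInv P C W s) {d : Side} {walls : Set ℝ}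
    (hs : s.phase = .sweep d ∅ walls) {a b : ℝ} (hab : Consecutive walls a b) {q : Plane}
    (hne : (s.pocket d a b).Nonempty)
    (hq : (∃ z ∈ s.inner, z 0 = a) → (∃ z ∈ s.inner, z 0 = b) →
      ∃ z ∈ s.inner, z 0 = q 0 ∧ d.height z ≤ d.height q)
    (hlt : 3 * ((s.learn q (O q)).pocket d a b).ncard ≤ 2 * (s.pocket d a b).ncard) :
    PhaseInv P C W (s.learn q (O q)) := by
  rw [PhaseInv, hs] at h
  rw [PhaseInv, State.learn_phase, hs]
  obtain ⟨T, V, R, hT, rfl, h⟩ := h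
  have hfin : (s.pocket d a b).Finite := hbase.finite.subset (Set.sep_subset _ _)
  refine ⟨T, V, R, hT, rfl, h.learn hbase (hq (h.inv.walls_over a hab.1)
    (h.inv.walls_over b hab.2.1)) (O q) ?_⟩
  have := totalPot_succ_le (d := d) (walls := V) hbase.unclassified_subset h.inv.covered
    (s.inner_subset_learn q (O q)) (s.learn_unclassified_subset q (O q)) hab.1
    (by rw [cell_eq_pocketPoints hab]; exact (Set.ncard_pos hfin).2 hne)
    (by rw [cell_eq_pocketPoints hab, cell_eq_pocketPoints hab]; exact hlt)
  omega

lemma pocket_learn_subset (hx : ∀ p ∈ s.unclassified, ∃ b ∈ s.inner, b 0 = p 0) (d : Side)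
    (a b : ℝ) (q : Plane) (w : Answer) : (s.learn q w).pocket d a b ⊆ s.pocket d a b := fun p hp =>
  ⟨s.learn_unclassified_subset q w hp.1, hp.2.1, hp.2.2.1,
    hp.2.2.2.anti (s.inner_subset_learn q w) (hx p (s.learn_unclassified_subset q w hp.1))⟩

lemma PhaseInv.covered (h : PhaseInv P C W s) {d : Side} {todo walls : Set ℝ}
    (hs : s.phase = .sweep d todo walls) : ∀ p ∈ s.unclassified, ∃ b ∈ s.inner, b 0 = p 0 := by
  rw [PhaseInv, hs] at h
  obtain ⟨T, V, R, -, -, h⟩ := h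
  exact h.inv.covered

lemma phaseInv_pocketSmall (hbase : BaseInv P C s) (hO : IsSeparationOracle O C)
    (h : PhaseInv P C W s) {d : Side} {walls : Set ℝ} (hs : s.phase = .sweep d ∅ walls) {a b : ℝ}
    (hab : Consecutive walls a b) {q : Plane} (hlt : (s.pocket d a b).ncard < 3)
    (hq : q ∈ s.pocket d a b) : PhaseInv P C W (s.learn q (O q)) := by
  have hx := h.covered hs
  have hfin : (s.pocket d a b).Finite := hbase.finite.subset (Set.sep_subset _ _)
  refine phaseInv_pocket hbase h hs hab ⟨q, hq⟩ (fun _ _ => ?_) ?_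
  · obtain ⟨z, hz, hz0⟩ := hq.2.2.2.1
    exact ⟨z, hz, hz0, (hq.2.2.2.2 z hz hz0).le⟩
  · have hss : (s.learn q (O q)).pocket d a b ⊂ s.pocket d a b :=
      Set.ssubset_iff_subset_ne.2 ⟨pocket_learn_subset hx d a b q (O q), fun he => by
        have : q ∈ (s.learn q (O q)).pocket d a b := he.symm ▸ hq
        exact hO.query_classified s q this.1⟩
    have := Set.ncard_lt_ncard hss hfin
    omega

lemma phaseInv_pocketOutside (hbase : BaseInv P C s) (hO : IsSeparationOracle O C)
    (h : PhaseInv P C W s) {d : Side} {walls : Set ℝ} (hs : s.phase = .sweep d ∅ walls) {a b : ℝ}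
    (hab : Consecutive walls a b) {q : Plane} {g : HalfPlane} (hle : 3 ≤ (s.pocket d a b).ncard)
    (hq : IsCenterpoint (s.pocket d a b) q) (hqO : O q = .outside g) :
    PhaseInv P C W (s.learn q (O q)) := by
  have hx := h.covered hs
  have hfin : (s.pocket d a b).Finite := hbase.finite.subset (Set.sep_subset _ _)
  have hne : (s.pocket d a b).Nonempty := (Set.ncard_pos hfin).1 (by omega)
  refine phaseInv_pocket hbase h hs hab hne (fun ha hb =>
    (pocket_centerpoint hbase.convex hbase.unclassified_subset ha hb hne hq).2.2) ?_
  have hsub := pocket_learn_subset hx d a b q (O q)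
  refine le_trans (Nat.mul_le_mul_left 3 (Set.ncard_le_ncard (fun p hp => ?_)
    (hfin.subset Set.inter_subset_left))) (hq.ncard_inter_le hfin (hO.outside hqO).2)
  refine ⟨hsub hp, ?_⟩
  rw [hqO] at hp
  exact hp.1.2

lemma phaseInv_pocketSplit (hbase : BaseInv P C s) (hO : IsSeparationOracle O C) (hC : Convex ℝ C)
    (hW : FenceAbscissas P C W) (h : PhaseInv P C W s) {d : Side} {walls : Set ℝ}
    (hs : s.phase = .sweep d ∅ walls) {a b : ℝ} (hab : Consecutive walls a b) {q : Plane}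
    (hle : 3 ≤ (s.pocket d a b).ncard) (hq : IsCenterpoint (s.pocket d a b) q)
    (hqO : O q = .inside) :
    PhaseInv P C W { s.learn q (O q) with
      phase := .clean d (interestPoints P d (s.learn q (O q)).inner (q 0)) ∅
        (insert (q 0) walls) } := by
  classical
  rw [PhaseInv, hs] at h
  obtain ⟨T, V, R, hT, rfl, h⟩ := h
  obtain rfl : T = ∅ := by simpa using hT.symm
  have hfin : (s.pocket d a b).Finite := hbase.finite.subset (Set.sep_subset _ _)
  have hne : (s.pocket d a b).Nonempty := (Set.ncard_pos hfin).1 (by omega)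
  have hqB : q ∈ (s.learn q (O q)).inner := by
    rw [hqO]; exact subset_convexHull ℝ _ (Set.mem_insert _ _)
  have hBB := s.inner_subset_learn q (O q)
  have hUU := s.learn_unclassified_subset q (O q)
  have hinv : SweepInv P C W d s.inner s.unclassified V ∅ R := by simpa using h.inv
  obtain ⟨hsplit, hnew⟩ := hinv.split hC hW hbase.convex hbase.inner_subset
    hbase.unclassified_subset hab hne hq (hO.inside hqO) hBB hqB hUU
  have hover := (pocket_centerpoint hbase.convex hbase.unclassified_subset
    (hinv.walls_over a hab.1) (hinv.walls_over b hab.2.1) hne hq).2.2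
  have hI := interestPoints_finite P d (s.learn q (O q)).inner (q 0)
  refine ⟨∅, insert (q 0) V, _, q 0, by simp, by simp, Finset.mem_insert_self _ _,
    ⟨hI.1, fun z hz => ?_, fun u hu _ => hu⟩,
    ⟨Finset.empty_subset _, by simp, by simpa using hsplit, h.other.learn h.inv.covered hover _, ?_⟩⟩
  · obtain ⟨c, hc, hc0⟩ := hz.1.1
    have hz0 := interestPoints_zero hz
    exact ⟨hz0, c, hc, hc0.trans hz0, (hz.1.2 c hc hc0).le⟩
  · have hcost := h.cost
    have h1 := totalPot_insert_le (d := d) (walls := V) hbase.unclassified_subset h.inv.covered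
      hBB hUU (q 0)
    have h2 := pot_mono hI.2
    -- Because the split is new, the budget grows by `splitCost`: one query, `pot n` for the
    -- additional cell, `pot (n ^ 2)` for the new line.
    rw [Finset.card_insert_of_notMem hnew, State.learn_queries, mul_add, mul_one]
    simp only [Finset.card_empty, mul_zero] at hcost ⊢
    show s.queries + 1 + totalPot d (s.learn q (O q)).inner (s.learn q (O q)).unclassified
      (insert (q 0) V) + 0 + _ ≤ _
    simp only [splitCost] at hcost ⊢
    omega

/-- When the pockets of a side are empty, no unclassified point is left over the inner
approximation. -/
lemma SweepInv.not_over {d : Side} {B U : Set Plane} {V : Finset ℝ} {R : Finset Split}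
    (h : SweepInv P C W d B U V ∅ R) (hUP : U ⊆ P)
    (hempty : ∀ a b, Consecutive (V : Set ℝ) a b → pocketPoints d B U a b = ∅) :
    ∀ p ∈ U, ¬ d.Over B p := by
  intro p hp hov
  by_cases hpV : p 0 ∈ V
  · exact (h.clean _ hpV (Set.notMem_empty _) p (mem_interestPoints_self (hUP hp) hov)).2 hp
  · obtain ⟨l, hl, hlp⟩ := h.lower p hp
    obtain ⟨r, hr, hpr⟩ := h.upper p hp
    obtain ⟨a, ha, hamax⟩ := (V.filter fun t => t ≤ p 0).exists_max_image id
      ⟨l, Finset.mem_filter.2 ⟨hl, hlp⟩⟩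
    obtain ⟨b, hb, hbmin⟩ := (V.filter fun t => p 0 ≤ t).exists_min_image id
      ⟨r, Finset.mem_filter.2 ⟨hr, hpr⟩⟩
    rw [Finset.mem_filter] at ha hb
    have hap : a < p 0 := lt_of_le_of_ne ha.2 fun h => hpV (h ▸ ha.1)
    have hpb : p 0 < b := lt_of_le_of_ne hb.2 fun h => hpV (h ▸ hb.1)
    have hcons : Consecutive (V : Set ℝ) a b := by
      refine ⟨ha.1, hb.1, hap.trans hpb, fun t ht => ?_⟩
      rcases le_total t (p 0) with h | h
      · exact Or.inl (hamax t (Finset.mem_filter.2 ⟨ht, h⟩))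
      · exact Or.inr (hbmin t (Finset.mem_filter.2 ⟨ht, h⟩))
    have : p ∈ pocketPoints d B U a b := ⟨hp, hap, hpb, hov⟩
    rw [hempty a b hcons] at this
    exact this

lemma phaseInv_aboveEnd (hbase : BaseInv P C s) (hC : Convex ℝ C) (hCb : Bornology.IsBounded C)
    (hW : FenceAbscissas P C W) (h : PhaseInv P C W s) {walls : Set ℝ}
    (hs : s.phase = .sweep .above ∅ walls)
    (hempty : ∀ a b, Consecutive walls a b → s.pocket .above a b = ∅) :
    PhaseInv P C W (s.startSide .below) := by
  rw [PhaseInv, hs] at h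
  obtain ⟨T, V, R, hT, rfl, h⟩ := h
  obtain rfl : T = ∅ := by simpa using hT.symm
  have hinv : SweepInv P C W .above s.inner s.unclassified V ∅ R := by simpa using h.inv
  obtain ⟨D, hD, hchain⟩ := h.other
  have hnot := hinv.not_over hbase.unclassified_subset hempty
  -- `SweepState` does not record that `B` is nonempty; if it were empty, nothing would be
  -- unclassified and there would be no walls.
  rcases s.inner.eq_empty_or_nonempty with hemp | hne
  · have hU : s.unclassified = ∅ := Set.eq_empty_iff_forall_notMem.2 fun p hp => by
      obtain ⟨b, hb, -⟩ := hinv.covered p hp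
      rw [hemp] at hb; exact hb
    have hch : Side.below.chain s.inner = ∅ := Set.eq_empty_iff_forall_notMem.2 fun v hv => by
      have := hv.1.1
      rw [hemp] at this; exact this
    have hq := h.queries_le hC hCb hW
    refine ⟨∅, ∅, ∅, by simp [hch], by simp [hch], subset_rfl, by simp,
      ⟨?_, ?_, ?_, ?_, ?_, ?_, ?_, ?_, ?_, ?_⟩, hnot, ?_⟩
    all_goals try simp [State.startSide, hU]
    simp only [totalPot, Finset.sum_empty, baseCost] at hq ⊢
    omega
  · refine phaseInv_startSide hbase hne hinv.covered hD hchain hnot ?_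
    have hq := h.queries_le hC hCb hW
    simp only [baseCost] at hq ⊢
    omega

/-- A remaining point would have a covered abscissa and be neither above nor below `B`, hence lie in
`B`, where no point is unclassified. -/
lemma phaseInv_belowEnd (hbase : BaseInv P C s) (hC : Convex ℝ C) (hCb : Bornology.IsBounded C)
    (hW : FenceAbscissas P C W) (h : PhaseInv P C W s) {walls : Set ℝ}
    (hs : s.phase = .sweep .below ∅ walls)
    (hempty : ∀ a b, Consecutive walls a b → s.pocket .below a b = ∅) :
    PhaseInv P C W { s with phase := .done } := by
  rw [PhaseInv, hs] at h
  obtain ⟨T, V, R, hT, rfl, h⟩ := h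
  obtain rfl : T = ∅ := by simpa using hT.symm
  have hinv : SweepInv P C W .below s.inner s.unclassified V ∅ R := by simpa using h.inv
  have hnot := hinv.not_over hbase.unclassified_subset hempty
  refine ⟨Set.eq_empty_iff_forall_notMem.2 fun p hp => ?_, h.queries_le hC hCb hW⟩
  have hx := hinv.covered p hp
  have ha : ¬ Side.above.Over s.inner p := h.other p hp
  have hb := hnot p hp
  simp only [Side.Over, not_and, not_forall, not_lt] at ha hb
  obtain ⟨u, hu, hu0, hup⟩ := ha hx
  obtain ⟨v, hv, hv0, hvp⟩ := hb hx
  refine hbase.unclassified_notMem p hp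
    (hbase.convex.mem_of_height_between .above hv hu hv0 hu0 ?_ hup)
  simpa [Side.height] using hvp

end

/-- The invariants hold in every reachable state. -/
lemma Reachable.invariants {P : Finset Plane} {C : Set Plane} {W : Finset ℝ} {O : Oracle}
    (hO : IsSeparationOracle O C) (hC : Convex ℝ C) (hCb : Bornology.IsBounded C)
    (hW : FenceAbscissas P C W) {s : State} (h : Reachable P O s) :
    BaseInv P C s ∧ PhaseInv P C W s := by
  induction h with
  | refl => exact ⟨baseInv_initial, phaseInv_initial⟩
  | tail _ hstep ih =>
    obtain ⟨hbase, hph⟩ := ih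
    cases hstep with
    | seekRound q hs hin hq =>
      exact ⟨hbase.learn hC hO q, phaseInv_seekRound hbase hO hph hs hin hq⟩
    | seekFail hs hin hU =>
      refine ⟨hbase.setPhase _, hU, ?_⟩
      rw [PhaseInv, hs] at hph
      have h1 := hph.2.1 hin
      have h2 := baseCost_le P.card W.card .above
      simp only [baseCost] at h2
      dsimp only
      omega
    | seekSuccess hs hne => exact ⟨hbase.setPhase _, phaseInv_seekSuccess hbase hph hs hne⟩
    | climbRound e q hs hq => exact ⟨hbase.learn hC hO q, phaseInv_climbRound hbase hO hph hs hq⟩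
    | climbRightEnd hs ha => exact ⟨hbase.setPhase _, phaseInv_climbRightEnd hbase hph hs ha⟩
    | climbLeftEnd hs ha => exact ⟨hbase.setPhase _, phaseInv_climbLeftEnd hbase hph hs ha⟩
    | cleanStart d todo walls t hs ht => exact ⟨hbase.setPhase _, phaseInv_cleanStart hph hs ht⟩
    | cleanQuery d I todo walls u hs hu =>
      exact ⟨(hbase.learn hC hO u).setPhase _, phaseInv_cleanQuery hbase hO hph hs hu⟩
    | cleanEnd d todo walls hs => exact ⟨hbase.setPhase _, phaseInv_cleanEnd hph hs⟩
    | pocketSmall d walls a b q hs hab hlt hq =>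
      exact ⟨hbase.learn hC hO q, phaseInv_pocketSmall hbase hO hph hs hab hlt hq⟩
    | pocketOutside d walls a b q g hs hab hle hq hqO =>
      exact ⟨hbase.learn hC hO q, phaseInv_pocketOutside hbase hO hph hs hab hle hq hqO⟩
    | pocketSplit d walls a b q hs hab hle hq hqO =>
      exact ⟨(hbase.learn hC hO q).setPhase _,
        phaseInv_pocketSplit hbase hO hC hW hph hs hab hle hq hqO⟩
    | aboveEnd walls hs hempty =>
      exact ⟨hbase.setPhase _, phaseInv_aboveEnd hbase hC hCb hW hph hs hempty⟩
    | belowEnd walls hs hempty =>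
      exact ⟨hbase.setPhase _, phaseInv_belowEnd hbase hC hCb hW hph hs hempty⟩

/-! ### Termination -/

lemma PhaseInv.queries_le {P : Finset Plane} {C : Set Plane} {W : Finset ℝ} {s : State}
    (h : PhaseInv P C W s) (hC : Convex ℝ C) (hCb : Bornology.IsBounded C)
    (hW : FenceAbscissas P C W) :
    s.queries ≤ totalCost P.card W.card := by
  have h0 := baseCost_le P.card W.card .above
  simp only [baseCost] at h0
  unfold PhaseInv at h
  split at h
  · obtain ⟨-, h1, h2⟩ := h
    rcases s.inner.eq_empty_or_nonempty with he | he
    · have := h1 he; omega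
    · have := h2 he; omega
  · have := h.2.2; omega
  · have := h.2.2.2; omega
  · obtain ⟨T, V, R, -, -, h⟩ := h
    exact (h.queries_le hC hCb hW).trans (baseCost_le _ _ _)
  · obtain ⟨T, V, R, t, -, -, -, -, h⟩ := h
    exact (h.queries_le hC hCb hW).trans (baseCost_le _ _ _)
  · exact h.2

/-- A bound for the number of consecutive transitions without a query. -/
noncomputable def Phase.rank (n : ℕ) : Phase → ℕ
  | .seek => 12 * pot n + 8
  | .climb .right => 12 * pot n + 7
  | .climb .left => 12 * pot n + 6
  | .sweep .above todo _ => 6 * pot n + 4 + 2 * todo.ncard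
  | .clean .above _ todo _ => 6 * pot n + 5 + 2 * todo.ncard
  | .sweep .below todo _ => 1 + 2 * todo.ncard
  | .clean .below _ todo _ => 2 + 2 * todo.ncard
  | .done => 0

lemma PhaseInv.todo_sweep {P : Finset Plane} {C : Set Plane} {W : Finset ℝ} {s : State}
    (h : PhaseInv P C W s) {d : Side} {todo walls : Set ℝ} (hs : s.phase = .sweep d todo walls) :
    todo.Finite ∧ todo.ncard ≤ 3 * pot P.card := by
  rw [PhaseInv, hs] at h
  obtain ⟨T, V, R, rfl, -, h⟩ := h
  exact ⟨T.finite_toSet, by rw [Set.ncard_coe_finset]; exact h.todo_card⟩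

lemma PhaseInv.todo_clean {P : Finset Plane} {C : Set Plane} {W : Finset ℝ} {s : State}
    (h : PhaseInv P C W s) {d : Side} {I : Set Plane} {todo walls : Set ℝ}
    (hs : s.phase = .clean d I todo walls) :
    todo.Finite ∧ todo.ncard ≤ 3 * pot P.card := by
  rw [PhaseInv, hs] at h
  obtain ⟨T, V, R, t, rfl, -, -, -, h⟩ := h
  exact ⟨T.finite_toSet, by rw [Set.ncard_coe_finset]; exact h.todo_card⟩

lemma PhaseInv.rank_le {P : Finset Plane} {C : Set Plane} {W : Finset ℝ} {s : State}
    (h : PhaseInv P C W s) : s.phase.rank P.card ≤ 12 * pot P.card + 8 := by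
  cases hs : s.phase with
  | seek => exact le_rfl
  | climb e => cases e <;> simp only [Phase.rank] <;> omega
  | sweep d todo walls =>
    have := (h.todo_sweep hs).2
    cases d <;> simp only [Phase.rank] <;> omega
  | clean d I todo walls =>
    have := (h.todo_clean hs).2
    cases d <;> simp only [Phase.rank] <;> omega
  | done => simp [Phase.rank]

/-- Each pending line weighs two units in `Phase.rank`, for the start and the end of its cleaning.
The offsets `6 * pot n` leave room for the at most `3 * pot n` lines with which a side begins. -/
lemma Step.progress {P : Finset Plane} {C : Set Plane} {W : Finset ℝ} {O : Oracle} {s s' : State}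
    (hstep : Step P O s s') (h : PhaseInv P C W s) (h' : PhaseInv P C W s') :
    s'.queries = s.queries + 1 ∨
      (s'.queries = s.queries ∧ s'.phase.rank P.card < s.phase.rank P.card) := by
  cases hstep with
  | seekRound q hs hin hq => exact Or.inl (State.learn_queries _ _ _)
  | seekFail hs hin hU => exact Or.inr ⟨rfl, by rw [hs]; simp [Phase.rank]⟩
  | seekSuccess hs hne => exact Or.inr ⟨rfl, by rw [hs]; simp [Phase.rank]⟩
  | climbRound e q hs hq => exact Or.inl (State.learn_queries _ _ _)
  | climbRightEnd hs ha => exact Or.inr ⟨rfl, by rw [hs]; simp [Phase.rank]⟩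
  | climbLeftEnd hs ha =>
    refine Or.inr ⟨rfl, ?_⟩
    have := (h'.todo_sweep rfl).2
    rw [hs]
    simp only [State.startSide, Phase.rank]
    omega
  | cleanStart d todo walls t hs ht =>
    refine Or.inr ⟨rfl, ?_⟩
    have := Set.ncard_sdiff_singleton_add_one ht (h.todo_sweep hs).1
    rw [hs]
    cases d <;> simp only [Phase.rank] <;> omega
  | cleanQuery d I todo walls u hs hu => exact Or.inl (State.learn_queries _ _ _)
  | cleanEnd d todo walls hs =>
    refine Or.inr ⟨rfl, ?_⟩
    rw [hs]
    cases d <;> simp only [Phase.rank] <;> omega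
  | pocketSmall d walls a b q hs hab hlt hq => exact Or.inl (State.learn_queries _ _ _)
  | pocketOutside d walls a b q g hs hab hle hq hqO => exact Or.inl (State.learn_queries _ _ _)
  | pocketSplit d walls a b q hs hab hle hq hqO => exact Or.inl (State.learn_queries _ _ _)
  | aboveEnd walls hs hempty =>
    refine Or.inr ⟨rfl, ?_⟩
    have := (h'.todo_sweep rfl).2
    rw [hs]
    simp only [State.startSide, Phase.rank]
    omega
  | belowEnd walls hs hempty => exact Or.inr ⟨rfl, by rw [hs]; simp [Phase.rank]⟩

lemma not_exists_infinite_run {P : Finset Plane} {C : Set Plane} {W : Finset ℝ} {O : Oracle}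
    (hO : IsSeparationOracle O C) (hC : Convex ℝ C) (hCb : Bornology.IsBounded C)
    (hW : FenceAbscissas P C W) :
    ¬ ∃ run : ℕ → State, run 0 = State.initial P ∧ ∀ i, Step P O (run i) (run (i + 1)) := by
  rintro ⟨run, h0, hrun⟩
  have hreach : ∀ i, Reachable P O (run i) := by
    intro i
    induction i with
    | zero => rw [h0]; exact Relation.ReflTransGen.refl
    | succ i ih => exact ih.tail (hrun i)
  have hinv := fun i => (hreach i).invariants hO hC hCb hW
  -- `K` exceeds every rank, so one query outweighs any increase of the rank.
  let K := 12 * pot P.card + 9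
  let μ : ℕ → ℕ := fun i =>
    (totalCost P.card W.card - (run i).queries) * K + (run i).phase.rank P.card
  have hμ : ∀ i, μ (i + 1) + 1 ≤ μ i := by
    intro i
    have hq := (hinv (i + 1)).2.queries_le hC hCb hW
    have hr := (hinv (i + 1)).2.rank_le
    rcases (hrun i).progress (hinv i).2 (hinv (i + 1)).2 with h | ⟨h, hlt⟩
    · have e : totalCost P.card W.card - (run i).queries =
        (totalCost P.card W.card - (run (i + 1)).queries) + 1 := by omega
      simp only [μ]
      rw [e, add_mul, one_mul]
      omega
    · simp only [μ]
      rw [h]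
      omega
  have hsum : ∀ i, μ i + i ≤ μ 0 := by
    intro i
    induction i with
    | zero => exact le_rfl
    | succ i ih => have := hμ i; omega
  have := hsum (μ 0 + 1)
  omega

lemma exists_roundQuery {S : Set Plane} (hS : S.Finite) (hne : S.Nonempty) :
    ∃ q, IsRoundQuery S q := by
  rcases lt_or_ge S.ncard 3 with h | h
  · obtain ⟨q, hq⟩ := hne
    exact ⟨q, Or.inl ⟨h, hq⟩⟩
  · obtain ⟨q, hq⟩ := exists_centerpoint hS.toFinset (by simpa using hne)
    exact ⟨q, Or.inr ⟨h, by simpa using hq⟩⟩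

/-- The algorithm does not get stuck. -/
lemma exists_step {P : Finset Plane} {C : Set Plane} {W : Finset ℝ} {O : Oracle} {s : State}
    (hbase : BaseInv P C s) (h : PhaseInv P C W s) (hs : s.phase ≠ .done) :
    ∃ s', Step P O s s' := by
  have hpocket : ∀ (d : Side) (walls : Set ℝ), s.phase = .sweep d ∅ walls →
      (∃ s', Step P O s s') ∨ ∀ a b, Consecutive walls a b → s.pocket d a b = ∅ := by
    intro d walls hph
    by_cases hall : ∀ a b, Consecutive walls a b → s.pocket d a b = ∅
    · exact Or.inr hall
    · push Not at hall
      obtain ⟨a, b, hab, hne⟩ := hall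
      left
      obtain ⟨q, hq⟩ := exists_roundQuery (hbase.finite.subset (Set.sep_subset _ _)) hne
      rcases hq with ⟨hlt, hq⟩ | ⟨hle, hq⟩
      · exact ⟨_, .pocketSmall s d walls a b q hph hab hlt hq⟩
      · cases hqO : O q with
        | inside => exact ⟨_, .pocketSplit s d walls a b q hph hab hle hq hqO⟩
        | outside g => exact ⟨_, .pocketOutside s d walls a b q g hph hab hle hq hqO⟩
  cases hph : s.phase with
  | seek =>
    rcases s.inner.eq_empty_or_nonempty with he | he
    · rcases s.unclassified.eq_empty_or_nonempty with hU | hU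
      · exact ⟨_, .seekFail s hph he hU⟩
      · obtain ⟨q, hq⟩ := exists_roundQuery hbase.finite hU
        exact ⟨_, .seekRound s q hph he hq⟩
    · exact ⟨_, .seekSuccess s hph he⟩
  | climb e =>
    rcases (s.ahead e).eq_empty_or_nonempty with hU | hU
    · cases e with
      | right => exact ⟨_, .climbRightEnd s hph hU⟩
      | left => exact ⟨_, .climbLeftEnd s hph hU⟩
    · obtain ⟨q, hq⟩ := exists_roundQuery (hbase.finite.subset (Set.sep_subset _ _)) hU
      exact ⟨_, .climbRound s e q hph hq⟩
  | sweep d todo walls =>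
    rcases todo.eq_empty_or_nonempty with rfl | ⟨t, ht⟩
    · rcases hpocket d walls hph with hstep | hempty
      · exact hstep
      · cases d with
        | above => exact ⟨_, .aboveEnd s walls hph hempty⟩
        | below => exact ⟨_, .belowEnd s walls hph hempty⟩
    · exact ⟨_, .cleanStart s d todo walls t hph ht⟩
  | clean d I todo walls =>
    rcases I.eq_empty_or_nonempty with rfl | hne
    · exact ⟨_, .cleanEnd s d todo walls hph⟩
    · rw [PhaseInv, hph] at h
      obtain ⟨T, V, R, t, -, -, -, hline, -⟩ := h
      obtain ⟨u, hu⟩ := exists_median d hline.finite hne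
      exact ⟨_, .cleanQuery s d I todo walls u hph hu⟩
  | done => exact absurd hph hs

/-! ### The bound -/

lemma totalCost_le {n w : ℕ} (hn : 2 ≤ n) :
    (totalCost n w : ℝ) ≤ 1000 * (1 + (w : ℝ)) * Real.log n ^ 2 := by
  set l := Real.log n with hl
  have hN : (pot n : ℝ) ≤ 5 * l := pot_le_log hn
  have hN2 : (pot (n ^ 2) : ℝ) ≤ 10 * l := pot_sq_le_log hn
  -- This absorbs the constant in `splitCost` and the linear term into multiples of `l` and `l ^ 2`;
  -- it gives the 17 as `5 + 10 + 2`.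
  have hl1 : 1 ≤ 2 * l := by
    have h1 : Real.log 2 ≤ l := Real.log_le_log two_pos (by exact_mod_cast hn)
    have := Real.log_two_gt_d9
    linarith
  have hl0 : 0 ≤ l := by linarith
  have e : (totalCost n w : ℝ) = 3 * pot n + 6 * (pot n * (pot n + pot (n ^ 2))) +
      2 * (2 * w + 1) * ((pot n + pot (n ^ 2) + 1) * pot n) := by
    simp only [totalCost, baseCost, sideCost, splitCost]
    push_cast
    ring
  have h1 : (pot n : ℝ) * (pot n + pot (n ^ 2)) ≤ 5 * l * (15 * l) :=
    mul_le_mul hN (by linarith) (by positivity) (by positivity)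
  have h2 : ((pot n : ℝ) + pot (n ^ 2) + 1) * pot n ≤ 17 * l * (5 * l) :=
    mul_le_mul (by linarith) hN (by positivity) (by positivity)
  have h3 : 2 * (2 * (w : ℝ) + 1) * (((pot n : ℝ) + pot (n ^ 2) + 1) * pot n) ≤
      2 * (2 * w + 1) * (17 * l * (5 * l)) := mul_le_mul_of_nonneg_left h2 (by positivity)
  have h4 : l ≤ 2 * l * l := by nlinarith
  have h5 : 0 ≤ (w : ℝ) * l ^ 2 := by positivity
  rw [e]
  nlinarith

theorem mainTheorem2 :
    ∃ K : ℝ, 0 < K ∧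
      ∀ (P : Finset Plane) (C : ConvexBody Plane) (O : Oracle),
        IsSeparationOracle O (C : Set Plane) →
        -- every run is finite
        (¬ ∃ run : ℕ → State, run 0 = State.initial P ∧ ∀ i, Step P O (run i) (run (i + 1))) ∧
        -- and a run that cannot be continued is done and every point has been classified correctly
        (∀ s : State, Reachable P O s → (¬ ∃ s', Step P O s s') →
          s.phase = Phase.done ∧
          s.markedIn = (P : Set Plane) ∩ (C : Set Plane) ∧
          s.markedOut = (P : Set Plane) \ (C : Set Plane)) ∧
        -- the number of queries
        (2 ≤ P.card → ∀ s : State, Reachable P O s →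
          (s.queries : ℝ) ≤
            K * (1 + (separationPrice P (C : Set Plane) : ℝ)) * Real.log (P.card : ℝ) ^ 2) ∧
        -- comparison with any correct query algorithm on the same instance
        (∀ (A : QueryAlgorithm), A.Classifies P →
          ∀ (k : ℕ) (S : Set Plane), A.Produces O [] k S →
            separationPrice P (C : Set Plane) ≤ k ∧
            (2 ≤ P.card → ∀ s : State, Reachable P O s →
              (s.queries : ℝ) ≤ K * Real.log (P.card : ℝ) ^ 2 * (k : ℝ))) := by
  -- The constant 1000 suffices against `1 + ϖ`; it is doubled for the comparison, where `1 + ϖ ≤ 1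
  -- + k ≤ 2k`.
  refine ⟨2000, by norm_num, fun P C O hO => ?_⟩
  obtain ⟨W, hW, hWc⟩ := exists_fenceAbscissas P C
  have hC := C.convex
  have hCb := C.isCompact.isBounded
  have hqueries : 2 ≤ P.card → ∀ s : State, Reachable P O s → (s.queries : ℝ) ≤
      1000 * (1 + (separationPrice P (C : Set Plane) : ℝ)) * Real.log (P.card : ℝ) ^ 2 := by
    intro hn s hs
    obtain ⟨-, hph⟩ := hs.invariants hO hC hCb hW
    have h1 : (s.queries : ℝ) ≤ totalCost P.card W.card := by
      exact_mod_cast hph.queries_le hC hCb hW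
    have h2 : (W.card : ℝ) ≤ separationPrice P (C : Set Plane) := by exact_mod_cast hWc
    refine h1.trans ((totalCost_le hn).trans ?_)
    gcongr
  refine ⟨not_exists_infinite_run hO hC hCb hW, fun s hs hstuck => ?_, fun hn s hs => ?_,
    fun A hA k S hk => ⟨hA.separationPrice_le hO hk, fun hn s hs => ?_⟩⟩
  · obtain ⟨hbase, hph⟩ := hs.invariants hO hC hCb hW
    have hdone : s.phase = .done := by
      by_contra hne
      exact hstuck (exists_step hbase hph hne)
    rw [PhaseInv, hdone] at hph
    -- Marks are always sound, so once nothing is unclassified they are also complete.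
    have htot := hbase.subset_union
    rw [hph.1, Set.empty_union] at htot
    refine ⟨hdone, Set.Subset.antisymm hbase.markedIn_subset fun p hp => ?_,
      Set.Subset.antisymm hbase.markedOut_subset fun p hp => ?_⟩
    · exact (htot hp.1).resolve_right fun h => (hbase.markedOut_subset h).2 hp.2
    · exact (htot hp.1).resolve_left fun h => hp.2 (hbase.markedIn_subset h).2
  · refine (hqueries hn s hs).trans ?_
    gcongr
    norm_num
  · refine (hqueries hn s hs).trans ?_
    have h1 : (separationPrice P (C : Set Plane) : ℝ) ≤ k := by
      exact_mod_cast hA.separationPrice_le hO hk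
    have h2 : (1 : ℝ) ≤ k := by
      exact_mod_cast hA.pos_of_nonempty (Finset.card_pos.1 (by omega)) hO hk
    have h3 : 0 ≤ Real.log (P.card : ℝ) ^ 2 := sq_nonneg _
    nlinarith
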